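/- Consider three bodies with arbitrary positive masses $m_1,m_2,m_3$, positions $q_i\in\mathbb{R}^4$ and momenta $p_i\in\mathbb{R}^4$, moving under Newtonian gravity in $\mathbb{R}^4$, with energy $$H=\frac12\sum_i\frac{|p_i|^2}{m_i}-\sum_{i<j}\frac{m_im_j}{|q_i-q_j|}$$ and angular momentum $J=\sum_i (q_ip_i^t-p_iq_i^t)\in\mathfrak{so}(4)$. The phase space $\mathcal{P}$ is the set of states with $\sum_i m_iq_i=0$, $\sum_i p_i=0$ and pairwise distinct $q_i$. Let $L$ be any antisymmetric $4\times4$ matrix of rank $4$, and let $\mathcal{P}_L=\{z\in\mathcal{P}: J(z)=L\}$. The fully reduced space is $\mathcal{P}_L/SO(4)_L$, where $SO(4)_L$ is the isotropy group of $L$ and rotations act simultaneously on all positions and momenta. (1) Compact integral manifolds. The energy $H$ attains a minimum $E_0$ on $\mathcal{P}_L$. There is $\varepsilon>0$ such that for every $E\in(E_0,E_0+\varepsilon)$ the set $\{z\in\mathcal{P}_L : H(z)=E\}$ is non-empty and compact, and at each of its points the first integrals $(\sum_i m_iq_i,\ \sum_i p_i,\ J,\ H)$, as a map into $\mathbb{R}^4\times\mathbb{R}^4\times\mathfrak{so}(4)\times\mathbb{R}$,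 are a submersion; so it is a compact submanifold of dimension $9$. (2) Nonlinear stability. Let $z\in\mathcal{P}_L$ be any local (for instance global) minimum of $H$ restricted to $\mathcal{P}_L$. Then: (a) $z$ is a relative equilibrium with $4$-dimensional motion: there is $\Omega\in\mathfrak{so}(4)$ such that $t\mapsto\exp(t\Omega)z$ is a motion of the three bodies, and the positions of the bodies along it span $\mathbb{R}^4$. (b) The class of $z$ is isolated in $\mathcal{P}_L/SO(4)_L$ among the classes of local minima of $H|_{\mathcal{P}_L}$. (c) $z$ is Lyapunov stable in the fully reduced system: every neighbourhood $U$ of the class of $z$ in $\mathcal{P}_L/SO(4)_L$ contains a neighbourhood $V$ of this class such that every motion that starts at a state whose class is in $V$ exists for all $t\in\mathbb{R}$ and its class remains in $U$. The same is true with $\mathcal{P}/SO(4)$ in place of $\mathcal{P}_L/SO(4)_L$, that is, when $L$ is perturbed as well. (d) There are a neighbourhood $W$ of $z$ in $\mathcal{P}$ and constants $r>0$, $C$ such that every motion that starts in $W$ exists for all $t\in\mathbb{R}$, remains bounded by $C$ in positions and momenta, and has all mutual distances at least $r$. -/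

import Mathlib

open Topology

noncomputable section

namespace ThreeBody

/-- Four-dimensional Euclidean space. -/
abbrev Space : Type := EuclideanSpace ℝ (Fin 4)

/-- States `(q, p)` of three bodies: the positions `q i` and the momenta `p i`. -/
abbrev State : Type := (Fin 3 → Space) × (Fin 3 → Space)

/-- The phase space: no two bodies at the same place, the centre of mass at the origin, and
total momentum zero. -/
def phaseSpace (m : Fin 3 → ℝ) : Set State :=
  {z | Function.Injective z.1 ∧ ∑ i, m i • z.1 i = 0 ∧ ∑ i, z.2 i = 0}

/-- The energy: kinetic energy plus Newtonian potential. -/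
def energy (m : Fin 3 → ℝ) (z : State) : ℝ :=
  (1 / 2) * ∑ i, ‖z.2 i‖ ^ 2 / m i
    - ∑ i, ∑ j ∈ Finset.Ioi i, m i * m j / ‖z.1 i - z.1 j‖

/-- The angular momentum `∑ i, (q i) (p i)ᵀ - (p i) (q i)ᵀ`. -/
def angularMomentum (z : State) : Matrix (Fin 4) (Fin 4) ℝ :=
  ∑ i, (Matrix.vecMulVec (z.1 i).ofLp (z.2 i).ofLp - Matrix.vecMulVec (z.2 i).ofLp (z.1 i).ofLp)

/-- The right-hand side of Hamilton's equations: `q i' = p i / m i` and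
`p i' = ∑ j, m i m j (q j - q i) / ‖q j - q i‖ ^ 3` (the term `j = i` is zero). -/
def vectorField (m : Fin 3 → ℝ) (z : State) : State :=
  (fun i => (m i)⁻¹ • z.2 i,
   fun i => ∑ j, (m i * m j / ‖z.1 j - z.1 i‖ ^ 3) • (z.1 j - z.1 i))

/-- A motion defined for all time, without collisions, in the centre of mass frame. -/
def IsMotion (m : Fin 3 → ℝ) (γ : ℝ → State) : Prop :=
  ∀ t, γ t ∈ phaseSpace m ∧ HasDerivAt γ (vectorField m (γ t)) t

/-- The dimension of a motion: the dimension of the smallest linear subspace in which the three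
bodies stay for all time. -/
def motionDim (γ : ℝ → State) : ℕ :=
  Module.finrank ℝ (Submodule.span ℝ {x : Space | ∃ t i, (γ t).1 i = x})

/-- The linear map `R` applied to all positions and all momenta. -/
def rotate (R : Matrix (Fin 4) (Fin 4) ℝ) (z : State) : State :=
  (fun i => WithLp.toLp 2 (R.mulVec (z.1 i).ofLp), fun i => WithLp.toLp 2 (R.mulVec (z.2 i).ofLp))

/-- The curve `t ↦ exp (t Ω) z`. -/
def uniformRotation (Ω : Matrix (Fin 4) (Fin 4) ℝ) (z : State) (t : ℝ) : State :=
  rotate (NormedSpace.exp (t • Ω)) z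

/-- The states of phase space with angular momentum `L`. -/
def momentumLevel (m : Fin 3 → ℝ) (L : Matrix (Fin 4) (Fin 4) ℝ) : Set State :=
  {z | z ∈ phaseSpace m ∧ angularMomentum z = L}

/-- The states of phase space with angular momentum `L` and energy `E`. -/
def integralManifold (m : Fin 3 → ℝ) (L : Matrix (Fin 4) (Fin 4) ℝ) (E : ℝ) : Set State :=
  {z | z ∈ momentumLevel m L ∧ energy m z = E}

/-- All first integrals: (mass times) centre of mass, total momentum, angular momentum, energy. -/
def firstIntegrals (m : Fin 3 → ℝ) (z : State) :
    Space × Space × (Fin 4 → Fin 4 → ℝ) × ℝ :=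
  (∑ i, m i • z.1 i, ∑ i, z.2 i, fun a b => angularMomentum z a b, energy m z)

/-- The first integrals, as a map into `ℝ⁴ × ℝ⁴ × so(4) × ℝ`, are a submersion at `z`. -/
def IsRegularPoint (m : Fin 3 → ℝ) (z : State) : Prop :=
  DifferentiableAt ℝ (firstIntegrals m) z ∧
    Set.range (fderiv ℝ (firstIntegrals m) z) = {v | ∀ a b, v.2.2.1 a b = -v.2.2.1 b a}

theorem rotate_one (z : State) : rotate 1 z = z := by
  simp [rotate]

theorem rotate_mul (R S : Matrix (Fin 4) (Fin 4) ℝ) (z : State) :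
    rotate (R * S) z = rotate R (rotate S z) := by
  simp [rotate, Matrix.mulVec_mulVec]

/-- Two states in `S` are equivalent if a rotation in `SO(4)` takes one to the other. -/
def orbitSetoid (S : Set State) : Setoid S where
  r z w := ∃ R ∈ Matrix.specialOrthogonalGroup (Fin 4) ℝ, rotate R z.1 = w.1
  iseqv := by
    refine ⟨fun z => ⟨1, one_mem _, rotate_one _⟩, ?_, ?_⟩
    · rintro z w ⟨R, hR, h⟩
      have hR' := Matrix.mem_specialOrthogonalGroup_iff.1 hR
      refine ⟨R.transpose, ?_, ?_⟩
      · refine Matrix.mem_specialOrthogonalGroup_iff.2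
          ⟨(Matrix.mem_orthogonalGroup_iff _ _).2 ?_, ?_⟩
        · simpa using (Matrix.mem_orthogonalGroup_iff' _ _).1 hR'.1
        · rw [Matrix.det_transpose, hR'.2]
      · rw [← h, ← rotate_mul, (Matrix.mem_orthogonalGroup_iff' _ _).1 hR'.1, rotate_one]
    · rintro x y z ⟨R, hR, h⟩ ⟨R', hR', h'⟩
      exact ⟨R' * R, mul_mem hR' hR, by rw [rotate_mul, h, h']⟩

/-- The quotient of `S` by rotations, with the quotient topology. For `S = phaseSpace m` this is
the quotient of the phase space by `SO(4)`. For `S = momentumLevel m L` this is the fully reduced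
space, the quotient of the level set of `L` by the isotropy group of `L`: a rotation that takes
one state with angular momentum `L` to another satisfies `R L Rᵀ = L`. -/
abbrev Reduced (S : Set State) : Type := Quotient (orbitSetoid S)

/-- The class of a state in the reduced space. -/
def toReduced (S : Set State) (z : S) : Reduced S := Quotient.mk (orbitSetoid S) z

/-- Lyapunov stability of the class of `z` for the dynamics on the quotient of `S` by rotations:
every neighbourhood `U` of the class contains, for all time, all reduced motions that start in
some neighbourhood `V` of it (these motions exist for all time). -/
def IsReducedStable (m : Fin 3 → ℝ) (S : Set State) (z : S) : Prop :=
  ∀ U ∈ 𝓝 (toReduced S z), ∃ V ∈ 𝓝 (toReduced S z), ∀ w : S, toReduced S w ∈ V →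
    (∃ γ, IsMotion m γ ∧ γ 0 = w.1) ∧
    ∀ γ, IsMotion m γ → γ 0 = w.1 → ∀ t, ∃ h : γ t ∈ S, toReduced S ⟨γ t, h⟩ ∈ U

end ThreeBody

end

/-! In a mass-orthonormal frame of the space orthogonal to the centre of mass, a state consists of
two Jacobi vectors X, Y with momenta P, Q, and its angular momentum is X ∧ P + Y ∧ Q. If L is
invertible, X, P, Y, Q form a basis of ℝ⁴, and the Pfaffian of L is their signed volume.

Compactness. Let σ be the smallest singular value of L. A vector orthogonal to Y and Q sees only X ∧
P, so |X||P| ≥ σ in every frame. A frame with X parallel to a given side turns this into a lower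
bound for the kinetic energy times the squared side (`le_kinetic_mul_side_sq`). This excludes
collisions at bounded energy, and it bounds the energy of a binary with a distant third body from
below by that of a circular binary with angular momentum σ. Trial states lie strictly below that
bound (`exists_energy_lt_escape`): a body at distance R can carry the rest of L at a kinetic cost of
order R⁻², while its attraction gains order R⁻¹. Hence some sublevel set reaching above the infimum
is compact.

Critical points. By Lagrange multipliers, a non-regular point with invertible L is a relative
equilibrium (`exists_isRelEq_of_not_isRegularPoint`), and a local minimum cannot be regular because
a submersion is open.

Finiteness (`finite_relEq_shapes`) is the core. Since Ω² is symmetric, the Gram matrix of X, Y and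
the matrix of accelerations commute; diagonalise both, with entries I, J and A, B. If κ = ⟪X, Q⟫ is
not zero, then A = B, the triangle is equilateral and L fixes its size. If κ = 0, the two invariants
of L fix the sum and the product of I²A and J²B. For each such pair of values and each angle of the
principal axes, the ratio I/J is unique and depends analytically on the angle, and the size follows.
The remaining equation is analytic in the angle. Either it has finitely many zeros per period, or it
holds identically; the latter forces equal masses and again an equilateral triangle of fixed size
(`finite_balanced_shapes`).

Consequences. The energy of a relative equilibrium depends only on its shape, by the virial
relation, so the levels just above the minimum contain none and are regular. Shape, L and the sign
of κ determine a relative equilibrium up to rotation, because they fix the Gram matrix of X, P, Y, Q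
(`IsRelEq.exists_rotation`). Relative equilibria are therefore isolated modulo rotation, and a local
minimum is automatically strict modulo rotation.

Stability (`exists_trap`). Strictness makes the first integrals at z differ from all their values on
the boundary of a small compact neighbourhood of the orbit. These boundary values form a compact
set, so the same holds for all starting states near z, with L free to vary, and their motions cannot
reach the boundary. -/

noncomputable section

namespace ThreeBody

open Filter Set

local notation "⟪" x ", " y "⟫" => inner ℝ x y

section

/-! ### Planar triangles with weights -/

/-- The inverse cube of the square root. -/
def invCube (s : ℝ) : ℝ := s ^ (-(3 / 2) : ℝ)

theorem invCube_pos {s : ℝ} (hs : 0 < s) : 0 < invCube s := Real.rpow_pos_of_pos hs _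

theorem invCube_mul {s t : ℝ} (hs : 0 ≤ s) (ht : 0 ≤ t) :
    invCube (s * t) = invCube s * invCube t := Real.mul_rpow hs ht

theorem invCube_injOn {s t : ℝ} (hs : 0 < s) (ht : 0 < t) (h : invCube s = invCube t) : s = t :=
  (Real.rpow_left_inj hs.le ht.le (by norm_num)).1 h

theorem invCube_sq {r : ℝ} (hr : 0 < r) : invCube (r ^ 2) = (r ^ 3)⁻¹ := by
  rw [invCube, ← Real.rpow_natCast r 2, ← Real.rpow_mul hr.le, ← Real.rpow_natCast r 3,
    ← Real.rpow_neg hr.le]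
  norm_num

theorem hasDerivAt_invCube {s : ℝ} (hs : 0 < s) :
    HasDerivAt invCube (-(3 / 2) * (invCube s / s)) s := by
  have h := Real.hasDerivAt_rpow_const (x := s) (p := -(3 / 2)) (Or.inl hs.ne')
  rw [Real.rpow_sub_one hs.ne'] at h
  exact h

theorem contDiffAt_invCube {n : WithTop ℕ∞} {s : ℝ} (hs : 0 < s) : ContDiffAt ℝ n invCube s :=
  Real.contDiffAt_rpow_const_of_ne hs.ne'

theorem strictConvexOn_invCube : StrictConvexOn ℝ (Ioi 0) invCube := by
  refine StrictMonoOn.strictConvexOn_of_deriv (convex_Ioi 0)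
    (fun s hs => (hasDerivAt_invCube hs).continuousAt.continuousWithinAt) ?_
  rw [interior_Ioi]
  intro s (hs : 0 < s) t (ht : 0 < t) hst
  rw [(hasDerivAt_invCube hs).deriv, (hasDerivAt_invCube ht).deriv]
  have h1 : invCube t < invCube s := Real.rpow_lt_rpow_of_neg hs hst (by norm_num)
  have h2 : invCube t / t < invCube s / s :=
    div_lt_div₀ h1 hst.le (invCube_pos hs).le hs
  linarith

/-- The sides of a triangle, in the coordinates of an orthonormal frame of the plane of weighted
triangles: they add up to zero, and their weighted second moments are `M` times the identity. -/
structure TriangleFrame (μ : Fin 3 → ℝ) (M : ℝ) (α β : Fin 3 → ℝ) : Prop where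
  sum_left : ∑ k, α k = 0
  sum_right : ∑ k, β k = 0
  sq_left : ∑ k, μ k * α k ^ 2 = M
  sq_right : ∑ k, μ k * β k ^ 2 = M
  cross : ∑ k, μ k * (α k * β k) = 0

/-- The first vector of a frame that is rotated by the angle `φ`. -/
def rotFst {ι : Type*} (φ : ℝ) (α β : ι → ℝ) (k : ι) : ℝ := Real.cos φ * α k + Real.sin φ * β k

/-- The second vector of a frame that is rotated by the angle `φ`. -/
def rotSnd {ι : Type*} (φ : ℝ) (α β : ι → ℝ) (k : ι) : ℝ := -Real.sin φ * α k + Real.cos φ * β k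

/-- The condition that decides about the ratio `t` of the principal moments of inertia. -/
def ratioFun (μ : Fin 3 → ℝ) (c d : ℝ) (α β : Fin 3 → ℝ) (t : ℝ) : ℝ :=
  ∑ k, μ k * (d * t ^ 2 * α k ^ 2 - c * β k ^ 2) * invCube (α k ^ 2 * t + β k ^ 2)

section

variable {μ : Fin 3 → ℝ} {M : ℝ} {α β : Fin 3 → ℝ}

theorem TriangleFrame.rotate (h : TriangleFrame μ M α β) (φ : ℝ) :
    TriangleFrame μ M (rotFst φ α β) (rotSnd φ α β) := by
  have hc := Real.sin_sq_add_cos_sq φ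
  obtain ⟨h1, h2, h3, h4, h5⟩ := h
  simp only [Fin.sum_univ_three] at h1 h2 h3 h4 h5
  constructor <;> simp only [Fin.sum_univ_three, rotFst, rotSnd]
  · linear_combination Real.cos φ * h1 + Real.sin φ * h2
  · linear_combination -Real.sin φ * h1 + Real.cos φ * h2
  · linear_combination Real.cos φ ^ 2 * h3 + Real.sin φ ^ 2 * h4 +
      2 * Real.cos φ * Real.sin φ * h5 + M * hc
  · linear_combination Real.sin φ ^ 2 * h3 + Real.cos φ ^ 2 * h4 -
      2 * Real.cos φ * Real.sin φ * h5 + M * hc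
  · linear_combination -Real.cos φ * Real.sin φ * h3 + Real.cos φ * Real.sin φ * h4 +
      (Real.cos φ ^ 2 - Real.sin φ ^ 2) * h5

theorem TriangleFrame.swap (h : TriangleFrame μ M α β) : TriangleFrame μ M β α :=
  ⟨h.2, h.1, h.4, h.3, by simpa only [mul_comm (β _)] using h.5⟩

/-- The sides of a triangle frame are pairwise independent. -/
theorem TriangleFrame.det_ne_zero (h : TriangleFrame μ M α β) (hM : 0 < M) {i j : Fin 3}
    (hij : i ≠ j) : α i * β j - α j * β i ≠ 0 := by
  obtain ⟨h1, h2, h3, h4, h5⟩ := h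
  simp only [Fin.sum_univ_three] at h1 h2 h3 h4 h5
  have e0 : α 2 = -α 0 - α 1 := by linarith
  have e1 : β 2 = -β 0 - β 1 := by linarith
  -- The determinant of the second moment matrix, by Cauchy–Binet. As the sides add up to zero,
  -- their three 2 × 2 determinants agree up to sign.
  have key : M ^ 2 = (α 0 * β 1 - α 1 * β 0) ^ 2 * (μ 0 * μ 1 + μ 0 * μ 2 + μ 1 * μ 2) := by
    have : M ^ 2 = (μ 0 * α 0 ^ 2 + μ 1 * α 1 ^ 2 + μ 2 * α 2 ^ 2) *
        (μ 0 * β 0 ^ 2 + μ 1 * β 1 ^ 2 + μ 2 * β 2 ^ 2) -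
        (μ 0 * (α 0 * β 0) + μ 1 * (α 1 * β 1) + μ 2 * (α 2 * β 2)) ^ 2 := by
      rw [h3, h4, h5]; ring
    rw [this, e0, e1]; ring
  have hδ : α 0 * β 1 - α 1 * β 0 ≠ 0 := by
    intro h0; rw [h0] at key; nlinarith
  have c02 : α 0 * β 2 - α 2 * β 0 = -(α 0 * β 1 - α 1 * β 0) := by rw [e0, e1]; ring
  have c12 : α 1 * β 2 - α 2 * β 1 = α 0 * β 1 - α 1 * β 0 := by rw [e0, e1]; ring
  intro h0
  apply hδ
  fin_cases i <;> fin_cases j <;> simp at hij h0 <;> linarith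

theorem TriangleFrame.sq_add_sq_pos (h : TriangleFrame μ M α β) (hM : 0 < M) (k : Fin 3) :
    0 < α k ^ 2 + β k ^ 2 := by
  have hk : k ≠ k + 1 := by fin_cases k <;> decide
  have := h.det_ne_zero hM hk
  rcases eq_or_ne (α k) 0 with h0 | h0
  · rcases eq_or_ne (β k) 0 with h1 | h1
    · simp [h0, h1] at this
    · positivity
  · positivity

theorem TriangleFrame.side_pos (h : TriangleFrame μ M α β) (hM : 0 < M) (k : Fin 3) {s t : ℝ}
    (hs : 0 < s) (ht : 0 < t) : 0 < α k ^ 2 * s + β k ^ 2 * t := by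
  have := h.sq_add_sq_pos hM k
  rcases eq_or_ne (α k) 0 with h0 | h0
  · rw [h0] at this ⊢
    have : 0 < β k ^ 2 := by simpa using this
    positivity
  · positivity

theorem TriangleFrame.exists_left_ne (h : TriangleFrame μ M α β) (hM : 0 < M) :
    ∃ k, α k ≠ 0 := by
  by_contra! h0
  have := h.sq_left
  simp [h0] at this
  linarith

/-- The exponent 3/2 of the force is smaller than the exponent 2 of `t`: the negative contribution
`-(3/2) d t² α⁴` is absorbed by `2 d t² α⁴`, and every summand of the derivative is non-negative. -/
theorem hasDerivAt_ratioFun (h : TriangleFrame μ M α β) (hμ : ∀ k, 0 < μ k) (hM : 0 < M) {c d : ℝ}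
    (hc : 0 < c) (hd : 0 < d) {t : ℝ} (ht : 0 < t) :
    ∃ e > 0, HasDerivAt (ratioFun μ c d α β) e t := by
  have hs : ∀ k, 0 < α k ^ 2 * t + β k ^ 2 := fun k => by
    simpa using h.side_pos hM k ht one_pos
  refine ⟨∑ k, (μ k * (invCube (α k ^ 2 * t + β k ^ 2) / (α k ^ 2 * t + β k ^ 2)) *
    (α k ^ 2 * (d * t * (t * α k ^ 2 / 2 + 2 * β k ^ 2) + 3 / 2 * c * β k ^ 2))), ?_, ?_⟩
  · obtain ⟨k, hk⟩ := h.exists_left_ne hM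
    refine Finset.sum_pos' (fun j _ => ?_) ⟨k, Finset.mem_univ _, ?_⟩
    · have := invCube_pos (hs j)
      have := hs j
      have := hμ j
      positivity
    · have := invCube_pos (hs k)
      have := hs k
      have := hμ k
      positivity
  · unfold ratioFun
    refine HasDerivAt.fun_sum fun k _ => ?_
    have h1 : HasDerivAt (fun t : ℝ => μ k * (d * t ^ 2 * α k ^ 2 - c * β k ^ 2))
        (μ k * (d * (2 * t) * α k ^ 2)) t := by
      have := ((((hasDerivAt_pow 2 t).const_mul d).mul_const (α k ^ 2)).sub_const
        (c * β k ^ 2)).const_mul (μ k)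
      convert! this using 1
      norm_num
    have h2 : HasDerivAt (fun t : ℝ => α k ^ 2 * t + β k ^ 2) (α k ^ 2) t := by
      simpa using ((hasDerivAt_id t).const_mul (α k ^ 2)).add_const (β k ^ 2)
    have h3 := h1.mul ((hasDerivAt_invCube (hs k)).comp t h2)
    convert! h3 using 1
    have := (hs k).ne'
    simp only [Function.comp]
    field_simp
    ring

theorem ratioFun_strictMonoOn (h : TriangleFrame μ M α β) (hμ : ∀ k, 0 < μ k) (hM : 0 < M)
    {c d : ℝ} (hc : 0 < c) (hd : 0 < d) : StrictMonoOn (ratioFun μ c d α β) (Ioi 0) := by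
  have hdv := fun t (ht : (0 : ℝ) < t) => hasDerivAt_ratioFun h hμ hM hc hd ht
  refine strictMonoOn_of_deriv_pos (convex_Ioi 0) (fun t ht => ?_) fun t ht => ?_
  · obtain ⟨e, -, he⟩ := hdv t ht
    exact he.continuousAt.continuousWithinAt
  · rw [interior_Ioi] at ht
    obtain ⟨e, he0, he⟩ := hdv t ht
    rwa [he.deriv]

/-- As `t` tends to zero, the terms with `d` vanish, and the terms with `c` have a negative limit.
Sides with `β k = 0` do not spoil this: their weight grows only like `t ^ (-3/2)`, against the
factor `t ^ 2`. -/
theorem exists_ratioFun_neg (h : TriangleFrame μ M α β) (hμ : ∀ k, 0 < μ k) (hM : 0 < M)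
    {c d : ℝ} (hc : 0 < c) : ∃ t > 0, ratioFun μ c d α β t < 0 := by
  have h1 : ∀ k, Tendsto (fun t => t ^ 2 * α k ^ 2 * invCube (α k ^ 2 * t + β k ^ 2))
      (𝓝[>] 0) (𝓝 0) := by
    intro k
    rcases eq_or_ne (α k) 0 with h0 | h0
    · simp [h0]
    have hb : Tendsto (fun t : ℝ => t ^ (1 / 2 : ℝ) * (α k ^ 2 * invCube (α k ^ 2)))
        (𝓝[>] 0) (𝓝 0) := by
      have : Tendsto (fun t : ℝ => t ^ (1 / 2 : ℝ)) (𝓝[>] 0) (𝓝 0) := by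
        have := (Real.continuousAt_rpow_const 0 (1 / 2) (Or.inr (by norm_num))).tendsto
        rw [Real.zero_rpow (by norm_num)] at this
        exact this.mono_left nhdsWithin_le_nhds
      simpa using this.mul_const (α k ^ 2 * invCube (α k ^ 2))
    refine tendsto_of_tendsto_of_tendsto_of_le_of_le' tendsto_const_nhds hb ?_ ?_
    · filter_upwards [self_mem_nhdsWithin] with t (ht : 0 < t)
      have := invCube_pos (s := α k ^ 2 * t + β k ^ 2) (by positivity)
      positivity
    · filter_upwards [self_mem_nhdsWithin] with t (ht : 0 < t)
      have h2 : invCube (α k ^ 2 * t + β k ^ 2) ≤ invCube (α k ^ 2 * t) :=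
        Real.rpow_le_rpow_of_nonpos (by positivity) (by nlinarith [sq_nonneg (β k)])
          (by norm_num)
      rw [invCube_mul (by positivity) ht.le] at h2
      have h3 : t ^ 2 * invCube t = t ^ (1 / 2 : ℝ) := by
        rw [invCube, ← Real.rpow_natCast t 2, ← Real.rpow_add ht]
        norm_num
      calc _ ≤ t ^ 2 * α k ^ 2 * (invCube (α k ^ 2) * invCube t) := by gcongr
        _ = t ^ 2 * invCube t * (α k ^ 2 * invCube (α k ^ 2)) := by ring
        _ = _ := by rw [h3]
  have h2 : ∀ k, Tendsto (fun t => β k ^ 2 * invCube (α k ^ 2 * t + β k ^ 2))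
      (𝓝[>] 0) (𝓝 (β k ^ 2 * invCube (β k ^ 2))) := by
    intro k
    rcases eq_or_ne (β k) 0 with h0 | h0
    · simp [h0]
    refine Tendsto.const_mul _ ?_
    have h4 : ContinuousAt invCube (β k ^ 2) := (hasDerivAt_invCube (by positivity)).continuousAt
    have h3 : Tendsto (fun t : ℝ => α k ^ 2 * t + β k ^ 2) (𝓝[>] 0) (𝓝 (β k ^ 2)) := by
      have : Continuous fun t : ℝ => α k ^ 2 * t + β k ^ 2 := by fun_prop
      have := this.tendsto 0
      simp only [mul_zero, zero_add] at this
      exact this.mono_left nhdsWithin_le_nhds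
    exact h4.tendsto.comp h3
  have h3 : Tendsto (ratioFun μ c d α β) (𝓝[>] 0)
      (𝓝 (∑ k, (μ k * d * 0 - μ k * c * (β k ^ 2 * invCube (β k ^ 2))))) := by
    have := tendsto_finsetSum (Finset.univ : Finset (Fin 3)) fun k _ =>
      ((h1 k).const_mul (μ k * d)).sub ((h2 k).const_mul (μ k * c))
    refine this.congr fun t => Finset.sum_congr rfl fun k _ => ?_
    ring
  have h4 : ∑ k, (μ k * d * 0 - μ k * c * (β k ^ 2 * invCube (β k ^ 2))) < 0 := by
    obtain ⟨k, hk⟩ := h.swap.exists_left_ne hM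
    have hnn : ∀ j, 0 ≤ invCube (β j ^ 2) := fun j => Real.rpow_nonneg (by positivity) _
    refine Finset.sum_neg' (fun j _ => ?_) ⟨k, Finset.mem_univ _, ?_⟩
    · have := hnn j
      have := hμ j
      have : 0 ≤ μ j * c * (β j ^ 2 * invCube (β j ^ 2)) := by positivity
      linarith
    · have := invCube_pos (s := β k ^ 2) (by positivity)
      have := hμ k
      have : 0 < μ k * c * (β k ^ 2 * invCube (β k ^ 2)) := by positivity
      linarith
  obtain ⟨t, ht, ht'⟩ := ((h3.eventually_lt_const h4).and self_mem_nhdsWithin).exists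
  exact ⟨t, ht', ht⟩

/-- Exchanging the principal axes inverts the ratio, so a positive value for large ratios follows
from a negative value for small ones. -/
theorem ratioFun_inv {c d : ℝ} {t : ℝ} (ht : 0 < t) :
    ratioFun μ c d α β t = -(t ^ 2 * invCube t) * ratioFun μ d c β α t⁻¹ := by
  unfold ratioFun
  rw [Finset.mul_sum]
  refine Finset.sum_congr rfl fun k _ => ?_
  have : α k ^ 2 * t + β k ^ 2 = t * (β k ^ 2 * t⁻¹ + α k ^ 2) := by
    field_simp; ring
  rw [this, invCube_mul ht.le (by positivity)]
  field_simp
  ring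

theorem existsUnique_ratioFun_eq_zero (h : TriangleFrame μ M α β) (hμ : ∀ k, 0 < μ k) (hM : 0 < M)
    {c d : ℝ} (hc : 0 < c) (hd : 0 < d) : ∃! t, 0 < t ∧ ratioFun μ c d α β t = 0 := by
  obtain ⟨t, ht, hft⟩ := exists_ratioFun_neg (d := d) h hμ hM hc
  obtain ⟨s, hs, hfs⟩ := exists_ratioFun_neg (d := c) h.swap hμ hM hd
  have hs' : 0 < ratioFun μ c d α β s⁻¹ := by
    rw [ratioFun_inv (inv_pos.2 hs), inv_inv]
    have := invCube_pos (inv_pos.2 hs)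
    have : 0 < s⁻¹ ^ 2 * invCube s⁻¹ := by positivity
    nlinarith
  have hcont : ContinuousOn (ratioFun μ c d α β) (Ioi 0) := fun t ht => by
    obtain ⟨e, -, he⟩ := hasDerivAt_ratioFun h hμ hM hc hd ht
    exact he.continuousAt.continuousWithinAt
  obtain ⟨u, hu, hu0⟩ := isPreconnected_Ioi.intermediate_value (mem_Ioi.2 ht)
    (mem_Ioi.2 (inv_pos.2 hs)) hcont ⟨hft.le, hs'.le⟩
  exact ⟨u, ⟨hu, hu0⟩, fun v hv => (ratioFun_strictMonoOn h hμ hM hc hd).injOn hv.1 hu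
    (hv.2.trans hu0.symm)⟩

end

end

/-! ### Affine relations under strict convexity, and analytic dependence of the ratio on the angle
-/

section

/-- Three values of a strictly convex function that satisfy two affine relations with non-zero
coefficients belong to the same point. -/
theorem eq_of_affine_relations {f : ℝ → ℝ} {S : Set ℝ} (hf : StrictConvexOn ℝ S f)
    {w s : Fin 3 → ℝ} (hw : ∀ k, w k ≠ 0) (hs : ∀ k, s k ∈ S) (h0 : ∑ k, w k = 0)
    (h1 : ∑ k, w k * s k = 0) (h2 : ∑ k, w k * f (s k) = 0) : s 0 = s 1 ∧ s 1 = s 2 := by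
  -- Among three non-zero weights with sum zero, two have the same sign. The third point is then a
  -- convex combination of their points, and equality in the convexity inequality makes these
  -- coincide.
  have key : ∀ u v w x y z : ℝ, x ∈ S → y ∈ S → 0 < u → 0 < v → u + v + w = 0 →
      u * x + v * y + w * z = 0 → u * f x + v * f y + w * f z = 0 → x = y ∧ y = z := by
    intro u v w x y z hx hy hu hv e0 e1 e2
    have hw : w = -(u + v) := by linarith
    have huv : 0 < u + v := by positivity
    have hz : z = (u / (u + v)) • x + (v / (u + v)) • y := by
      simp only [smul_eq_mul]
      field_simp
      rw [hw] at e1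
      linarith
    by_cases hxy : x = y
    · refine ⟨hxy, ?_⟩
      rw [hz, hxy, ← add_smul, ← add_div, div_self huv.ne', one_smul]
    · exfalso
      have := hf.2 hx hy hxy (div_pos hu huv) (div_pos hv huv) (by field_simp)
      rw [← hz, smul_eq_mul, smul_eq_mul, div_mul_eq_mul_div, div_mul_eq_mul_div, ← add_div,
        lt_div_iff₀ huv] at this
      rw [hw] at e2
      linarith
  have key' : ∀ u v w x y z : ℝ, x ∈ S → y ∈ S → u < 0 → v < 0 → u + v + w = 0 →
      u * x + v * y + w * z = 0 → u * f x + v * f y + w * f z = 0 → x = y ∧ y = z := by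
    intro u v w x y z hx hy hu hv e0 e1 e2
    exact key (-u) (-v) (-w) x y z hx hy (by linarith) (by linarith) (by linarith) (by linarith)
      (by linarith)
  simp only [Fin.sum_univ_three] at h0 h1 h2
  rcases lt_or_gt_of_ne (hw 0) with a | a <;> rcases lt_or_gt_of_ne (hw 1) with b | b <;>
    rcases lt_or_gt_of_ne (hw 2) with c | c
  · exact key' _ _ _ _ _ _ (hs 0) (hs 1) a b h0 h1 h2
  · exact key' _ _ _ _ _ _ (hs 0) (hs 1) a b h0 h1 h2
  · obtain ⟨e, e'⟩ := key' _ _ (w 1) _ _ (s 1) (hs 0) (hs 2) a c (by linarith) (by linarith)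
      (by linarith)
    exact ⟨by linarith, by linarith⟩
  · obtain ⟨e, e'⟩ := key _ _ (w 0) _ _ (s 0) (hs 1) (hs 2) b c (by linarith) (by linarith)
      (by linarith)
    exact ⟨by linarith, by linarith⟩
  · obtain ⟨e, e'⟩ := key' _ _ (w 0) _ _ (s 0) (hs 1) (hs 2) b c (by linarith) (by linarith)
      (by linarith)
    exact ⟨by linarith, by linarith⟩
  · obtain ⟨e, e'⟩ := key _ _ (w 1) _ _ (s 1) (hs 0) (hs 2) a c (by linarith) (by linarith)
      (by linarith)
    exact ⟨by linarith, by linarith⟩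
  · exact key _ _ _ _ _ _ (hs 0) (hs 1) a b h0 h1 h2
  · exact key _ _ _ _ _ _ (hs 0) (hs 1) a b h0 h1 h2

theorem finite_zeros_Icc {g : ℝ → ℝ} (hg : AnalyticOnNhd ℝ g univ) (h : ∃ x, g x ≠ 0) (a b : ℝ) :
    {x ∈ Icc a b | g x = 0}.Finite := by
  by_contra hinf
  obtain ⟨x, -, hx⟩ := Set.Infinite.exists_accPt_of_subset_isCompact hinf isCompact_Icc
    (fun y hy => hy.1)
  rw [accPt_iff_frequently_nhdsNE] at hx
  obtain ⟨y, hy⟩ := h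
  exact hy (hg.eqOn_zero_of_preconnected_of_frequently_eq_zero isPreconnected_univ (mem_univ x)
    (hx.mono fun z hz => hz.2) (mem_univ y))

section

variable {μ : Fin 3 → ℝ} {M : ℝ} {α β : Fin 3 → ℝ} {c d : ℝ}

/-- The ratio of the principal moments of inertia, as a function of the angle of the principal
axes. -/
theorem exists_contDiff_ratio (h : TriangleFrame μ M α β) (hμ : ∀ k, 0 < μ k) (hM : 0 < M)
    (hc : 0 < c) (hd : 0 < d) : ∃ T : ℝ → ℝ, ContDiff ℝ ⊤ T ∧ ∀ φ t,
      (0 < t ∧ ratioFun μ c d (rotFst φ α β) (rotSnd φ α β) t = 0) ↔ t = T φ := by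
  choose T hT hT' using fun φ => existsUnique_ratioFun_eq_zero (h.rotate φ) hμ hM hc hd
  refine ⟨T, ?_, fun φ t => ⟨fun ht => hT' φ t ht, fun ht => ht ▸ hT φ⟩⟩
  -- The order `⊤` of differentiability is `ω`, so this is analyticity. The implicit function
  -- theorem applies because the derivative in the ratio is positive, and uniqueness of the positive
  -- zero identifies the implicit function with `T`.
  rw [contDiff_iff_contDiffAt]
  intro φ
  let F : ℝ × ℝ → ℝ := fun u => ratioFun μ c d (rotFst u.1 α β) (rotSnd u.1 α β) u.2
  have hF : ContDiffAt ℝ ⊤ F (φ, T φ) := by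
    refine ContDiffAt.sum fun k _ => ?_
    have hs := (h.rotate φ).side_pos hM k (hT φ).1 one_pos
    have h1 : ContDiff ℝ ⊤ fun u : ℝ × ℝ => rotFst u.1 α β k := by
      unfold rotFst
      exact ((Real.contDiff_cos.comp contDiff_fst).mul contDiff_const).add
        ((Real.contDiff_sin.comp contDiff_fst).mul contDiff_const)
    have h2 : ContDiff ℝ ⊤ fun u : ℝ × ℝ => rotSnd u.1 α β k := by
      unfold rotSnd
      exact ((Real.contDiff_sin.comp contDiff_fst).neg.mul contDiff_const).add
        ((Real.contDiff_cos.comp contDiff_fst).mul contDiff_const)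
    have h3 : ContDiffAt ℝ ⊤ (fun u : ℝ × ℝ =>
        invCube (rotFst u.1 α β k ^ 2 * u.2 + rotSnd u.1 α β k ^ 2)) (φ, T φ) := by
      refine ContDiffAt.comp (g := invCube) (φ, T φ) (contDiffAt_invCube (by simpa using hs)) ?_
      exact (((h1.pow 2).mul contDiff_snd).add (h2.pow 2)).contDiffAt
    refine ContDiffAt.mul (ContDiff.contDiffAt ?_) h3
    exact contDiff_const.mul (((contDiff_const.mul (contDiff_snd.pow 2)).mul (h1.pow 2)).sub
      (contDiff_const.mul (h2.pow 2)))
  obtain ⟨e, he0, he⟩ := hasDerivAt_ratioFun (h.rotate φ) hμ hM hc hd (hT φ).1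
  have hinv : (fderiv ℝ F (φ, T φ) ∘L .inr ℝ ℝ ℝ).IsInvertible := by
    refine ⟨ContinuousLinearEquiv.smulLeft (Units.mk0 e he0.ne'), ?_⟩
    ext
    have h1 : HasFDerivAt F (fderiv ℝ F (φ, T φ)) (φ, T φ) :=
      (hF.differentiableAt (by simp)).hasFDerivAt
    have h2 : HasDerivAt (fun t : ℝ => ((φ, t) : ℝ × ℝ)) (0, 1) (T φ) :=
      (hasDerivAt_const _ _).prodMk (hasDerivAt_id _)
    have h3 := (h1.comp_hasDerivAt (T φ) h2).unique he
    simpa using h3.symm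
  have hψ := hF.contDiffAt_implicitFunction (by simp) hinv
  refine hψ.congr_of_eventuallyEq ?_
  have e0 : F (φ, T φ) = 0 := (hT φ).2
  have e1 := hF.eventually_apply_implicitFunction (by simp) hinv
  have e2 : ∀ᶠ x in 𝓝 φ, 0 < hF.implicitFunction (by simp) hinv x := by
    refine hψ.continuousAt.eventually_const_lt ?_
    rw [hF.implicitFunction_apply_self (by simp) hinv]
    exact (hT φ).1
  filter_upwards [e1, e2] with x hx1 hx2
  exact (hT' x _ ⟨hx2, hx1.trans e0⟩).symm

/-- The left side is the sum over `j` of `μ j` times the squared determinant of the sides `j` and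
`k`. The term `j = k` vanishes, and the other two determinants agree up to sign. -/
theorem TriangleFrame.sq_add_sq (h : TriangleFrame μ M α β) (k : Fin 3) :
    M * (α k ^ 2 + β k ^ 2) = (μ (k + 1) + μ (k + 2)) * (α k * β (k + 1) - α (k + 1) * β k) ^ 2 := by
  obtain ⟨h1, h2, h3, h4, h5⟩ := h
  simp only [Fin.sum_univ_three] at h1 h2 h3 h4 h5
  have e0 : α 2 = -α 0 - α 1 := by linarith
  have e1 : β 2 = -β 0 - β 1 := by linarith
  rw [e0] at h3 h5
  rw [e1] at h4 h5
  fin_cases k <;> simp [e0, e1]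
  · linear_combination (-β 0 ^ 2) * h3 - (α 0) ^ 2 * h4 + 2 * α 0 * β 0 * h5
  · linear_combination (-β 1 ^ 2) * h3 - (α 1) ^ 2 * h4 + 2 * α 1 * β 1 * h5
  · linear_combination (-(β 0 + β 1) ^ 2) * h3 - (α 0 + α 1) ^ 2 * h4 +
      2 * (α 0 + α 1) * (β 0 + β 1) * h5

end

end

/-! ### Finiteness of balanced triangles -/

section

section

variable {μ : Fin 3 → ℝ} {M : ℝ} {α β : Fin 3 → ℝ} {c d : ℝ}

theorem rot_sq_add_sq {ι : Type*} (φ : ℝ) (α β : ι → ℝ) (k : ι) :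
    rotFst φ α β k ^ 2 + rotSnd φ α β k ^ 2 = α k ^ 2 + β k ^ 2 := by
  unfold rotFst rotSnd
  linear_combination (α k ^ 2 + β k ^ 2) * Real.sin_sq_add_cos_sq φ

/-- The frame is turned by the polar angle of the vector `(α k, β k)`, which puts this side on the
first axis. -/
theorem exists_rotSnd_eq_zero {ι : Type*} (α β : ι → ℝ) (k : ι) : ∃ φ, rotSnd φ α β k = 0 := by
  refine ⟨Complex.arg ⟨α k, β k⟩, ?_⟩
  have h1 := Complex.norm_mul_cos_arg ⟨α k, β k⟩
  have h2 := Complex.norm_mul_sin_arg ⟨α k, β k⟩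
  simp only at h1 h2
  unfold rotSnd
  linear_combination (-Real.cos (Complex.arg ⟨α k, β k⟩)) * h2 +
    Real.sin (Complex.arg ⟨α k, β k⟩) * h1

theorem exists_mem_Icc_rot_eq {ι : Type*} (φ : ℝ) (α β : ι → ℝ) :
    ∃ ψ ∈ Icc 0 (2 * Real.pi), rotFst ψ α β = rotFst φ α β ∧ rotSnd ψ α β = rotSnd φ α β := by
  have h := toIcoMod_mem_Ico Real.two_pi_pos 0 φ
  refine ⟨toIcoMod Real.two_pi_pos 0 φ, ⟨h.1, by simpa using h.2.le⟩, ?_, ?_⟩ <;>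
  · ext k
    rw [toIcoMod]
    simp only [rotFst, rotSnd, zsmul_eq_mul, Real.cos_sub_int_mul_two_pi,
      Real.sin_sub_int_mul_two_pi]

/-- If the side `k` lies along the first axis and the mixed condition holds at every ratio, then
the weights of the other two sides agree. -/
theorem weight_eq_of_cross_eq_zero (h : TriangleFrame μ M α β) (hμ : ∀ k, 0 < μ k) (hM : 0 < M)
    {t : ℝ} (ht : 0 < t) {k : Fin 3} (hk : β k = 0)
    (hg : ∑ k, μ k * (α k * β k) * invCube (α k ^ 2 * t + β k ^ 2) = 0) :
    μ (k + 1) = μ (k + 2) := by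
  have hs : ∀ k, 0 < α k ^ 2 * t + β k ^ 2 := fun k => by simpa using h.side_pos hM k ht one_pos
  -- With `u = 0` the other two sides have second coordinates `v` and `-v`. The cross moment gives
  -- `p y = q z`, the mixed condition gives equal lengths and hence `y = z` or `y = -z`, and the
  -- latter would make `x` zero.
  have key : ∀ x y z : ℝ, ∀ u v w : ℝ, ∀ p q : ℝ, 0 < p → 0 < q → x ≠ 0 → x + y + z = 0 →
      u = 0 → u + v + w = 0 → v ≠ 0 → p * (y * v) + q * (z * w) = 0 → 0 < y ^ 2 * t + v ^ 2 →
      0 < z ^ 2 * t + w ^ 2 → p * (y * v) * invCube (y ^ 2 * t + v ^ 2) +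
        q * (z * w) * invCube (z ^ 2 * t + w ^ 2) = 0 → p = q := by
    intro x y z u v w p q hp hq hx e1 hu e2 hv e3 s1 s2 e4
    have hw : w = -v := by linarith
    subst hw
    have e5 : p * y = q * z := by
      have : v * (p * y - q * z) = 0 := by linarith
      have := (mul_eq_zero.1 this).resolve_left hv
      linarith
    have hy : p * y ≠ 0 := by
      intro h0
      have y0 : y = 0 := (mul_eq_zero.1 h0).resolve_left hp.ne'
      have z0 : z = 0 := (mul_eq_zero.1 (e5 ▸ h0)).resolve_left hq.ne'
      apply hx; linarith
    have e6 : invCube (y ^ 2 * t + v ^ 2) = invCube (z ^ 2 * t + (-v) ^ 2) := by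
      have : p * y * v * (invCube (y ^ 2 * t + v ^ 2) - invCube (z ^ 2 * t + (-v) ^ 2)) = 0 := by
        linear_combination e4 - v * invCube (z ^ 2 * t + (-v) ^ 2) * e5
      have := (mul_eq_zero.1 this).resolve_left (mul_ne_zero hy hv)
      linarith
    have e7 := invCube_injOn s1 s2 e6
    have e8 : t * ((y - z) * (y + z)) = 0 := by linear_combination e7
    have e9 := (mul_eq_zero.1 e8).resolve_left ht.ne'
    have e10 : y + z ≠ 0 := fun h0 => hx (by linarith)
    have e11 := (mul_eq_zero.1 e9).resolve_right e10
    have hyz : y = z := by linarith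
    subst hyz
    have y0 : y ≠ 0 := fun h0 => hy (by simp [h0])
    exact mul_right_cancel₀ y0 e5
  have hα : α k ≠ 0 := by
    have := h.sq_add_sq_pos hM k
    rw [hk] at this
    intro h0
    simp [h0] at this
  have hβ : β (k + 1) ≠ 0 := by
    have := h.det_ne_zero hM (i := k) (j := k + 1) (by fin_cases k <;> decide)
    intro h0
    simp [hk, h0] at this
  obtain ⟨h1, h2, h3, h4, h5⟩ := h
  simp only [Fin.sum_univ_three] at h1 h2 h3 h4 h5 hg
  refine key (α k) (α (k + 1)) (α (k + 2)) (β k) (β (k + 1)) (β (k + 2)) _ _ (hμ _) (hμ _) hα ?_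
    hk ?_ hβ ?_ (hs _) (hs _) ?_ <;> clear key <;> fin_cases k <;> simp at hk ⊢ <;> simp [hk] at * <;>
    linarith

theorem TriangleFrame.sq_add_sq_eq (h : TriangleFrame μ M α β) (hM : 0 < M)
    (hμ : ∀ k, μ k = μ 0) (i j : Fin 3) : α i ^ 2 + β i ^ 2 = α j ^ 2 + β j ^ 2 := by
  have key : ∀ k, M * (α k ^ 2 + β k ^ 2) = 2 * μ 0 * (α 0 * β 1 - α 1 * β 0) ^ 2 := by
    intro k
    rw [h.sq_add_sq k, hμ (k + 1), hμ (k + 2)]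
    have h1 := h.sum_left
    have h2 := h.sum_right
    simp only [Fin.sum_univ_three] at h1 h2
    have e0 : α 2 = -α 0 - α 1 := by linarith
    have e1 : β 2 = -β 0 - β 1 := by linarith
    have e2 : (α k * β (k + 1) - α (k + 1) * β k) ^ 2 = (α 0 * β 1 - α 1 * β 0) ^ 2 := by
      fin_cases k <;> simp [e0, e1] <;> ring
    rw [e2]; ring
  exact mul_left_cancel₀ hM.ne' ((key i).trans (key j).symm)

/-- For equal weights, the mixed condition forces equal principal moments of inertia, unless a side
lies along a principal axis. -/
theorem ratio_eq_one_of_cross_eq_zero (h : TriangleFrame μ M α β) (hM : 0 < M)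
    (hμ : ∀ k, μ k = μ 0) {t : ℝ} (ht : 0 < t) (h0 : ∀ k, α k * β k ≠ 0)
    (hg : ∑ k, μ k * (α k * β k) * invCube (α k ^ 2 * t + β k ^ 2) = 0) : t = 1 := by
  have hs : ∀ k, 0 < α k ^ 2 * t + β k ^ 2 := fun k => by simpa using h.side_pos hM k ht one_pos
  have hd := h.sq_add_sq_eq hM hμ
  have hμ0 : μ 0 ≠ 0 := by
    intro h0
    have := h.sq_left
    simp [hμ, h0] at this
    exact hM.ne' this.symm
  obtain ⟨h1, h2, h3, h4, h5⟩ := h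
  simp only [Fin.sum_univ_three, hμ 1, hμ 2] at h1 h2 h3 h4 h5 hg
  have e0 : α 2 = -α 0 - α 1 := by linarith
  have e1 : β 2 = -β 0 - β 1 := by linarith
  have e2 : α 0 * β 0 + α 1 * β 1 + α 2 * β 2 = 0 :=
    mul_left_cancel₀ hμ0 (by linarith)
  -- For equal weights, the products `α k * β k` annihilate the constants, the squared sides (since
  -- the sides add up to zero) and the inverse cubes of the sides.
  have e3 := eq_of_affine_relations strictConvexOn_invCube (w := fun k => α k * β k)
    (s := fun k => α k ^ 2 * t + β k ^ 2) h0 hs (by simpa [Fin.sum_univ_three] using e2) (by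
      simp only [Fin.sum_univ_three]
      rw [e0, e1] at e2 ⊢
      linear_combination (t * (α 0 ^ 2 + α 0 * α 1 + α 1 ^ 2) +
        (β 0 ^ 2 + β 0 * β 1 + β 1 ^ 2)) * e2) (by
      simp only [Fin.sum_univ_three]
      exact mul_left_cancel₀ hμ0 (by linarith))
  -- All `α k ^ 2 * t + β k ^ 2` agree and all `α k ^ 2 + β k ^ 2` agree. If `t ≠ 1`, then all `α k
  -- ^ 2` agree, which is impossible for three non-zero numbers with sum zero.
  by_contra ht1
  have e4 : α 0 ^ 2 = α 1 ^ 2 := by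
    have := hd 0 1
    exact mul_left_cancel₀ (sub_ne_zero.2 ht1) (by linear_combination e3.1 - this)
  have e5 : α 1 ^ 2 = α 2 ^ 2 := by
    have := hd 1 2
    exact mul_left_cancel₀ (sub_ne_zero.2 ht1) (by linear_combination e3.2 - this)
  have e6 : α 1 ≠ 0 := fun h => h0 1 (by simp [h])
  rcases sq_eq_sq_iff_eq_or_eq_neg.1 e4 with e | e
  · rw [e0, e] at e5
    apply e6
    nlinarith
  · rw [e0, e] at e5
    have : α 2 = 0 := by rw [e0, e]; ring
    exact h0 2 (by simp [this])

/-- The triangles that satisfy the equations of balanced configurations with given angular momenta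
are finite in number. -/
theorem finite_balanced_shapes (h : TriangleFrame μ M α β) (hμ : ∀ k, 0 < μ k) (hM : 0 < M)
    (hc : 0 < c) (hd : 0 < d) :
    {s : Fin 3 → ℝ | ∃ φ I J : ℝ, 0 < I ∧ 0 < J ∧
      (∀ k, s k = rotFst φ α β k ^ 2 * I + rotSnd φ α β k ^ 2 * J) ∧
      I ^ 2 * ∑ k, μ k * rotFst φ α β k ^ 2 * invCube (s k) = c ∧
      J ^ 2 * ∑ k, μ k * rotSnd φ α β k ^ 2 * invCube (s k) = d ∧
      ∑ k, μ k * (rotFst φ α β k * rotSnd φ α β k) * invCube (s k) = 0}.Finite := by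
  obtain ⟨T, hT, hT'⟩ := exists_contDiff_ratio h hμ hM hc hd
  have hTpos : ∀ φ, 0 < T φ := fun φ => ((hT' φ _).2 rfl).1
  set A : ℝ → Fin 3 → ℝ := fun φ => rotFst φ α β with hA
  set B : ℝ → Fin 3 → ℝ := fun φ => rotSnd φ α β with hB
  have hAB : ∀ φ, TriangleFrame μ M (A φ) (B φ) := h.rotate
  have hside : ∀ φ k, 0 < A φ k ^ 2 * T φ + B φ k ^ 2 := fun φ k => by
    simpa using (hAB φ).side_pos hM k (hTpos φ) one_pos
  -- At angle `φ` the ratio must be `T φ`. What remains is the mixed condition `g φ = 0`. The size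
  -- is given by `√J * D φ = d`, because `J ^ 2 * invCube J = √J`; this is the factor `(d / D φ) ^
  -- 2` in `S`.
  let g : ℝ → ℝ := fun φ => ∑ k, μ k * (A φ k * B φ k) * invCube (A φ k ^ 2 * T φ + B φ k ^ 2)
  let D : ℝ → ℝ := fun φ => ∑ k, μ k * B φ k ^ 2 * invCube (A φ k ^ 2 * T φ + B φ k ^ 2)
  let S : ℝ → Fin 3 → ℝ := fun φ k => (d / D φ) ^ 2 * (A φ k ^ 2 * T φ + B φ k ^ 2)
  have hDpos : ∀ φ, 0 < D φ := by
    intro φ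
    obtain ⟨k, hk⟩ := (hAB φ).swap.exists_left_ne hM
    refine Finset.sum_pos' (fun j _ => ?_) ⟨k, Finset.mem_univ _, ?_⟩
    · have := invCube_pos (hside φ j)
      have := hμ j
      positivity
    · have := invCube_pos (hside φ k)
      have := hμ k
      positivity
  have hAc : ∀ k, ContDiff ℝ ⊤ fun φ => A φ k := fun k =>
    (Real.contDiff_cos.mul contDiff_const).add (Real.contDiff_sin.mul contDiff_const)
  have hBc : ∀ k, ContDiff ℝ ⊤ fun φ => B φ k := fun k =>
    (Real.contDiff_sin.neg.mul contDiff_const).add (Real.contDiff_cos.mul contDiff_const)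
  have hgc : ContDiff ℝ ⊤ g := by
    refine ContDiff.sum fun k _ => ?_
    refine (contDiff_const.mul ((hAc k).mul (hBc k))).mul ?_
    rw [contDiff_iff_contDiffAt]
    intro φ
    exact ContDiffAt.comp (g := invCube) φ (contDiffAt_invCube (hside φ k))
      ((((hAc k).pow 2).mul hT).add ((hBc k).pow 2)).contDiffAt
  -- every solution comes from a zero of `g`
  have hsol : ∀ s : Fin 3 → ℝ, ∀ φ I J : ℝ, 0 < I → 0 < J →
      (∀ k, s k = A φ k ^ 2 * I + B φ k ^ 2 * J) →
      I ^ 2 * ∑ k, μ k * A φ k ^ 2 * invCube (s k) = c →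
      J ^ 2 * ∑ k, μ k * B φ k ^ 2 * invCube (s k) = d →
      ∑ k, μ k * (A φ k * B φ k) * invCube (s k) = 0 → g φ = 0 ∧ s = S φ := by
    intro s φ I J hI hJ hs h1 h2 h3
    have hs' : ∀ k, s k = J * (A φ k ^ 2 * (I / J) + B φ k ^ 2) := by
      intro k; rw [hs k]; field_simp
    have hpos : ∀ k, 0 < A φ k ^ 2 * (I / J) + B φ k ^ 2 := fun k => by
      simpa using (hAB φ).side_pos hM k (div_pos hI hJ) one_pos
    have hw : ∀ k, invCube (s k) = invCube J * invCube (A φ k ^ 2 * (I / J) + B φ k ^ 2) := by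
      intro k; rw [hs' k, invCube_mul hJ.le (hpos k).le]
    have hJ3 := invCube_pos hJ
    have hTφ : I / J = T φ := by
      rw [← hT' φ]
      refine ⟨div_pos hI hJ, ?_⟩
      have e1 : ratioFun μ c d (A φ) (B φ) (I / J) * invCube J =
          d * (I / J) ^ 2 * (∑ k, μ k * A φ k ^ 2 * invCube (s k)) -
          c * ∑ k, μ k * B φ k ^ 2 * invCube (s k) := by
        unfold ratioFun
        rw [Finset.mul_sum, Finset.mul_sum, ← Finset.sum_sub_distrib, Finset.sum_mul]
        refine Finset.sum_congr rfl fun k _ => ?_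
        rw [hw k]; ring
      have e2 : d * (I / J) ^ 2 * (∑ k, μ k * A φ k ^ 2 * invCube (s k)) -
          c * ∑ k, μ k * B φ k ^ 2 * invCube (s k) = 0 := by
        rw [← h1, ← h2]
        field_simp
        ring
      exact (mul_eq_zero.1 (e1.trans e2)).resolve_right hJ3.ne'
    rw [hTφ] at hw hs'
    constructor
    · have : g φ * invCube J = 0 := by
        rw [← h3, Finset.sum_mul]
        refine Finset.sum_congr rfl fun k _ => ?_
        rw [hw k]; ring
      exact (mul_eq_zero.1 this).resolve_right hJ3.ne'
    · have e3 : J ^ 2 * invCube J * D φ = d := by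
        rw [← h2, mul_assoc, Finset.mul_sum]
        congr 1
        refine Finset.sum_congr rfl fun k _ => ?_
        rw [hw k]; ring
      have e4 : (J ^ 2 * invCube J) ^ 2 = J := by
        have : J ^ 2 * invCube J = J ^ (1 / 2 : ℝ) := by
          rw [invCube, ← Real.rpow_natCast J 2, ← Real.rpow_add hJ]
          norm_num
        rw [this, ← Real.rpow_natCast, ← Real.rpow_mul hJ.le]
        norm_num
      have e5 : J = (d / D φ) ^ 2 := by
        rw [← e3, mul_div_assoc, div_self (hDpos φ).ne', mul_one, e4]
      ext k
      rw [hs' k]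
      simp only [S]
      rw [← e5]
  by_cases hg : ∃ φ, g φ ≠ 0
  · have hfin := finite_zeros_Icc (contDiff_omega_iff_analyticOnNhd.1 hgc) hg 0 (2 * Real.pi)
    refine (hfin.image S).subset ?_
    rintro s ⟨φ, I, J, hI, hJ, hs, h1, h2, h3⟩
    obtain ⟨ψ, hψ, ea, eb⟩ := exists_mem_Icc_rot_eq φ α β
    simp only [← ea, ← eb] at hs h1 h2 h3
    obtain ⟨h4, h5⟩ := hsol s ψ I J hI hJ hs h1 h2 h3
    exact ⟨ψ, ⟨hψ, h4⟩, h5.symm⟩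
  -- The degenerate case: the mixed condition holds at every angle. Turning each side in turn onto
  -- the first axis shows that the weights are equal.
  · push Not at hg
    have hμk : ∀ k : Fin 3, μ (k + 1) = μ (k + 2) := by
      intro k
      obtain ⟨φ, hφ⟩ := exists_rotSnd_eq_zero α β k
      exact weight_eq_of_cross_eq_zero (hAB φ) hμ hM (hTpos φ) hφ (hg φ)
    have hμ0 : ∀ k, μ k = μ 0 := by
      have e0 := hμk 0
      have e1 := hμk 1
      simp at e0 e1
      intro k
      fin_cases k
      · rfl
      · exact e0.trans e1
      · exact e1
    -- The ratio is one at every angle for which no side lies along an axis. A product of analytic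
    -- functions on the line vanishes identically only if a factor does.
    have hT1 : ∀ φ, T φ = 1 := by
      have hprod : AnalyticOnNhd ℝ (fun φ => ∏ k, (A φ k * B φ k)) univ := by
        rw [← contDiff_omega_iff_analyticOnNhd]
        exact contDiff_prod fun k _ => (hAc k).mul (hBc k)
      have hT1c : AnalyticOnNhd ℝ (fun φ => T φ - 1) univ :=
        contDiff_omega_iff_analyticOnNhd.1 (hT.sub contDiff_const)
      have hz : ∀ φ ∈ univ, (T φ - 1) * ∏ k, (A φ k * B φ k) = 0 := by
        intro φ _
        by_cases h0 : ∏ k, (A φ k * B φ k) = 0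
        · rw [h0, mul_zero]
        · rw [ratio_eq_one_of_cross_eq_zero (hAB φ) hM hμ0 (hTpos φ)
            (fun k hk => h0 (Finset.prod_eq_zero (Finset.mem_univ k) hk)) (hg φ)]
          ring
      rcases hT1c.eq_zero_or_eq_zero_of_mul_eq_zero hprod hz isPreconnected_univ with h0 | h0
      · intro φ
        have := h0 φ (mem_univ _)
        linarith
      · exfalso
        have hnz : ∀ k, ¬ ∀ φ ∈ univ, A φ k = 0 := by
          intro k hk
          have e0 := hk 0 (mem_univ _)
          have e1 := hk (Real.pi / 2) (mem_univ _)
          simp [hA, rotFst] at e0 e1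
          have := h.sq_add_sq_pos hM k
          simp [e0, e1] at this
        have hnz' : ∀ k, ¬ ∀ φ ∈ univ, B φ k = 0 := by
          intro k hk
          have e0 := hk 0 (mem_univ _)
          have e1 := hk (Real.pi / 2) (mem_univ _)
          simp [hB, rotSnd] at e0 e1
          have := h.sq_add_sq_pos hM k
          simp [e0, e1] at this
        have han : ∀ k, AnalyticOnNhd ℝ (fun φ => A φ k) univ := fun k =>
          contDiff_omega_iff_analyticOnNhd.1 (hAc k)
        have hbn : ∀ k, AnalyticOnNhd ℝ (fun φ => B φ k) univ := fun k =>
          contDiff_omega_iff_analyticOnNhd.1 (hBc k)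
        have hk0 : ∀ k, ¬ ∀ φ ∈ univ, A φ k * B φ k = 0 := fun k hk =>
          ((han k).eq_zero_or_eq_zero_of_mul_eq_zero (hbn k) hk isPreconnected_univ).elim
            (hnz k) (hnz' k)
        have habn : ∀ k, AnalyticOnNhd ℝ (fun φ => A φ k * B φ k) univ := fun k =>
          (han k).mul (hbn k)
        simp only [Fin.prod_univ_three] at h0
        rcases ((habn 0).mul (habn 1)).eq_zero_or_eq_zero_of_mul_eq_zero (habn 2) h0
          isPreconnected_univ with h1 | h1
        · exact ((habn 0).eq_zero_or_eq_zero_of_mul_eq_zero (habn 1) h1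
            isPreconnected_univ).elim (hk0 0) (hk0 1)
        · exact hk0 2 h1
    -- With equal weights and ratio one, rotation of the axes changes neither the sides nor the
    -- size.
    have hSS : ∀ φ, S φ = S 0 := by
      have hsq := fun i => h.sq_add_sq_eq hM hμ0 i 0
      have e2 : ∀ φ k, A φ k ^ 2 * T φ + B φ k ^ 2 = α 0 ^ 2 + β 0 ^ 2 := by
        intro φ k
        rw [hT1, mul_one, rot_sq_add_sq, hsq]
      have e3 : ∀ φ, D φ = M * invCube (α 0 ^ 2 + β 0 ^ 2) := by
        intro φ
        simp only [D, e2, ← Finset.sum_mul]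
        rw [(hAB φ).sq_right]
      intro φ
      ext k
      simp only [S, e2, e3]
    refine (finite_singleton (S 0)).subset ?_
    rintro s ⟨φ, I, J, hI, hJ, hs, h1, h2, h3⟩
    rw [mem_singleton_iff, (hsol s φ I J hI hJ hs h1 h2 h3).2, hSS]

end

end

section

/-! ### Matrices acting on space -/

/-- The operator of a matrix. -/
def act (R : Matrix (Fin 4) (Fin 4) ℝ) : Space →L[ℝ] Space :=
  Matrix.toEuclideanCLM (n := Fin 4) (𝕜 := ℝ) R

theorem act_ofLp (R : Matrix (Fin 4) (Fin 4) ℝ) (x : Space) :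
    act R x = WithLp.toLp 2 (R.mulVec x.ofLp) := rfl

theorem rotate_eq (R : Matrix (Fin 4) (Fin 4) ℝ) (z : State) :
    rotate R z = (fun i => act R (z.1 i), fun i => act R (z.2 i)) := rfl

theorem act_mul (R S : Matrix (Fin 4) (Fin 4) ℝ) (x : Space) : act (R * S) x = act R (act S x) := by
  simp [act, map_mul]

theorem act_one (x : Space) : act 1 x = x := by
  simp [act]

theorem inner_act (R : Matrix (Fin 4) (Fin 4) ℝ) (x y : Space) :
    ⟪act R x, y⟫ = ⟪x, act R.transpose y⟫ := by
  have : act R.transpose = ContinuousLinearMap.adjoint (act R) := by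
    have := map_star (Matrix.toEuclideanCLM (n := Fin 4) (𝕜 := ℝ)) R
    rw [ContinuousLinearMap.star_eq_adjoint, Matrix.star_eq_conjTranspose,
      Matrix.conjTranspose_eq_transpose_of_trivial] at this
    exact this
  rw [this, ContinuousLinearMap.adjoint_inner_right]

theorem act_injective {R S : Matrix (Fin 4) (Fin 4) ℝ} (h : ∀ x, act R x = act S x) : R = S :=
  (Matrix.toEuclideanCLM (n := Fin 4) (𝕜 := ℝ)).injective (ContinuousLinearMap.ext h)

theorem act_neg (R : Matrix (Fin 4) (Fin 4) ℝ) (x : Space) : act (-R) x = -act R x := by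
  simp [act]

theorem act_add (R S : Matrix (Fin 4) (Fin 4) ℝ) (x : Space) :
    act (R + S) x = act R x + act S x := by
  simp [act]

theorem act_sub (R S : Matrix (Fin 4) (Fin 4) ℝ) (x : Space) :
    act (R - S) x = act R x - act S x := by
  simp [act]

theorem act_smul (c : ℝ) (R : Matrix (Fin 4) (Fin 4) ℝ) (x : Space) :
    act (c • R) x = c • act R x := by
  simp [act]

theorem inner_act_skew {R : Matrix (Fin 4) (Fin 4) ℝ} (hR : R.transpose = -R) (x y : Space) :
    ⟪act R x, y⟫ = -⟪x, act R y⟫ := by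
  rw [inner_act, hR, act_neg, inner_neg_right]

theorem inner_act_self_skew {R : Matrix (Fin 4) (Fin 4) ℝ} (hR : R.transpose = -R) (x : Space) :
    ⟪x, act R x⟫ = 0 := by
  have := inner_act_skew hR x x
  rw [real_inner_comm] at this
  linarith

theorem inner_eq_sum (x y : Space) : ⟪x, y⟫ = ∑ a, x a * y a := by
  simp [PiLp.inner_apply, mul_comm]

/-- The wedge product of two vectors, as a matrix. -/
def wedge (x p : Space) : Matrix (Fin 4) (Fin 4) ℝ :=
  Matrix.vecMulVec x.ofLp p.ofLp - Matrix.vecMulVec p.ofLp x.ofLp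

theorem wedge_apply (x p : Space) (a b : Fin 4) : wedge x p a b = x a * p b - p a * x b := rfl

theorem act_wedge (x p v : Space) : act (wedge x p) v = ⟪p, v⟫ • x - ⟪x, v⟫ • p := by
  ext a
  simp only [inner_eq_sum, act_ofLp, Matrix.mulVec, dotProduct, wedge_apply, PiLp.sub_apply,
    PiLp.smul_apply, smul_eq_mul, Finset.sum_mul, ← Finset.sum_sub_distrib]
  exact Finset.sum_congr rfl fun b _ => by ring

theorem angularMomentum_eq (z : State) : angularMomentum z = ∑ i, wedge (z.1 i) (z.2 i) := rfl

theorem transpose_wedge (x p : Space) : (wedge x p).transpose = -wedge x p := by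
  ext a b
  simp [wedge_apply, Matrix.transpose_apply]
  ring

theorem transpose_angularMomentum (z : State) :
    (angularMomentum z).transpose = -angularMomentum z := by
  rw [angularMomentum_eq, Matrix.transpose_sum, ← Finset.sum_neg_distrib]
  exact Finset.sum_congr rfl fun i _ => transpose_wedge _ _

theorem mul_wedge_mul (R : Matrix (Fin 4) (Fin 4) ℝ) (x p : Space) :
    wedge (act R x) (act R p) = R * wedge x p * R.transpose := by
  apply act_injective
  intro v
  rw [act_mul, act_mul, act_wedge, act_wedge, map_sub, map_smul, map_smul, inner_act, inner_act]

theorem angularMomentum_rotate (R : Matrix (Fin 4) (Fin 4) ℝ) (z : State) :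
    angularMomentum (rotate R z) = R * angularMomentum z * R.transpose := by
  rw [angularMomentum_eq, angularMomentum_eq, Finset.mul_sum, Finset.sum_mul]
  exact Finset.sum_congr rfl fun i _ => mul_wedge_mul _ _ _

theorem norm_act {R : Matrix (Fin 4) (Fin 4) ℝ} (hR : R.transpose * R = 1) (x : Space) :
    ‖act R x‖ = ‖x‖ := by
  rw [← sq_eq_sq₀ (norm_nonneg _) (norm_nonneg _), ← real_inner_self_eq_norm_sq,
    ← real_inner_self_eq_norm_sq, inner_act, ← act_mul, hR, act_one]

theorem act_inj {R : Matrix (Fin 4) (Fin 4) ℝ} (hR : R.transpose * R = 1) :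
    Function.Injective (act R) := fun x y h => by
  rw [← act_one x, ← act_one y, ← hR, act_mul, act_mul, h]

theorem rotate_mem_phaseSpace {m : Fin 3 → ℝ} {R : Matrix (Fin 4) (Fin 4) ℝ}
    (hR : R.transpose * R = 1) {z : State} (hz : z ∈ phaseSpace m) : rotate R z ∈ phaseSpace m := by
  obtain ⟨h1, h2, h3⟩ := hz
  refine ⟨fun i j h => h1 (act_inj hR h), ?_, ?_⟩
  · simp only [rotate_eq, ← map_smul, ← map_sum, h2, map_zero]
  · simp only [rotate_eq, ← map_sum, h3, map_zero]

theorem energy_rotate {m : Fin 3 → ℝ} {R : Matrix (Fin 4) (Fin 4) ℝ}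
    (hR : R.transpose * R = 1) (z : State) : energy m (rotate R z) = energy m z := by
  simp only [energy, rotate_eq, norm_act hR, ← map_sub]

/-! ### Jacobi coordinates -/

/-- The products of two masses. -/
def pairMass (m : Fin 3 → ℝ) (k : Fin 3) : ℝ := m (k + 1) * m (k + 2)

/-- The side opposite to `k`. -/
def side {E : Type*} [Sub E] (a : Fin 3 → E) (k : Fin 3) : E := a (k + 1) - a (k + 2)

theorem pairMass_pos {m : Fin 3 → ℝ} (hm : ∀ i, 0 < m i) (k : Fin 3) : 0 < pairMass m k :=
  mul_pos (hm _) (hm _)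

/-- An orthonormal frame for mass-weighted coordinates orthogonal to the centre of mass. -/
structure MassFrame (m a b : Fin 3 → ℝ) : Prop where
  sum_left : ∑ i, m i * a i = 0
  sum_right : ∑ i, m i * b i = 0
  sq_left : ∑ i, m i * a i ^ 2 = 1
  sq_right : ∑ i, m i * b i ^ 2 = 1
  cross : ∑ i, m i * (a i * b i) = 0
  complete : ∀ i j, m i * (a i * a j + b i * b j) = (if i = j then 1 else 0) - m i / ∑ k, m k

/-- The normalised Jacobi coordinates: the difference of the bodies 0 and 1, and the position of
body 2 relative to their centre of mass. -/
theorem exists_massFrame {m : Fin 3 → ℝ} (hm : ∀ i, 0 < m i) : ∃ a b, MassFrame m a b := by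
  have h0 := hm 0
  have h1 := hm 1
  have h2 := hm 2
  set c := √(m 0 * m 1 / (m 0 + m 1)) with hc
  set e := √(m 2 / ((m 0 + m 1) * (m 0 + m 1 + m 2))) with he
  have hc2 : c ^ 2 = m 0 * m 1 / (m 0 + m 1) := Real.sq_sqrt (by positivity)
  have he2 : e ^ 2 = m 2 / ((m 0 + m 1) * (m 0 + m 1 + m 2)) := Real.sq_sqrt (by positivity)
  clear_value c e
  refine ⟨![c / m 0, -c / m 1, 0], ![e, e, -e * (m 0 + m 1) / m 2], ?_, ?_, ?_, ?_, ?_, ?_⟩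
  · simp [Fin.sum_univ_three]; field_simp; ring
  · simp [Fin.sum_univ_three]; field_simp; ring
  · simp [Fin.sum_univ_three]
    field_simp
    rw [hc2]; field_simp; ring
  · simp [Fin.sum_univ_three]
    field_simp
    rw [he2]; field_simp; ring
  · simp [Fin.sum_univ_three]; field_simp; ring
  · intro i j
    fin_cases i <;> fin_cases j <;> simp [Fin.sum_univ_three] <;> field_simp <;>
      (try rw [hc2]) <;> (try rw [he2]) <;> field_simp <;> ring

section

variable {m a b : Fin 3 → ℝ}

theorem MassFrame.rotate (h : MassFrame m a b) (φ : ℝ) :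
    MassFrame m (rotFst φ a b) (rotSnd φ a b) := by
  have hc := Real.sin_sq_add_cos_sq φ
  obtain ⟨h1, h2, h3, h4, h5, h6⟩ := h
  simp only [Fin.sum_univ_three] at h1 h2 h3 h4 h5
  refine ⟨?_, ?_, ?_, ?_, ?_, fun i j => ?_⟩
  on_goal 6 =>
    rw [← h6 i j]
    simp only [rotFst, rotSnd]
    linear_combination (m i * (a i * a j + b i * b j)) * hc
  all_goals simp only [Fin.sum_univ_three, rotFst, rotSnd]
  · linear_combination Real.cos φ * h1 + Real.sin φ * h2
  · linear_combination -Real.sin φ * h1 + Real.cos φ * h2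
  · linear_combination Real.cos φ ^ 2 * h3 + Real.sin φ ^ 2 * h4 +
      2 * Real.cos φ * Real.sin φ * h5 + hc
  · linear_combination Real.sin φ ^ 2 * h3 + Real.cos φ ^ 2 * h4 -
      2 * Real.cos φ * Real.sin φ * h5 + hc
  · linear_combination -Real.cos φ * Real.sin φ * h3 + Real.cos φ * Real.sin φ * h4 +
      (Real.cos φ ^ 2 - Real.sin φ ^ 2) * h5

theorem side_rotFst (φ : ℝ) (a b : Fin 3 → ℝ) :
    side (rotFst φ a b) = rotFst φ (side a) (side b) := by
  ext k; simp only [side, rotFst]; ring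

theorem side_rotSnd (φ : ℝ) (a b : Fin 3 → ℝ) :
    side (rotSnd φ a b) = rotSnd φ (side a) (side b) := by
  ext k; simp only [side, rotSnd]; ring

/-- Lagrange's identity: the sum of `m i * m j * (a i - a j) ^ 2` over pairs is the total mass times
the second moment, minus the square of the first moment, which is zero. The cross moments are
treated in the same way. -/
theorem MassFrame.triangleFrame (h : MassFrame m a b) :
    TriangleFrame (pairMass m) (∑ i, m i) (side a) (side b) := by
  obtain ⟨h1, h2, h3, h4, h5, -⟩ := h
  simp only [Fin.sum_univ_three] at h1 h2 h3 h4 h5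
  constructor <;> simp [Fin.sum_univ_three, side, pairMass]
  · ring
  · ring
  · linear_combination (m 0 + m 1 + m 2) * h3 - (m 0 * a 0 + m 1 * a 1 + m 2 * a 2) * h1
  · linear_combination (m 0 + m 1 + m 2) * h4 - (m 0 * b 0 + m 1 * b 1 + m 2 * b 2) * h2
  · linear_combination (m 0 + m 1 + m 2) * h5 - (m 0 * a 0 + m 1 * a 1 + m 2 * a 2) * h2

/-- A Jacobi vector of the configuration. -/
def jacobiPos (m c : Fin 3 → ℝ) (z : State) : Space := ∑ i, (m i * c i) • z.1 i

/-- A Jacobi vector of the momenta. -/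
def jacobiMom (c : Fin 3 → ℝ) (z : State) : Space := ∑ i, c i • z.2 i

theorem MassFrame.pos_eq (h : MassFrame m a b) {z : State} (hz : z ∈ phaseSpace m) (i : Fin 3) :
    z.1 i = a i • jacobiPos m a z + b i • jacobiPos m b z := by
  have h1 : ∀ j, m j * (a i * a j + b i * b j) = (if i = j then 1 else 0) - m j / ∑ k, m k := by
    intro j
    rw [mul_comm (a i), mul_comm (b i), h.complete j i]
    simp only [eq_comm]
  have h2 := hz.2.1
  simp only [jacobiPos, Finset.smul_sum, smul_smul, ← Finset.sum_add_distrib, ← add_smul]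
  have h3 : ∀ j, a i * (m j * a j) + b i * (m j * b j) =
      (if i = j then 1 else 0) - (∑ k, m k)⁻¹ * m j := by
    intro j
    rw [← div_eq_inv_mul, ← h1 j]; ring
  simp only [h3, sub_smul, Finset.sum_sub_distrib, mul_smul, ← Finset.smul_sum, h2]
  simp

theorem MassFrame.mom_eq (h : MassFrame m a b) {z : State} (hz : z ∈ phaseSpace m) (i : Fin 3) :
    z.2 i = m i • (a i • jacobiMom a z + b i • jacobiMom b z) := by
  have h2 := hz.2.2
  simp only [jacobiMom, Finset.smul_sum, smul_smul, ← Finset.sum_add_distrib, ← add_smul]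
  have h3 : ∀ j, m i * (a i * a j + b i * b j) = (if i = j then 1 else 0) - m i / ∑ k, m k :=
    h.complete i
  simp only [h3, sub_smul, Finset.sum_sub_distrib, ← Finset.smul_sum, h2]
  simp

theorem MassFrame.side_eq (h : MassFrame m a b) {z : State} (hz : z ∈ phaseSpace m) (k : Fin 3) :
    side z.1 k = side a k • jacobiPos m a z + side b k • jacobiPos m b z := by
  rw [side, h.pos_eq hz (k + 1), h.pos_eq hz (k + 2), side, side, sub_smul, sub_smul]
  abel

/-- Orthonormality removes the cross terms. Two wedges just suffice for rank 4, so in the case of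
rank 4 the four Jacobi vectors must form a basis. -/
theorem MassFrame.angularMomentum_eq (h : MassFrame m a b) {z : State} (hz : z ∈ phaseSpace m) :
    angularMomentum z = wedge (jacobiPos m a z) (jacobiMom a z) +
      wedge (jacobiPos m b z) (jacobiMom b z) := by
  have h3 := h.sq_left
  have h4 := h.sq_right
  have h5 := h.cross
  rw [ThreeBody.angularMomentum_eq]
  have hq := fun i => h.pos_eq hz i
  have hp := fun i => h.mom_eq hz i
  generalize jacobiPos m a z = X at *
  generalize jacobiPos m b z = Y at *
  generalize jacobiMom a z = P at *
  generalize jacobiMom b z = Q at *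
  ext i j
  simp only [hq, hp, Matrix.add_apply, Matrix.sum_apply, wedge_apply, PiLp.add_apply,
    PiLp.smul_apply, smul_eq_mul]
  simp only [Fin.sum_univ_three] at h3 h4 h5 ⊢
  linear_combination (X i * P j - P i * X j) * h3 + (Y i * Q j - Q i * Y j) * h4 +
    (X i * Q j - Q i * X j + Y i * P j - P i * Y j) * h5

theorem MassFrame.kinetic_eq (h : MassFrame m a b) (hm : ∀ i, 0 < m i) {z : State}
    (hz : z ∈ phaseSpace m) :
    ∑ i, ‖z.2 i‖ ^ 2 / m i = ‖jacobiMom a z‖ ^ 2 + ‖jacobiMom b z‖ ^ 2 := by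
  have h3 := h.sq_left
  have h4 := h.sq_right
  have h5 := h.cross
  have hp := fun i => h.mom_eq hz i
  generalize jacobiMom a z = P at *
  generalize jacobiMom b z = Q at *
  have key : ∀ i, ‖z.2 i‖ ^ 2 / m i = m i * a i ^ 2 * ‖P‖ ^ 2 + m i * b i ^ 2 * ‖Q‖ ^ 2 +
      2 * (m i * (a i * b i)) * ⟪P, Q⟫ := by
    intro i
    have := (hm i).ne'
    rw [hp i, norm_smul, mul_pow, norm_add_sq_real, norm_smul, norm_smul, real_inner_smul_left,
      real_inner_smul_right]
    simp only [mul_pow, Real.norm_eq_abs, sq_abs]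
    field_simp
    ring
  simp only [key, Finset.sum_add_distrib, ← Finset.sum_mul, ← Finset.mul_sum, h3, h4, h5]
  ring

theorem energy_eq (m : Fin 3 → ℝ) (z : State) : energy m z =
    (1 / 2) * ∑ i, ‖z.2 i‖ ^ 2 / m i - ∑ k, pairMass m k / ‖side z.1 k‖ := by
  have e0 : (Finset.Ioi (0 : Fin 3)) = {1, 2} := by decide
  have e1 : (Finset.Ioi (1 : Fin 3)) = {2} := by decide
  have e2 : (Finset.Ioi (2 : Fin 3)) = ∅ := by decide
  rw [energy]
  congr 1
  simp only [Fin.sum_univ_three, e0, e1, e2, pairMass, side, Finset.sum_empty,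
    Finset.sum_singleton]
  rw [Finset.sum_pair (by decide), norm_sub_rev (z.1 0) (z.1 2)]
  simp
  ring

theorem side_ne_zero {E : Type*} [AddGroup E] {q : Fin 3 → E} (hq : Function.Injective q)
    (k : Fin 3) : side q k ≠ 0 := by
  rw [side, sub_ne_zero]
  intro h
  have := hq h
  fin_cases k <;> simp at this

theorem injective_of_side_ne_zero {E : Type*} [AddGroup E] {q : Fin 3 → E}
    (h : ∀ k, side q k ≠ 0) : Function.Injective q := by
  have h0 := h 0
  have h1 := h 1
  have h2 := h 2
  simp only [side, sub_ne_zero, ne_eq] at h0 h1 h2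
  simp at h0 h1 h2
  intro i j hij
  fin_cases i <;> fin_cases j <;> simp at hij ⊢
  exacts [h2 hij, h1 hij.symm, h2 hij.symm, h0 hij, h1 hij, h0 hij.symm]

theorem exists_side_eq {E : Type*} [AddGroup E] {q : Fin 3 → E} {i j : Fin 3} (hij : i ≠ j) :
    ∃ k, q i - q j = side q k ∨ q i - q j = -side q k := by
  fin_cases i <;> fin_cases j <;> simp at hij ⊢
  · exact ⟨2, Or.inl rfl⟩
  · exact ⟨1, Or.inr (by simp [side])⟩
  · exact ⟨2, Or.inr (by simp [side])⟩
  · exact ⟨0, Or.inl rfl⟩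
  · exact ⟨1, Or.inl rfl⟩
  · exact ⟨0, Or.inr (by simp [side])⟩

/-- The state with given Jacobi vectors. -/
def ofJacobi (m a b : Fin 3 → ℝ) (X Y P Q : Space) : State :=
  (fun i => a i • X + b i • Y, fun i => m i • (a i • P + b i • Q))

theorem MassFrame.ofJacobi_mem (h : MassFrame m a b) {X Y P Q : Space}
    (hne : ∀ k, side a k • X + side b k • Y ≠ 0) : ofJacobi m a b X Y P Q ∈ phaseSpace m := by
  refine ⟨injective_of_side_ne_zero fun k => ?_, ?_, ?_⟩
  · convert! hne k using 1
    simp only [ofJacobi, side, sub_smul]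
    abel
  · simp only [ofJacobi, smul_add, smul_smul, Finset.sum_add_distrib, ← Finset.sum_smul,
      h.sum_left, h.sum_right, zero_smul, add_zero]
  · simp only [ofJacobi, smul_add, smul_smul, Finset.sum_add_distrib, ← Finset.sum_smul,
      h.sum_left, h.sum_right, zero_smul, add_zero]

theorem MassFrame.jacobiPos_ofJacobi (h : MassFrame m a b) (X Y P Q : Space) :
    jacobiPos m a (ofJacobi m a b X Y P Q) = X ∧ jacobiPos m b (ofJacobi m a b X Y P Q) = Y := by
  have h3 := h.sq_left
  have h4 := h.sq_right
  have h5 := h.cross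
  have e1 : ∀ i, m i * a i * a i = m i * a i ^ 2 := fun i => by ring
  have e2 : ∀ i, m i * a i * b i = m i * (a i * b i) := fun i => by ring
  have e3 : ∀ i, m i * b i * a i = m i * (a i * b i) := fun i => by ring
  have e4 : ∀ i, m i * b i * b i = m i * b i ^ 2 := fun i => by ring
  constructor <;>
  simp only [jacobiPos, ofJacobi, smul_add, smul_smul, Finset.sum_add_distrib, ← Finset.sum_smul,
      e1, e2, e3, e4, h3, h4, h5, zero_smul, one_smul, add_zero, zero_add]

theorem MassFrame.jacobiMom_ofJacobi (h : MassFrame m a b) (X Y P Q : Space) :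
    jacobiMom a (ofJacobi m a b X Y P Q) = P ∧ jacobiMom b (ofJacobi m a b X Y P Q) = Q := by
  have h3 := h.sq_left
  have h4 := h.sq_right
  have h5 := h.cross
  have e1 : ∀ i, a i * (m i * a i) = m i * a i ^ 2 := fun i => by ring
  have e2 : ∀ i, a i * (m i * b i) = m i * (a i * b i) := fun i => by ring
  have e3 : ∀ i, b i * (m i * a i) = m i * (a i * b i) := fun i => by ring
  have e4 : ∀ i, b i * (m i * b i) = m i * b i ^ 2 := fun i => by ring
  constructor <;>
  simp only [jacobiMom, ofJacobi, smul_add, smul_smul, Finset.sum_add_distrib, ← Finset.sum_smul,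
      e1, e2, e3, e4, h3, h4, h5, zero_smul, one_smul, add_zero, zero_add]

end

end

section

/-! ### Derivatives of the first integrals -/

/-- The force on the body `i`. -/
def force (m : Fin 3 → ℝ) (z : State) (i : Fin 3) : Space :=
  ∑ j, (m i * m j / ‖z.1 j - z.1 i‖ ^ 3) • (z.1 j - z.1 i)

theorem vectorField_eq (m : Fin 3 → ℝ) (z : State) :
    vectorField m z = (fun i => (m i)⁻¹ • z.2 i, force m z) := rfl

/-- The coefficient of the attraction along the side `k`. -/
def attraction (m : Fin 3 → ℝ) (z : State) (k : Fin 3) : ℝ := pairMass m k / ‖side z.1 k‖ ^ 3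

theorem force_eq (m : Fin 3 → ℝ) (z : State) (i : Fin 3) :
    force m z i = attraction m z (i + 1) • side z.1 (i + 1) -
      attraction m z (i + 2) • side z.1 (i + 2) := by
  have e : ∀ i j : Fin 3, (m i * m j / ‖z.1 j - z.1 i‖ ^ 3) • (z.1 j - z.1 i) =
      -((m i * m j / ‖z.1 i - z.1 j‖ ^ 3) • (z.1 i - z.1 j)) := by
    intro i j
    rw [norm_sub_rev, ← smul_neg, neg_sub]
  fin_cases i <;> simp [force, Fin.sum_univ_three, attraction, side, pairMass]
  · rw [e 0 1, mul_comm (m 0) (m 2)]; abel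
  · rw [e 1 2, mul_comm (m 1) (m 0)]; abel
  · rw [e 2 0, mul_comm (m 2) (m 1)]; abel

/-- By action and reaction, the work of the forces depends only on the variation of the sides. -/
theorem sum_inner_force (m : Fin 3 → ℝ) (z : State) (u : Fin 3 → Space) :
    ∑ i, ⟪force m z i, u i⟫ = -∑ k, attraction m z k * ⟪side z.1 k, side u k⟫ := by
  simp only [force_eq, inner_sub_left, real_inner_smul_left, Fin.sum_univ_three]
  have e : ∀ k, side u k = u (k + 1) - u (k + 2) := fun k => rfl
  simp only [e, inner_sub_right]
  simp
  ring

theorem sum_force (m : Fin 3 → ℝ) (z : State) : ∑ i, force m z i = 0 := by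
  simp only [force_eq, Fin.sum_univ_three]
  simp

theorem hasDerivAt_inv_norm {v : ℝ → Space} {v' : Space} {t : ℝ} (h : HasDerivAt v v' t)
    (hv : v t ≠ 0) : HasDerivAt (fun t => ‖v t‖⁻¹) (-(⟪v t, v'⟫ / ‖v t‖ ^ 3)) t := by
  have hv' : ‖v t‖ ≠ 0 := norm_ne_zero_iff.2 hv
  have h1 := (h.norm_sq.sqrt (pow_ne_zero 2 hv'))
  simp only [Real.sqrt_sq (norm_nonneg _)] at h1
  have h2 := h1.inv hv'
  convert! h2 using 1
  field_simp

/-- The derivative of the energy in the direction `δ`. -/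
def energyDeriv (m : Fin 3 → ℝ) (z δ : State) : ℝ :=
  ∑ i, ⟪z.2 i, δ.2 i⟫ / m i - ∑ i, ⟪force m z i, δ.1 i⟫

/-- The derivative of the angular momentum in the direction `δ`. -/
def momentumDeriv (z δ : State) : Matrix (Fin 4) (Fin 4) ℝ :=
  ∑ i, (wedge (δ.1 i) (z.2 i) + wedge (z.1 i) (δ.2 i))

theorem hasDerivAt_fst_apply {γ : ℝ → State} {δ : State} {t : ℝ} (h : HasDerivAt γ δ t)
    (i : Fin 3) : HasDerivAt (fun t => (γ t).1 i) (δ.1 i) t :=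
  hasDerivAt_pi.1 (((ContinuousLinearMap.fst ℝ (Fin 3 → Space)
    (Fin 3 → Space)).hasFDerivAt.comp_hasDerivAt t h)) i

theorem hasDerivAt_snd_apply {γ : ℝ → State} {δ : State} {t : ℝ} (h : HasDerivAt γ δ t)
    (i : Fin 3) : HasDerivAt (fun t => (γ t).2 i) (δ.2 i) t :=
  hasDerivAt_pi.1 (((ContinuousLinearMap.snd ℝ (Fin 3 → Space)
    (Fin 3 → Space)).hasFDerivAt.comp_hasDerivAt t h)) i

theorem hasDerivAt_energy {m : Fin 3 → ℝ} {γ : ℝ → State} {δ : State} {t : ℝ}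
    (h : HasDerivAt γ δ t) (hinj : Function.Injective (γ t).1) :
    HasDerivAt (fun t => energy m (γ t)) (energyDeriv m (γ t) δ) t := by
  simp only [energy_eq, energyDeriv, sum_inner_force]
  have h1 : HasDerivAt (fun t => (1 / 2) * ∑ i, ‖(γ t).2 i‖ ^ 2 / m i)
      (∑ i, ⟪(γ t).2 i, δ.2 i⟫ / m i) t := by
    have := (HasDerivAt.fun_sum (u := Finset.univ) fun i _ =>
      ((hasDerivAt_snd_apply h i).norm_sq.div_const (m i))).const_mul (1 / 2)
    convert! this using 1
    rw [Finset.mul_sum]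
    exact Finset.sum_congr rfl fun i _ => by ring
  have h2 : HasDerivAt (fun t => ∑ k, pairMass m k / ‖side (γ t).1 k‖)
      (∑ k, -(attraction m (γ t) k * ⟪side (γ t).1 k, side δ.1 k⟫)) t := by
    refine HasDerivAt.fun_sum fun k _ => ?_
    have hs : HasDerivAt (fun t => side (γ t).1 k) (side δ.1 k) t :=
      (hasDerivAt_fst_apply h _).sub (hasDerivAt_fst_apply h _)
    have := (hasDerivAt_inv_norm hs (side_ne_zero hinj k)).const_mul (pairMass m k)
    convert! this using 1
    rw [attraction]; ring
  convert! h1.sub h2 using 1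
  rw [Finset.sum_neg_distrib]

theorem hasDerivAt_angularMomentum {γ : ℝ → State} {δ : State} {t : ℝ} (h : HasDerivAt γ δ t)
    (a b : Fin 4) :
    HasDerivAt (fun t => angularMomentum (γ t) a b) (momentumDeriv (γ t) δ a b) t := by
  simp only [angularMomentum_eq, momentumDeriv, Matrix.sum_apply, Matrix.add_apply, wedge_apply]
  refine HasDerivAt.fun_sum fun i _ => ?_
  have hq : ∀ a, HasDerivAt (fun t => (γ t).1 i a) (δ.1 i a) t := fun a =>
    (EuclideanSpace.proj a : Space →L[ℝ] ℝ).hasFDerivAt.comp_hasDerivAt t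
      (hasDerivAt_fst_apply h i)
  have hp : ∀ a, HasDerivAt (fun t => (γ t).2 i a) (δ.2 i a) t := fun a =>
    (EuclideanSpace.proj a : Space →L[ℝ] ℝ).hasFDerivAt.comp_hasDerivAt t
      (hasDerivAt_snd_apply h i)
  convert! ((hq a).mul (hp b)).sub ((hp a).mul (hq b)) using 1
  ring

theorem contDiffAt_energy {m : Fin 3 → ℝ} {z : State} (hinj : Function.Injective z.1) :
    ContDiffAt ℝ 1 (energy m) z := by
  have hq : ∀ i, ContDiff ℝ 1 fun z : State => z.1 i := fun i =>
    (ContinuousLinearMap.proj (R := ℝ) (φ := fun _ : Fin 3 => Space) i).contDiff.comp contDiff_fst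
  have hp : ∀ i, ContDiff ℝ 1 fun z : State => z.2 i := fun i =>
    (ContinuousLinearMap.proj (R := ℝ) (φ := fun _ : Fin 3 => Space) i).contDiff.comp contDiff_snd
  have : energy m = fun z => (1 / 2) * ∑ i, ‖z.2 i‖ ^ 2 / m i -
      ∑ k, pairMass m k / ‖side z.1 k‖ := funext (energy_eq m)
  rw [this]
  refine ContDiffAt.sub (ContDiff.contDiffAt ?_) ?_
  · exact contDiff_const.mul (ContDiff.sum fun i _ => ((hp i).norm_sq ℝ).div_const _)
  · refine ContDiffAt.sum fun k _ => contDiffAt_const.div ?_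
      (norm_ne_zero_iff.2 (side_ne_zero hinj k))
    exact ((hq _).sub (hq _)).contDiffAt.norm ℝ (side_ne_zero hinj k)

theorem contDiffAt_firstIntegrals {m : Fin 3 → ℝ} {z : State} (hinj : Function.Injective z.1) :
    ContDiffAt ℝ 1 (firstIntegrals m) z := by
  have hq : ∀ i, ContDiff ℝ 1 fun z : State => z.1 i := fun i =>
    (ContinuousLinearMap.proj (R := ℝ) (φ := fun _ : Fin 3 => Space) i).contDiff.comp contDiff_fst
  have hp : ∀ i, ContDiff ℝ 1 fun z : State => z.2 i := fun i =>
    (ContinuousLinearMap.proj (R := ℝ) (φ := fun _ : Fin 3 => Space) i).contDiff.comp contDiff_snd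
  have hπ : ∀ a : Fin 4, ContDiff ℝ 1 fun x : Space => x a := fun a =>
    (EuclideanSpace.proj a : Space →L[ℝ] ℝ).contDiff
  unfold firstIntegrals
  refine ContDiffAt.prodMk ?_ (ContDiffAt.prodMk ?_ (ContDiffAt.prodMk ?_ (contDiffAt_energy hinj)))
  · have h : ∀ i, ContDiff ℝ 1 fun z : State => m i • z.1 i := fun i =>
      (contDiff_const (c := m i)).fun_smul (hq i)
    exact (ContDiff.sum fun i _ => h i).contDiffAt
  · exact (ContDiff.sum fun i _ => hp i).contDiffAt
  · refine contDiffAt_pi.2 fun a => contDiffAt_pi.2 fun b => ContDiff.contDiffAt ?_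
    simp only [angularMomentum_eq, Matrix.sum_apply, wedge_apply]
    exact ContDiff.sum fun i _ => (((hπ a).comp (hq i)).mul ((hπ b).comp (hp i))).sub
      (((hπ a).comp (hp i)).mul ((hπ b).comp (hq i)))

theorem fderiv_firstIntegrals {m : Fin 3 → ℝ} {z : State} (hinj : Function.Injective z.1)
    (δ : State) : fderiv ℝ (firstIntegrals m) z δ =
      (∑ i, m i • δ.1 i, ∑ i, δ.2 i, fun a b => momentumDeriv z δ a b, energyDeriv m z δ) := by
  have hline : HasDerivAt (fun t : ℝ => z + t • δ) δ 0 := by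
    simpa using ((hasDerivAt_id (0 : ℝ)).smul_const δ).const_add z
  have e0 : z + (0 : ℝ) • δ = z := by simp
  have h0 : HasFDerivAt (firstIntegrals m) (fderiv ℝ (firstIntegrals m) z) (z + (0 : ℝ) • δ) := by
    rw [e0]
    exact ((contDiffAt_firstIntegrals (m := m) hinj).differentiableAt (by norm_num)).hasFDerivAt
  have h1 := h0.comp_hasDerivAt 0 hline
  refine h1.unique ?_
  refine HasDerivAt.prodMk ?_ (HasDerivAt.prodMk ?_ (HasDerivAt.prodMk ?_ ?_))
  · exact HasDerivAt.fun_sum fun i _ => (hasDerivAt_fst_apply hline i).const_smul (m i)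
  · exact HasDerivAt.fun_sum fun i _ => hasDerivAt_snd_apply hline i
  · refine hasDerivAt_pi.2 fun a => hasDerivAt_pi.2 fun b => ?_
    have := hasDerivAt_angularMomentum hline a b
    rwa [e0] at this
  · have := hasDerivAt_energy (m := m) hline (by rwa [e0])
    rwa [e0] at this

theorem transpose_momentumDeriv (z δ : State) :
    (momentumDeriv z δ).transpose = -momentumDeriv z δ := by
  rw [momentumDeriv, Matrix.transpose_sum, ← Finset.sum_neg_distrib]
  refine Finset.sum_congr rfl fun i _ => ?_
  rw [Matrix.transpose_add, transpose_wedge, transpose_wedge, neg_add]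

/-! ### Relative equilibria -/

/-- The state `z` is a relative equilibrium with angular velocity `Ω`. -/
structure IsRelEq (m : Fin 3 → ℝ) (Ω : Matrix (Fin 4) (Fin 4) ℝ) (z : State) : Prop where
  skew : Ω.transpose = -Ω
  mom : ∀ i, z.2 i = m i • act Ω (z.1 i)
  balance : ∀ i, force m z i = act Ω (z.2 i)

/-- The space in which the first integrals take their values. -/
def integralSpace : Submodule ℝ (Space × Space × (Fin 4 → Fin 4 → ℝ) × ℝ) where
  carrier := {v | ∀ a b, v.2.2.1 a b = -v.2.2.1 b a}
  add_mem' {u v} hu hv a b := by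
    have h1 := hu a b
    have h2 := hv a b
    simp only [Prod.snd_add, Prod.fst_add, Pi.add_apply] at *
    linarith
  zero_mem' a b := by simp
  smul_mem' c v hv a b := by
    have h1 := hv a b
    simp only [Prod.smul_snd, Prod.smul_fst, Pi.smul_apply, smul_eq_mul] at *
    rw [h1]; ring

theorem inner_act_eq_sum (N : Matrix (Fin 4) (Fin 4) ℝ) (u v : Space) :
    ⟪u, act N v⟫ = ∑ a, ∑ b, u a * N a b * v b := by
  simp only [inner_eq_sum, act_ofLp, Matrix.mulVec, dotProduct, Finset.mul_sum, mul_assoc]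

/-- A linear functional on the values of the first integrals, in coordinates. -/
theorem exists_functional_coordinates
    (f : (Space × Space × (Fin 4 → Fin 4 → ℝ) × ℝ) →ₗ[ℝ] ℝ) :
    ∃ (u v : Space) (F : Matrix (Fin 4) (Fin 4) ℝ) (c : ℝ), ∀ w,
      f w = ⟪u, w.1⟫ + ⟪v, w.2.1⟫ + (∑ a, ∑ b, w.2.2.1 a b * F a b) + c * w.2.2.2 := by
  have hs : ∀ g : Space →ₗ[ℝ] ℝ, ∃ u : Space, ∀ x, g x = ⟪u, x⟫ := fun g =>
    ⟨(InnerProductSpace.toDual ℝ Space).symm (LinearMap.toContinuousLinearMap g), fun x => by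
      rw [InnerProductSpace.toDual_symm_apply]; rfl⟩
  obtain ⟨u, hu⟩ := hs (f ∘ₗ LinearMap.inl ℝ _ _)
  obtain ⟨v, hv⟩ := hs (f ∘ₗ LinearMap.inr ℝ _ _ ∘ₗ LinearMap.inl ℝ _ _)
  let f3 : (Fin 4 → Fin 4 → ℝ) →ₗ[ℝ] ℝ :=
    f ∘ₗ LinearMap.inr ℝ _ _ ∘ₗ LinearMap.inr ℝ _ _ ∘ₗ LinearMap.inl ℝ _ _
  refine ⟨u, v, fun a b => f3 (Pi.single a (Pi.single b 1)), f (0, 0, 0, 1), fun w => ?_⟩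
  obtain ⟨x, y, S, e⟩ := w
  have h1 : f (x, 0) = ⟪u, x⟫ := hu x
  have h2 : f (0, y, 0) = ⟪v, y⟫ := hv y
  have h3 : f (0, 0, S, 0) = ∑ a, ∑ b, S a b * f3 (Pi.single a (Pi.single b 1)) := by
    change f3 S = _
    have : S = ∑ a, ∑ b, S a b • (Pi.single a (Pi.single b 1) : Fin 4 → Fin 4 → ℝ) := by
      ext i j
      simp [Finset.sum_apply, Pi.single_apply, ite_apply]
    conv_lhs => rw [this]
    simp only [map_sum, map_smul, smul_eq_mul]
  have h4 : f (0, 0, 0, e) = f (0, 0, 0, 1) * e := by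
    have : ((0, 0, 0, e) : Space × Space × (Fin 4 → Fin 4 → ℝ) × ℝ) = e • (0, 0, 0, 1) := by simp
    rw [this, map_smul, smul_eq_mul, mul_comm]
  have h5 : ((x, y, S, e) : Space × Space × (Fin 4 → Fin 4 → ℝ) × ℝ) =
      (x, 0) + (0, y, 0) + (0, 0, S, 0) + (0, 0, 0, e) := by simp
  rw [h5, map_add, map_add, map_add, h1, h2, h3, h4]
  simp

theorem sum_wedge_mul (F : Matrix (Fin 4) (Fin 4) ℝ) (x y : Space) :
    ∑ a, ∑ b, wedge x y a b * F a b = ⟪x, act (F - F.transpose) y⟫ := by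
  rw [inner_act_eq_sum]
  simp only [wedge_apply, Matrix.sub_apply, Matrix.transpose_apply]
  simp only [sub_mul, mul_sub, Finset.sum_sub_distrib]
  congr 1
  · exact Finset.sum_congr rfl fun a _ => Finset.sum_congr rfl fun b _ => by ring
  · rw [Finset.sum_comm]
    exact Finset.sum_congr rfl fun a _ => Finset.sum_congr rfl fun b _ => by ring

/-- A state whose angular momentum is invertible is a regular point of the first integrals or a
relative equilibrium. -/
theorem exists_isRelEq_of_not_isRegularPoint {m : Fin 3 → ℝ} (hm : ∀ i, 0 < m i) {z : State}
    (hz : z ∈ phaseSpace m) (hL : IsUnit (angularMomentum z)) (h : ¬ IsRegularPoint m z) :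
    ∃ Ω, IsRelEq m Ω z := by
  have hd := (contDiffAt_firstIntegrals (m := m) hz.1).differentiableAt (by norm_num)
  have hle : (fderiv ℝ (firstIntegrals m) z).range ≤ integralSpace := by
    rintro _ ⟨δ, rfl⟩ a b
    have := congrFun (congrFun (transpose_momentumDeriv z δ) b) a
    change (fderiv ℝ (firstIntegrals m) z δ).2.2.1 a b = -(fderiv ℝ (firstIntegrals m) z δ).2.2.1 b a
    rw [fderiv_firstIntegrals hz.1]
    exact this
  obtain ⟨w, hw, hwn⟩ : ∃ w ∈ integralSpace, w ∉ (fderiv ℝ (firstIntegrals m) z).range := by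
    by_contra! hcon
    exact h ⟨hd, Set.ext fun v => ⟨fun ⟨δ, hδ⟩ => hle ⟨δ, hδ⟩, fun hv => hcon v hv⟩⟩
  -- Lagrange multipliers: `f` kills the range of the derivative but not the admissible value `w`.
  -- Its components are `u`, `v`, the skew matrix `N` and the coefficient `c` of the energy.
  obtain ⟨f, hf, hker⟩ := Submodule.exists_le_ker_of_notMem hwn
  obtain ⟨u, v, F, c, hfe⟩ := exists_functional_coordinates f
  set N := F - F.transpose with hN
  have hNs : N.transpose = -N := by rw [hN]; simp
  have hzero : ∀ δ : State, ⟪u, ∑ i, m i • δ.1 i⟫ + ⟪v, ∑ i, δ.2 i⟫ +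
      ∑ i, (⟪δ.1 i, act N (z.2 i)⟫ + ⟪z.1 i, act N (δ.2 i)⟫) + c * energyDeriv m z δ = 0 := by
    intro δ
    have h1 : f (fderiv ℝ (firstIntegrals m) z δ) = 0 := hker ⟨δ, rfl⟩
    rw [hfe, fderiv_firstIntegrals hz.1] at h1
    rw [← h1]
    congr 2
    simp only [momentumDeriv, Matrix.sum_apply, Matrix.add_apply, Finset.sum_mul, add_mul]
    rw [Finset.sum_congr rfl fun a _ => Finset.sum_comm, Finset.sum_comm]
    refine Finset.sum_congr rfl fun i _ => ?_
    simp only [Finset.sum_add_distrib, sum_wedge_mul, hN]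
  have hq : ∀ i, m i • u + act N (z.2 i) - c • force m z i = 0 := by
    intro i
    refine ext_inner_right ℝ fun x => ?_
    have h1 := hzero (Pi.single i x, 0)
    simp [energyDeriv, Pi.single_apply, apply_ite] at h1
    simp only [inner_sub_left, inner_add_left, real_inner_smul_left, inner_zero_left]
    have h2 : ∀ j, ⟪(if j = i then x else 0), act N (z.2 j)⟫ =
        if j = i then ⟪x, act N (z.2 i)⟫ else 0 := by
      intro j
      split_ifs with hj
      · rw [hj]
      · simp
    simp only [h2, Finset.sum_ite_eq', Finset.mem_univ, if_true, real_inner_smul_right] at h1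
    rw [real_inner_comm x (act N (z.2 i))]
    linarith
  have hp : ∀ i, v - act N (z.1 i) + (c / m i) • z.2 i = 0 := by
    intro i
    refine ext_inner_right ℝ fun x => ?_
    have h1 := hzero (0, Pi.single i x)
    simp [energyDeriv, Pi.single_apply, apply_ite] at h1
    simp only [inner_sub_left, inner_add_left, real_inner_smul_left, inner_zero_left]
    simp only [ite_div, zero_div, Finset.sum_ite_eq', Finset.mem_univ, if_true] at h1
    rw [inner_act_skew hNs]
    linear_combination h1
  have hMpos : 0 < ∑ i, m i := Finset.sum_pos (fun i _ => hm i) Finset.univ_nonempty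
  -- Summation over the bodies eliminates the forces, the total momentum and the centre of mass.
  have hu : u = 0 := by
    have h1 : ∑ i, (m i • u + act N (z.2 i) - c • force m z i) = 0 :=
      Finset.sum_eq_zero fun i _ => hq i
    rw [Finset.sum_sub_distrib, Finset.sum_add_distrib, ← Finset.smul_sum, sum_force, ← map_sum,
      hz.2.2, ← Finset.sum_smul] at h1
    simpa [hMpos.ne'] using h1
  have hv : v = 0 := by
    have h1 : ∑ i, m i • (v - act N (z.1 i) + (c / m i) • z.2 i) = 0 :=
      Finset.sum_eq_zero fun i _ => by rw [hp i, smul_zero]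
    have h2 : ∀ i, m i • (v - act N (z.1 i) + (c / m i) • z.2 i) =
        m i • v - act N (m i • z.1 i) + c • z.2 i := by
      intro i
      rw [smul_add, smul_sub, smul_smul, mul_div_cancel₀ _ (hm i).ne', map_smul]
    simp only [h2] at h1
    rw [Finset.sum_add_distrib, Finset.sum_sub_distrib, ← Finset.smul_sum, ← map_sum,
      hz.2.2, hz.2.1, ← Finset.sum_smul] at h1
    simpa [hMpos.ne'] using h1
  simp only [hu, smul_zero, zero_add, sub_eq_zero] at hq
  simp only [hv, zero_sub, neg_add_eq_zero] at hp
  -- If `c = 0`, then `N` annihilates all positions and momenta, so `N * L = 0` and `N = 0` by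
  -- invertibility. Then `F` is symmetric, and `f` vanishes on all skew values, in particular at
  -- `w`.
  have hc : c ≠ 0 := by
    intro hc
    simp only [hc, zero_smul, zero_div] at hp hq
    have hNL : N * angularMomentum z = 0 := by
      apply act_injective
      intro x
      rw [act_mul, angularMomentum_eq]
      have : act (∑ i, wedge (z.1 i) (z.2 i)) x = ∑ i, act (wedge (z.1 i) (z.2 i)) x := by
        simp [act]
      rw [this, map_sum]
      simp only [act_wedge, map_sub, map_smul, hp, hq, smul_zero, sub_zero, Finset.sum_const_zero]
      simp [act]
    have hN0 : N = 0 := by simpa using hL.mul_left_eq_zero.1 hNL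
    apply hf
    rw [hfe, hu, hv, hc]
    have h1 : ∑ a, ∑ b, w.2.2.1 a b * F a b = ∑ a, ∑ b, w.2.2.1 b a * F b a := Finset.sum_comm
    have h2 : ∀ a b, w.2.2.1 b a * F b a = -(w.2.2.1 a b * F a b) := by
      intro a b
      have h3 := hw b a
      have h4 := congrFun (congrFun hN0 b) a
      simp [hN] at h4
      rw [h3, show F b a = F a b by linarith]; ring
    rw [Finset.sum_congr rfl fun a _ => Finset.sum_congr rfl fun b _ => h2 a b] at h1
    simp only [Finset.sum_neg_distrib] at h1
    simp
    linarith
  refine ⟨c⁻¹ • N, ?_, fun i => ?_, fun i => ?_⟩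
  · rw [Matrix.transpose_smul, hNs, smul_neg]
  · rw [act_smul, hp i, smul_smul, smul_smul]
    have := (hm i).ne'
    field_simp
    simp
  · rw [act_smul, hq i, smul_smul, inv_mul_cancel₀ hc, one_smul]

end

/-! ### Local minima are critical points of the first integrals -/

section

theorem continuous_pos (i : Fin 3) : Continuous fun z : State => z.1 i :=
  (continuous_apply i).comp continuous_fst

theorem continuous_side (k : Fin 3) : Continuous fun z : State => side z.1 k :=
  (continuous_pos _).sub (continuous_pos _)

theorem isOpen_injective : IsOpen {z : State | Function.Injective z.1} := by
  have : {z : State | Function.Injective z.1} = ⋂ k, {z : State | side z.1 k ≠ 0} := by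
    ext z
    simp only [mem_ofPred_eq, mem_iInter]
    exact ⟨fun h k => side_ne_zero h k, injective_of_side_ne_zero⟩
  rw [this]
  exact isOpen_iInter_of_finite fun k => isOpen_ne_fun (continuous_side k) continuous_const

theorem firstIntegrals_mem (m : Fin 3 → ℝ) (z : State) : firstIntegrals m z ∈ integralSpace :=
  fun a b => congrFun (congrFun (transpose_angularMomentum z) b) a

theorem mem_momentumLevel_of_firstIntegrals {m : Fin 3 → ℝ} {L : Matrix (Fin 4) (Fin 4) ℝ} {E : ℝ}
    {z : State} (hz : Function.Injective z.1)
    (h : firstIntegrals m z = (0, 0, fun a b => L a b, E)) :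
    z ∈ momentumLevel m L ∧ energy m z = E := by
  simp only [firstIntegrals, Prod.mk.injEq] at h
  obtain ⟨h1, h2, h3, h4⟩ := h
  exact ⟨⟨⟨hz, h1, h2⟩, Matrix.ext fun a b => congrFun (congrFun h3 a) b⟩, h4⟩

theorem firstIntegrals_of_mem {m : Fin 3 → ℝ} {L : Matrix (Fin 4) (Fin 4) ℝ} {z : State}
    (h : z ∈ momentumLevel m L) :
    firstIntegrals m z = (0, 0, fun a b => L a b, energy m z) := by
  obtain ⟨⟨-, h1, h2⟩, h3⟩ := h
  simp only [firstIntegrals, h1, h2, h3]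

/-- A submersion is open: near a regular point the energy can be lowered by any small amount with
all other integrals unchanged. -/
theorem not_isRegularPoint_of_isLocalMinOn {m : Fin 3 → ℝ} {L : Matrix (Fin 4) (Fin 4) ℝ}
    {z : State} (hz : z ∈ momentumLevel m L)
    (hmin : IsLocalMinOn (energy m) (momentumLevel m L) z) : ¬ IsRegularPoint m z := by
  rintro ⟨-, hrange⟩
  have hstrict := (contDiffAt_firstIntegrals (m := m) hz.1.1).hasStrictFDerivAt (by norm_num)
  -- The derivative is onto only after restriction of the codomain to values with skew third
  -- component, so the map is composed with a projection onto this subspace.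
  obtain ⟨p₀, hp₀⟩ := integralSpace.subtype.exists_leftInverse_of_injective
    integralSpace.ker_subtype
  let p : (Space × Space × (Fin 4 → Fin 4 → ℝ) × ℝ) →L[ℝ] integralSpace :=
    LinearMap.toContinuousLinearMap p₀
  have hp : ∀ v : integralSpace, p v = v := fun v => LinearMap.congr_fun hp₀ v
  have hcomp := p.hasStrictFDerivAt.comp z hstrict
  have hsurj : (p.comp (fderiv ℝ (firstIntegrals m) z)).range = ⊤ := by
    rw [eq_top_iff]
    rintro v -
    have : (v : Space × Space × (Fin 4 → Fin 4 → ℝ) × ℝ) ∈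
        Set.range (fderiv ℝ (firstIntegrals m) z) := by
      rw [hrange]; exact v.2
    obtain ⟨δ, hδ⟩ := this
    refine ⟨δ, ?_⟩
    change p (fderiv ℝ (firstIntegrals m) z δ) = v
    rw [hδ, hp]
  have hmap := hcomp.map_nhds_eq_of_surj hsurj
  have hA : {w : State | (w ∈ momentumLevel m L → energy m z ≤ energy m w) ∧
      Function.Injective w.1} ∈ 𝓝 z := by
    refine inter_mem ?_ (isOpen_injective.mem_nhds hz.1.1)
    exact mem_nhdsWithin_iff_eventually.1 hmin
  have himg := image_mem_map (m := fun x => p (firstIntegrals m x)) hA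
  rw [hmap] at himg
  let target : ℝ → Space × Space × (Fin 4 → Fin 4 → ℝ) × ℝ := fun ε =>
    firstIntegrals m z - (0, 0, 0, ε)
  have htc : Continuous target := by fun_prop
  have h0 : target 0 = firstIntegrals m z := by
    have : ((0, 0, 0, 0) : Space × Space × (Fin 4 → Fin 4 → ℝ) × ℝ) = 0 := rfl
    simp only [target, this, sub_zero]
  have htend : Tendsto (fun ε => p (target ε)) (𝓝[>] 0) (𝓝 (p (firstIntegrals m z))) := by
    have := (p.continuous.comp htc).tendsto 0
    simp only [Function.comp, h0] at this
    exact this.mono_left nhdsWithin_le_nhds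
  obtain ⟨ε, hε, hε0⟩ := ((htend.eventually himg).and self_mem_nhdsWithin).exists
  obtain ⟨w, ⟨hw1, hw2⟩, hw3⟩ := hε
  have htV : target ε ∈ integralSpace := by
    refine integralSpace.sub_mem (firstIntegrals_mem m z) ?_
    intro a b
    simp
  have e1 : firstIntegrals m w = target ε := by
    have h1 := hp ⟨_, firstIntegrals_mem m w⟩
    have h2 := hp ⟨_, htV⟩
    have := h1.symm.trans (hw3.trans h2)
    exact congrArg Subtype.val this
  have e2 : target ε = (0, 0, fun a b => L a b, energy m z - ε) := by
    simp only [target, firstIntegrals_of_mem hz, Prod.mk_sub_mk, sub_zero]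
  obtain ⟨h1, h2⟩ := mem_momentumLevel_of_firstIntegrals hw2 (e1.trans e2)
  have := hw1 h1
  have : 0 < ε := hε0
  linarith

end

section

/-! ### Invariants of the angular momentum -/

/-- The Pfaffian of an antisymmetric matrix. -/
def pfaffian (L : Matrix (Fin 4) (Fin 4) ℝ) : ℝ := L 0 1 * L 2 3 - L 0 2 * L 1 3 + L 0 3 * L 1 2

/-- The sum of the squares of the entries. -/
def sqNorm (L : Matrix (Fin 4) (Fin 4) ℝ) : ℝ := ∑ a, ∑ b, L a b ^ 2

/-- The matrix with columns `X`, `P`, `Y`, `Q`. -/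
def colMatrix (X P Y Q : Space) : Matrix (Fin 4) (Fin 4) ℝ :=
  Matrix.of fun i j => ![X, P, Y, Q] j i

/-- The matrix of the standard symplectic form. -/
def sympMatrix : Matrix (Fin 4) (Fin 4) ℝ :=
  !![0, 1, 0, 0; -1, 0, 0, 0; 0, 0, 0, 1; 0, 0, -1, 0]

theorem wedge_add_wedge_eq (X P Y Q : Space) : wedge X P + wedge Y Q =
    colMatrix X P Y Q * sympMatrix * (colMatrix X P Y Q).transpose := by
  ext i j
  simp [wedge_apply, colMatrix, sympMatrix, Matrix.mul_apply, Fin.sum_univ_four]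
  ring

theorem det_sympMatrix : sympMatrix.det = 1 := by
  simp [sympMatrix, Matrix.det_succ_row_zero, Fin.sum_univ_succ, Fin.succAbove]

/-- The congruence of the standard symplectic form by the matrix of Jacobi vectors multiplies its
Pfaffian, which is 1, by the determinant. The sign records the orientation of the basis. -/
theorem pfaffian_wedge_add_wedge (X P Y Q : Space) :
    pfaffian (wedge X P + wedge Y Q) = (colMatrix X P Y Q).det := by
  simp [pfaffian, wedge_apply, colMatrix, Matrix.det_succ_row_zero, Fin.sum_univ_succ,
    Fin.succAbove]
  ring

theorem det_wedge_add_wedge (X P Y Q : Space) :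
    (wedge X P + wedge Y Q).det = pfaffian (wedge X P + wedge Y Q) ^ 2 := by
  rw [pfaffian_wedge_add_wedge, wedge_add_wedge_eq, Matrix.det_mul, Matrix.det_mul,
    det_sympMatrix, Matrix.det_transpose]
  ring

theorem gram_colMatrix (X P Y Q : Space) (i j : Fin 4) :
    ((colMatrix X P Y Q).transpose * colMatrix X P Y Q) i j =
      ⟪![X, P, Y, Q] i, ![X, P, Y, Q] j⟫ := by
  simp [Matrix.mul_apply, colMatrix, inner_eq_sum]

theorem pfaffian_sq_eq_det_gram (X P Y Q : Space) : pfaffian (wedge X P + wedge Y Q) ^ 2 =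
    (Matrix.of fun i j => ⟪![X, P, Y, Q] i, ![X, P, Y, Q] j⟫).det := by
  have : (Matrix.of fun i j => ⟪![X, P, Y, Q] i, ![X, P, Y, Q] j⟫) =
      (colMatrix X P Y Q).transpose * colMatrix X P Y Q := by
    ext i j
    exact (gram_colMatrix X P Y Q i j).symm
  rw [this, Matrix.det_mul, Matrix.det_transpose, pfaffian_wedge_add_wedge]
  ring

theorem sqNorm_wedge_add_wedge (X P Y Q : Space) : sqNorm (wedge X P + wedge Y Q) =
    2 * (‖X‖ ^ 2 * ‖P‖ ^ 2 - ⟪X, P⟫ ^ 2) + 2 * (‖Y‖ ^ 2 * ‖Q‖ ^ 2 - ⟪Y, Q⟫ ^ 2) +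
      4 * (⟪X, Y⟫ * ⟪P, Q⟫ - ⟪X, Q⟫ * ⟪Y, P⟫) := by
  simp only [← real_inner_self_eq_norm_sq, inner_eq_sum, sqNorm, Matrix.add_apply, wedge_apply,
    Fin.sum_univ_four]
  ring

/-! ### Relative equilibria in Jacobi coordinates -/

/-- The matrix of the accelerations in Jacobi coordinates. -/
def accel (m c d : Fin 3 → ℝ) (z : State) : ℝ := ∑ k, attraction m z k * (side c k * side d k)

theorem accel_comm (m c d : Fin 3 → ℝ) (z : State) : accel m c d z = accel m d c z := by
  simp only [accel, mul_comm (side c _)]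

variable {m a b : Fin 3 → ℝ} {Ω : Matrix (Fin 4) (Fin 4) ℝ} {z : State}

theorem IsRelEq.jacobiMom_eq (h : IsRelEq m Ω z) (c : Fin 3 → ℝ) :
    jacobiMom c z = act Ω (jacobiPos m c z) := by
  simp only [jacobiMom, jacobiPos, map_sum, map_smul, h.mom, smul_smul, mul_comm]

/-- The balance equations in Jacobi coordinates: since the momenta are the images of the positions
under `Ω`, this says that `Ω²` acts on the Jacobi vectors as minus the matrix of accelerations. -/
theorem IsRelEq.act_jacobiMom (h : IsRelEq m Ω z) (hf : MassFrame m a b) (hz : z ∈ phaseSpace m)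
    (c : Fin 3 → ℝ) : act Ω (jacobiMom c z) =
      -(accel m c a z • jacobiPos m a z + accel m c b z • jacobiPos m b z) := by
  refine ext_inner_right ℝ fun u => ?_
  have h1 : ⟪act Ω (jacobiMom c z), u⟫ = ∑ i, ⟪force m z i, c i • u⟫ := by
    simp only [jacobiMom, map_sum, map_smul, sum_inner, real_inner_smul_left,
      real_inner_smul_right, h.balance]
  have h2 : ∀ k, side (fun i => c i • u) k = side c k • u := fun k => by
    simp only [side, sub_smul]
  rw [h1, sum_inner_force, inner_neg_left]
  simp only [h2, hf.side_eq hz, inner_add_left, real_inner_smul_left, real_inner_smul_right, accel,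
    Finset.sum_mul]
  rw [← Finset.sum_add_distrib]
  congr 1
  exact Finset.sum_congr rfl fun k _ => by ring

/-- Simultaneous diagonalisation of two symmetric 2 × 2 matrices with off-diagonal entries `v`, `v'`
and differences `u`, `u'` of the diagonal entries. The hypothesis says that they commute, and the
angle is half the polar angle of `(u, 2v)`. -/
theorem exists_common_rotation {u v u' v' : ℝ} (h : u * v' = u' * v) :
    ∃ φ : ℝ, (Real.cos φ ^ 2 - Real.sin φ ^ 2) * v = Real.cos φ * Real.sin φ * u ∧
      (Real.cos φ ^ 2 - Real.sin φ ^ 2) * v' = Real.cos φ * Real.sin φ * u' := by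
  have key : ∀ u v u' v' : ℝ, u * v' = u' * v → (u ≠ 0 ∨ v ≠ 0) →
      ∃ φ : ℝ, (Real.cos φ ^ 2 - Real.sin φ ^ 2) * v = Real.cos φ * Real.sin φ * u ∧
      (Real.cos φ ^ 2 - Real.sin φ ^ 2) * v' = Real.cos φ * Real.sin φ * u' := by
    intro u v u' v' h hne
    set w : ℂ := ⟨u, 2 * v⟩ with hw
    have h1 : ‖w‖ * Real.cos (Complex.arg w) = u := Complex.norm_mul_cos_arg w
    have h2 : ‖w‖ * Real.sin (Complex.arg w) = 2 * v := Complex.norm_mul_sin_arg w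
    have hn : ‖w‖ ≠ 0 := by
      rw [norm_ne_zero_iff]
      intro h0
      have e1 := congrArg Complex.re h0
      have e2 := congrArg Complex.im h0
      simp [hw] at e1 e2
      tauto
    have e : Complex.arg w = 2 * (Complex.arg w / 2) := by ring
    rw [e, Real.cos_two_mul'] at h1
    rw [e, Real.sin_two_mul] at h2
    refine ⟨Complex.arg w / 2, ?_, ?_⟩
    · rw [← h1]; linear_combination (-(Real.cos (Complex.arg w / 2) ^ 2 -
        Real.sin (Complex.arg w / 2) ^ 2) / 2) * h2
    · apply mul_left_cancel₀ hn
      linear_combination v' * h1 + h - u' * h2 / 2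
  by_cases h0 : u ≠ 0 ∨ v ≠ 0
  · exact key u v u' v' h h0
  · push Not at h0
    by_cases h1 : u' ≠ 0 ∨ v' ≠ 0
    · obtain ⟨φ, e1, e2⟩ := key u' v' u v (by rw [h0.1, h0.2]; ring) h1
      exact ⟨φ, e2, e1⟩
    · push Not at h1
      exact ⟨0, by simp [h0], by simp [h1]⟩

theorem jacobiPos_rotFst (φ : ℝ) (z : State) : jacobiPos m (rotFst φ a b) z =
    Real.cos φ • jacobiPos m a z + Real.sin φ • jacobiPos m b z := by
  simp only [jacobiPos, rotFst, Finset.smul_sum, smul_smul, ← Finset.sum_add_distrib, ← add_smul]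
  exact Finset.sum_congr rfl fun i _ => by ring_nf

theorem jacobiPos_rotSnd (φ : ℝ) (z : State) : jacobiPos m (rotSnd φ a b) z =
    -Real.sin φ • jacobiPos m a z + Real.cos φ • jacobiPos m b z := by
  simp only [jacobiPos, rotSnd, Finset.smul_sum, smul_smul, ← Finset.sum_add_distrib, ← add_smul]
  exact Finset.sum_congr rfl fun i _ => by ring_nf

theorem accel_rot (φ : ℝ) (z : State) : accel m (rotFst φ a b) (rotSnd φ a b) z =
    (Real.cos φ ^ 2 - Real.sin φ ^ 2) * accel m a b z -
      Real.cos φ * Real.sin φ * (accel m a a z - accel m b b z) := by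
  simp only [accel, side_rotFst, side_rotSnd, Fin.sum_univ_three, rotFst, rotSnd]
  ring

/-- A frame in which the matrix of inertia and the matrix of accelerations are diagonal. -/
structure IsPrincipalFrame (m a b : Fin 3 → ℝ) (z : State) : Prop where
  frame : MassFrame m a b
  orth : ⟪jacobiPos m a z, jacobiPos m b z⟫ = 0
  accel_eq : accel m a b z = 0

/-- The square of `Ω` is symmetric, so `⟪Ω²X, Y⟫ = ⟪X, Ω²Y⟫`. This says that the Gram matrix of the
Jacobi vectors commutes with the matrix of accelerations. -/
theorem IsRelEq.exists_isPrincipalFrame (h : IsRelEq m Ω z) (hf : MassFrame m a b)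
    (hz : z ∈ phaseSpace m) : ∃ φ, IsPrincipalFrame m (rotFst φ a b) (rotSnd φ a b) z := by
  set X := jacobiPos m a z with hX
  set Y := jacobiPos m b z with hY
  have hP := h.act_jacobiMom hf hz a
  have hQ := h.act_jacobiMom hf hz b
  rw [h.jacobiMom_eq] at hP hQ
  rw [accel_comm m b a] at hQ
  have e1 : ⟪act Ω (act Ω X), Y⟫ = ⟪X, act Ω (act Ω Y)⟫ := by
    rw [inner_act_skew h.skew, inner_act_skew h.skew, neg_neg]
  rw [hP, hQ] at e1
  simp only [inner_neg_left, inner_neg_right, inner_add_left, inner_add_right,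
    real_inner_smul_left, real_inner_smul_right, ← hX, ← hY] at e1
  obtain ⟨φ, h1, h2⟩ := exists_common_rotation (u := ⟪X, X⟫ - ⟪Y, Y⟫) (v := ⟪X, Y⟫)
    (u' := accel m a a z - accel m b b z) (v' := accel m a b z) (by linarith)
  refine ⟨φ, hf.rotate φ, ?_, ?_⟩
  · rw [jacobiPos_rotFst, jacobiPos_rotSnd]
    simp only [inner_add_left, inner_add_right, real_inner_smul_left, real_inner_smul_right,
      ← hX, ← hY, real_inner_comm X Y]
    linear_combination h1
  · rw [accel_rot]
    linear_combination h2

/-- The scalar products of the Jacobi vectors of a relative equilibrium in a principal frame. -/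
theorem IsRelEq.inner_eq (h : IsRelEq m Ω z) (hp : IsPrincipalFrame m a b z)
    (hz : z ∈ phaseSpace m) :
    ⟪jacobiPos m a z, jacobiMom a z⟫ = 0 ∧ ⟪jacobiPos m b z, jacobiMom b z⟫ = 0 ∧
    ⟪jacobiPos m b z, jacobiMom a z⟫ = -⟪jacobiPos m a z, jacobiMom b z⟫ ∧
    ⟪jacobiMom a z, jacobiMom b z⟫ = 0 ∧
    ‖jacobiMom a z‖ ^ 2 = accel m a a z * ‖jacobiPos m a z‖ ^ 2 ∧
    ‖jacobiMom b z‖ ^ 2 = accel m b b z * ‖jacobiPos m b z‖ ^ 2 ∧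
    (accel m a a z - accel m b b z) * ⟪jacobiPos m a z, jacobiMom b z⟫ = 0 := by
  have hP := h.act_jacobiMom hp.frame hz a
  have hQ := h.act_jacobiMom hp.frame hz b
  have hX := h.jacobiMom_eq a
  have hY := h.jacobiMom_eq b
  have ho := hp.orth
  rw [hp.accel_eq, zero_smul, add_zero] at hP
  rw [accel_comm m b a, hp.accel_eq, zero_smul, zero_add] at hQ
  have hs := inner_act_skew h.skew
  have h0 := inner_act_self_skew h.skew
  generalize jacobiPos m a z = X at *
  generalize jacobiPos m b z = Y at *
  generalize jacobiMom a z = P at *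
  generalize jacobiMom b z = Q at *
  refine ⟨by rw [hX, h0], by rw [hY, h0], ?_, ?_, ?_, ?_, ?_⟩
  · rw [hX, hY, ← neg_eq_iff_eq_neg, ← hs, real_inner_comm]
  · conv_lhs => rw [hX]
    rw [hs, hQ]
    simp [real_inner_smul_right, ho]
  · rw [← real_inner_self_eq_norm_sq, ← real_inner_self_eq_norm_sq]
    rw [show ⟪P, P⟫ = ⟪act Ω X, P⟫ by rw [← hX], hs, hP]
    simp [real_inner_smul_right]
  · rw [← real_inner_self_eq_norm_sq, ← real_inner_self_eq_norm_sq]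
    rw [show ⟪Q, Q⟫ = ⟪act Ω Y, Q⟫ by rw [← hY], hs, hQ]
    simp [real_inner_smul_right]
  · have e1 : ⟪act Ω P, Q⟫ = ⟪X, act Ω (act Ω Q)⟫ := by
      rw [hs, hX, hs, neg_neg]
    rw [hP, hQ, map_neg, map_smul, ← hY] at e1
    simp only [inner_neg_left, inner_neg_right, real_inner_smul_left, real_inner_smul_right] at e1
    linarith

theorem norm_side_sq (hf : MassFrame m a b) (hz : z ∈ phaseSpace m) (k : Fin 3) :
    ‖side z.1 k‖ ^ 2 = side a k ^ 2 * ‖jacobiPos m a z‖ ^ 2 +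
      side b k ^ 2 * ‖jacobiPos m b z‖ ^ 2 +
      2 * (side a k * side b k) * ⟪jacobiPos m a z, jacobiPos m b z⟫ := by
  rw [hf.side_eq hz, norm_add_sq_real, norm_smul, norm_smul, real_inner_smul_left,
    real_inner_smul_right]
  simp only [mul_pow, Real.norm_eq_abs, sq_abs]
  ring

/-- If `⟪X, Q⟫ = 0`, half of `sqNorm` and the squared Pfaffian are the sum and the product of the
two numbers `A * ‖X‖ ^ 4` and `B * ‖Y‖ ^ 4`. -/
theorem IsRelEq.invariants (h : IsRelEq m Ω z) (hp : IsPrincipalFrame m a b z)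
    (hz : z ∈ phaseSpace m) :
    sqNorm (angularMomentum z) = 2 * (accel m a a z * (‖jacobiPos m a z‖ ^ 2) ^ 2) +
      2 * (accel m b b z * (‖jacobiPos m b z‖ ^ 2) ^ 2) +
      4 * ⟪jacobiPos m a z, jacobiMom b z⟫ ^ 2 ∧
    pfaffian (angularMomentum z) ^ 2 =
      (accel m a a z * (‖jacobiPos m a z‖ ^ 2 * ‖jacobiPos m b z‖ ^ 2) -
        ⟪jacobiPos m a z, jacobiMom b z⟫ ^ 2) *
      (accel m b b z * (‖jacobiPos m a z‖ ^ 2 * ‖jacobiPos m b z‖ ^ 2) -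
        ⟪jacobiPos m a z, jacobiMom b z⟫ ^ 2) := by
  obtain ⟨h1, h2, h3, h4, h5, h6, -⟩ := h.inner_eq hp hz
  have ho := hp.orth
  rw [hp.frame.angularMomentum_eq hz]
  generalize jacobiPos m a z = X at *
  generalize jacobiPos m b z = Y at *
  generalize jacobiMom a z = P at *
  generalize jacobiMom b z = Q at *
  constructor
  · rw [sqNorm_wedge_add_wedge, h1, h2, h3, h4, h5, h6]; ring
  · rw [pfaffian_sq_eq_det_gram]
    have e1 : ⟪P, X⟫ = 0 := by rw [real_inner_comm, h1]
    have e2 : ⟪Q, Y⟫ = 0 := by rw [real_inner_comm, h2]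
    have e3 : ⟪P, Y⟫ = -⟪X, Q⟫ := by rw [real_inner_comm, h3]
    have e4 : ⟪Q, P⟫ = 0 := by rw [real_inner_comm, h4]
    have e5 : ⟪Y, X⟫ = 0 := by rw [real_inner_comm, ho]
    have e6 : ⟪Q, X⟫ = ⟪X, Q⟫ := real_inner_comm _ _
    simp [Matrix.det_succ_row_zero, Fin.sum_univ_succ, Fin.succAbove, h1, h2, h3, h4, ho, e1, e2,
      e3, e4, e5, e6]
    simp only [h5, h6]
    ring

theorem pfaffian_ne_zero (hm : ∀ i, 0 < m i) (hz : z ∈ phaseSpace m)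
    (hL : IsUnit (angularMomentum z)) : pfaffian (angularMomentum z) ≠ 0 := by
  obtain ⟨a, b, hf⟩ := exists_massFrame hm
  have h1 := (Matrix.isUnit_iff_isUnit_det _).1 hL
  rw [hf.angularMomentum_eq hz] at h1 ⊢
  rw [det_wedge_add_wedge] at h1
  intro h0
  simp [h0] at h1

/-- The virial relation: pairing the balance equations with the positions shows that twice the
kinetic energy equals the negative potential. The energy is thus a function of the triangle alone.
-/
theorem IsRelEq.energy_eq (h : IsRelEq m Ω z) (hm : ∀ i, 0 < m i) (hz : z ∈ phaseSpace m) :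
    energy m z = -(1 / 2) * ∑ k, pairMass m k / ‖side z.1 k‖ := by
  have h1 : ∑ i, ‖z.2 i‖ ^ 2 / m i = ∑ k, pairMass m k / ‖side z.1 k‖ := by
    have e1 : ∀ i, ‖z.2 i‖ ^ 2 / m i = -⟪force m z i, z.1 i⟫ := by
      intro i
      rw [h.balance, inner_act_skew h.skew, neg_neg, ← real_inner_self_eq_norm_sq]
      rw [show ⟪z.2 i, z.2 i⟫ = ⟪z.2 i, m i • act Ω (z.1 i)⟫ by rw [← h.mom],
        real_inner_smul_right, mul_div_cancel_left₀ _ (hm i).ne']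
    simp only [e1]
    rw [Finset.sum_neg_distrib, sum_inner_force, neg_neg]
    refine Finset.sum_congr rfl fun k _ => ?_
    have := norm_ne_zero_iff.2 (side_ne_zero hz.1 k)
    rw [attraction, real_inner_self_eq_norm_sq]
    field_simp
  rw [ThreeBody.energy_eq, h1]
  ring

end

/-! ### Finiteness of the relative equilibria with given angular momentum -/

section

variable {m a b : Fin 3 → ℝ} {Ω : Matrix (Fin 4) (Fin 4) ℝ} {z : State}

theorem IsRelEq.principal_bounds (h : IsRelEq m Ω z) (hp : IsPrincipalFrame m a b z)
    (hz : z ∈ phaseSpace m) (hpf : pfaffian (angularMomentum z) ≠ 0) :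
    0 < ‖jacobiPos m a z‖ ^ 2 ∧ 0 < ‖jacobiPos m b z‖ ^ 2 ∧ 0 < accel m a a z ∧
    0 < accel m b b z ∧ ⟪jacobiPos m a z, jacobiMom b z⟫ ^ 2 ≤
      accel m b b z * (‖jacobiPos m a z‖ ^ 2 * ‖jacobiPos m b z‖ ^ 2) := by
  have hinv := (h.invariants hp hz).2
  obtain ⟨h1, h2, h3, h4, h5, h6, h7⟩ := h.inner_eq hp hz
  have hsq : 0 < pfaffian (angularMomentum z) ^ 2 := by positivity
  have cs : ⟪jacobiPos m a z, jacobiMom b z⟫ ^ 2 ≤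
      ‖jacobiPos m a z‖ ^ 2 * ‖jacobiMom b z‖ ^ 2 := by
    rw [← mul_pow, ← sq_abs]
    exact pow_le_pow_left₀ (abs_nonneg _) (abs_real_inner_le_norm _ _) 2
  rw [h6] at cs
  have hX0 : 0 ≤ ‖jacobiPos m a z‖ ^ 2 := by positivity
  have hY0 : 0 ≤ ‖jacobiPos m b z‖ ^ 2 := by positivity
  have hP0 : 0 ≤ ‖jacobiMom a z‖ ^ 2 := by positivity
  have hQ0 : 0 ≤ ‖jacobiMom b z‖ ^ 2 := by positivity
  have hk0 := sq_nonneg ⟪jacobiPos m a z, jacobiMom b z⟫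
  rw [h5] at hP0
  rw [h6] at hQ0
  generalize ⟪jacobiPos m a z, jacobiMom b z⟫ = κ at *
  generalize ‖jacobiPos m a z‖ ^ 2 = I at *
  generalize ‖jacobiPos m b z‖ ^ 2 = J at *
  generalize accel m a a z = A at *
  generalize accel m b b z = B at *
  have hκ : I * J = 0 → κ = 0 := by
    intro h0
    have : κ ^ 2 ≤ 0 := by rwa [show I * (B * J) = B * (I * J) by ring, h0, mul_zero] at cs
    exact pow_eq_zero_iff two_ne_zero |>.1 (le_antisymm this hk0)
  have hIJ : I * J ≠ 0 := by
    intro h0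
    rw [h0, hκ h0] at hinv
    simp at hinv
    exact hpf hinv
  have hI : 0 < I := lt_of_le_of_ne hX0 fun h0 => hIJ (by rw [← h0]; ring)
  have hJ : 0 < J := lt_of_le_of_ne hY0 fun h0 => hIJ (by rw [← h0]; ring)
  have hA : 0 ≤ A := nonneg_of_mul_nonneg_left hP0 hI
  have hB : 0 ≤ B := nonneg_of_mul_nonneg_left hQ0 hJ
  have hAB : A ≠ 0 ∧ B ≠ 0 := by
    constructor
    · rintro rfl
      rcases mul_eq_zero.1 h7 with h0 | h0
      · have : B = 0 := by linarith
        rw [this] at cs hinv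
        have : κ = 0 := by nlinarith
        rw [this] at hinv
        simp at hinv
        exact hpf hinv
      · rw [h0] at hinv
        simp at hinv
        exact hpf hinv
    · rintro rfl
      have : κ = 0 := by nlinarith
      rw [this] at hinv
      simp at hinv
      exact hpf hinv
  exact ⟨hI, hJ, lt_of_le_of_ne hA hAB.1.symm, lt_of_le_of_ne hB hAB.2.symm, by linarith⟩

/-- The squares of the three sides, as linear forms, are independent quadratic forms. Evaluation at
a vector orthogonal to side `i` removes `u i` and leaves the sum of the other two coefficients,
since their squares agree there. -/
theorem eq_zero_of_moments_eq_zero {μ α β u : Fin 3 → ℝ} {M : ℝ} (h : TriangleFrame μ M α β)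
    (hM : 0 < M) (h1 : ∑ k, u k * (α k * α k) = 0) (h2 : ∑ k, u k * (β k * β k) = 0)
    (h3 : ∑ k, u k * (α k * β k) = 0) (k : Fin 3) : u k = 0 := by
  have key : ∀ i, ∑ k, u k * (α k * β i - α i * β k) ^ 2 = 0 := by
    intro i
    simp only [Fin.sum_univ_three] at *
    linear_combination β i ^ 2 * h1 + α i ^ 2 * h2 - 2 * α i * β i * h3
  have hδ := h.det_ne_zero hM (i := 0) (j := 1) (by decide)
  have s1 := h.sum_left
  have s2 := h.sum_right
  simp only [Fin.sum_univ_three] at s1 s2 key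
  have e0 : α 2 = -α 0 - α 1 := by linarith
  have e1 : β 2 = -β 0 - β 1 := by linarith
  have k0 := key 0
  have k1 := key 1
  have k2 := key 2
  rw [e0, e1] at k0 k1 k2
  have f0 : u 1 + u 2 = 0 := by
    apply mul_right_cancel₀ (pow_ne_zero 2 hδ)
    linear_combination k0
  have f1 : u 0 + u 2 = 0 := by
    apply mul_right_cancel₀ (pow_ne_zero 2 hδ)
    linear_combination k1
  have f2 : u 0 + u 1 = 0 := by
    apply mul_right_cancel₀ (pow_ne_zero 2 hδ)
    linear_combination k2
  fin_cases k <;> simp <;> linarith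

theorem totalMass_pos (hm : ∀ i, 0 < m i) : 0 < ∑ i, m i :=
  Finset.sum_pos (fun i _ => hm i) Finset.univ_nonempty

theorem attraction_eq_invCube (hz : z ∈ phaseSpace m) (k : Fin 3) :
    attraction m z k = pairMass m k * invCube (‖side z.1 k‖ ^ 2) := by
  rw [invCube_sq (norm_pos_iff.2 (side_ne_zero hz.1 k)), attraction, div_eq_mul_inv]

/-- If the configuration plane of a relative equilibrium is not isotropic, the triangle is
equilateral, and its size is a function of the angular momentum. -/
theorem IsRelEq.side_eq_of_ne_zero (h : IsRelEq m Ω z) (hm : ∀ i, 0 < m i)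
    (hp : IsPrincipalFrame m a b z) (hz : z ∈ phaseSpace m)
    (hpf : pfaffian (angularMomentum z) ≠ 0)
    (hκ : ⟪jacobiPos m a z, jacobiMom b z⟫ ≠ 0) (k : Fin 3) :
    ‖side z.1 k‖ = (∑ i, m i) * (sqNorm (angularMomentum z) / 2 +
      2 * |pfaffian (angularMomentum z)|) / (∑ k, pairMass m k) ^ 2 := by
  obtain ⟨i1, i2⟩ := h.invariants hp hz
  obtain ⟨b1, b2, b3, b4, b5⟩ := h.principal_bounds hp hz hpf
  have h7 := (h.inner_eq hp hz).2.2.2.2.2.2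
  have hAB : accel m b b z = accel m a a z := by
    have := (mul_eq_zero.1 h7).resolve_right hκ
    linarith
  have hM := totalMass_pos hm
  have ht := hp.frame.triangleFrame
  have hacc := hp.accel_eq
  -- With `A = B` the second moments of the attractions are a multiple of the identity, as are those
  -- of the pair masses. So the two are proportional, which means that all sides have the cube `M /
  -- A`.
  have hu := eq_zero_of_moments_eq_zero ht hM
    (u := fun k => attraction m z k - accel m a a z / (∑ i, m i) * pairMass m k) (by
      have e1 : accel m a a z = ∑ k, attraction m z k * (side a k * side a k) := rfl
      have e2 := ht.sq_left
      have e3 : ∀ k, (attraction m z k - accel m a a z / (∑ i, m i) * pairMass m k) *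
          (side a k * side a k) = attraction m z k * (side a k * side a k) -
          accel m a a z / (∑ i, m i) * (pairMass m k * side a k ^ 2) := fun k => by ring
      simp only [e3, Finset.sum_sub_distrib, ← Finset.mul_sum]
      rw [e2, ← e1]
      field_simp
      ring) (by
      have e1 : accel m b b z = ∑ k, attraction m z k * (side b k * side b k) := rfl
      have e2 := ht.sq_right
      have e3 : ∀ k, (attraction m z k - accel m a a z / (∑ i, m i) * pairMass m k) *
          (side b k * side b k) = attraction m z k * (side b k * side b k) -
          accel m a a z / (∑ i, m i) * (pairMass m k * side b k ^ 2) := fun k => by ring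
      simp only [e3, Finset.sum_sub_distrib, ← Finset.mul_sum]
      rw [e2, ← e1, hAB]
      field_simp
      ring) (by
      have e1 : accel m a b z = ∑ k, attraction m z k * (side a k * side b k) := rfl
      have e2 := ht.cross
      have e3 : ∀ k, (attraction m z k - accel m a a z / (∑ i, m i) * pairMass m k) *
          (side a k * side b k) = attraction m z k * (side a k * side b k) -
          accel m a a z / (∑ i, m i) * (pairMass m k * (side a k * side b k)) := fun k => by ring
      simp only [e3, Finset.sum_sub_distrib, ← Finset.mul_sum]
      rw [e2, ← e1, hacc]
      ring)
  have hr : ∀ k, 0 < ‖side z.1 k‖ := fun k => norm_pos_iff.2 (side_ne_zero hz.1 k)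
  have hA : ∀ k, accel m a a z * ‖side z.1 k‖ ^ 3 = ∑ i, m i := by
    intro k
    have e1 := hu k
    have e2 := pairMass_pos hm k
    have e3 := hr k
    simp only [attraction] at e1
    field_simp at e1
    rw [mul_zero] at e1
    have := (mul_eq_zero.1 e1).resolve_left e2.ne'
    linarith
  have hreq : ∀ j, ‖side z.1 j‖ = ‖side z.1 k‖ := by
    intro j
    have e1 := mul_left_cancel₀ b3.ne' ((hA j).trans (hA k).symm)
    exact (pow_left_inj₀ (hr j).le (hr k).le three_ne_zero).1 e1
  have hI : (∑ i, m i) * (‖jacobiPos m a z‖ ^ 2 + ‖jacobiPos m b z‖ ^ 2) =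
      (∑ k, pairMass m k) * ‖side z.1 k‖ ^ 2 := by
    have e1 : ∀ j, pairMass m j * ‖side z.1 k‖ ^ 2 =
        pairMass m j * side a j ^ 2 * ‖jacobiPos m a z‖ ^ 2 +
        pairMass m j * side b j ^ 2 * ‖jacobiPos m b z‖ ^ 2 := by
      intro j
      rw [← hreq j, norm_side_sq hp.frame hz, hp.orth]
      ring
    have e2 : (∑ k, pairMass m k) * ‖side z.1 k‖ ^ 2 = ∑ j, pairMass m j * ‖side z.1 k‖ ^ 2 :=
      Finset.sum_mul ..
    rw [e2, Finset.sum_congr rfl fun j _ => e1 j, Finset.sum_add_distrib,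
      ← Finset.sum_mul, ← Finset.sum_mul, ht.sq_left, ht.sq_right]
    ring
  rw [hAB] at i1 i2 b5
  -- In the combination `sqNorm / 2 + 2 * |pfaffian|` the term `⟪X, Q⟫ ^ 2` cancels. What is left is
  -- `A * (‖X‖ ^ 2 + ‖Y‖ ^ 2) ^ 2`, where the moment of inertia is known from the side.
  have habs : |pfaffian (angularMomentum z)| =
      accel m a a z * (‖jacobiPos m a z‖ ^ 2 * ‖jacobiPos m b z‖ ^ 2) -
        ⟪jacobiPos m a z, jacobiMom b z⟫ ^ 2 := by
    rw [← abs_of_nonneg (sub_nonneg.2 b5), ← sq_eq_sq_iff_abs_eq_abs, i2]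
    ring
  rw [habs, i1]
  have hμ : 0 < ∑ k, pairMass m k :=
    Finset.sum_pos (fun k _ => pairMass_pos hm k) Finset.univ_nonempty
  have hAk := hA k
  have hrk := hr k
  rw [eq_div_iff (by positivity)]
  have e5 : accel m a a z * ((∑ i, m i) * (‖jacobiPos m a z‖ ^ 2 + ‖jacobiPos m b z‖ ^ 2)) ^ 2 =
      (∑ i, m i) * (‖side z.1 k‖ * (∑ k, pairMass m k) ^ 2) := by
    rw [hI]
    linear_combination ((∑ k, pairMass m k) ^ 2 * ‖side z.1 k‖) * hAk
  apply mul_left_cancel₀ hM.ne'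
  linear_combination -e5

/-- The triangles formed by the relative equilibria of a given angular momentum are finite in
number, up to congruence. -/
theorem finite_relEq_shapes (hm : ∀ i, 0 < m i) {L : Matrix (Fin 4) (Fin 4) ℝ} (hL : IsUnit L) :
    {s : Fin 3 → ℝ | ∃ z ∈ momentumLevel m L, (∃ Ω, IsRelEq m Ω z) ∧
      ∀ k, s k = ‖side z.1 k‖ ^ 2}.Finite := by
  obtain ⟨a, b, hf⟩ := exists_massFrame hm
  have hM := totalMass_pos hm
  set S : ℝ := sqNorm L / 2 with hS
  set D : ℝ := pfaffian L ^ 2 with hD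
  -- The possible values of `A * ‖X‖ ^ 4` and `B * ‖Y‖ ^ 4` in the case `⟪X, Q⟫ = 0`: the two roots
  -- of a quadratic, in either order.
  let T : Set (ℝ × ℝ) := {p | 0 < p.1 ∧ 0 < p.2 ∧ p.1 + p.2 = S ∧ p.1 * p.2 = D}
  have hT : T.Finite := by
    let r := √(S ^ 2 - 4 * D)
    refine (Set.toFinite {((S + r) / 2, (S - r) / 2), ((S - r) / 2, (S + r) / 2)}).subset ?_
    rintro ⟨x, y⟩ ⟨-, -, h1, h2⟩
    have hr : r ^ 2 = (x - y) ^ 2 := by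
      have e : S ^ 2 - 4 * D = (x - y) ^ 2 := by rw [← h1, ← h2]; ring
      rw [Real.sq_sqrt (by rw [e]; positivity), e]
    simp only at h1
    rcases sq_eq_sq_iff_eq_or_eq_neg.1 hr with h0 | h0
    · left; ext <;> simp only <;> linarith
    · right
      simp only [mem_singleton_iff]
      ext <;> simp only <;> linarith
  have hfin := hT.biUnion fun p hp => finite_balanced_shapes hf.triangleFrame (pairMass_pos hm) hM
    hp.1 hp.2.1
  refine (hfin.union (finite_singleton fun _ : Fin 3 => ((∑ i, m i) * (sqNorm L / 2 +
      2 * |pfaffian L|) / (∑ k, pairMass m k) ^ 2) ^ 2)).subset ?_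
  rintro s ⟨z, ⟨hz, hzL⟩, ⟨Ω, hΩ⟩, hs⟩
  have hpf := pfaffian_ne_zero hm hz (by rwa [hzL])
  obtain ⟨φ, hp⟩ := hΩ.exists_isPrincipalFrame hf hz
  by_cases hκ : ⟪jacobiPos m (rotFst φ a b) z, jacobiMom (rotSnd φ a b) z⟫ = 0
  · left
    obtain ⟨i1, i2⟩ := hΩ.invariants hp hz
    obtain ⟨b1, b2, b3, b4, -⟩ := hΩ.principal_bounds hp hz hpf
    rw [hzL, hκ] at i1 i2
    have hside : ∀ k, s k = rotFst φ (side a) (side b) k ^ 2 * ‖jacobiPos m (rotFst φ a b) z‖ ^ 2 +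
        rotSnd φ (side a) (side b) k ^ 2 * ‖jacobiPos m (rotSnd φ a b) z‖ ^ 2 := by
      intro k
      rw [hs k, norm_side_sq hp.frame hz, hp.orth, side_rotFst, side_rotSnd]
      ring
    have hacc : ∀ c d, accel m c d z =
        ∑ k, pairMass m k * (side c k * side d k) * invCube (s k) := by
      intro c d
      refine Finset.sum_congr rfl fun k _ => ?_
      rw [attraction_eq_invCube hz, hs k]
      ring
    have hA := hacc (rotFst φ a b) (rotFst φ a b)
    have hB := hacc (rotSnd φ a b) (rotSnd φ a b)
    have hC := hacc (rotFst φ a b) (rotSnd φ a b)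
    rw [hp.accel_eq, side_rotFst, side_rotSnd] at hC
    rw [side_rotFst] at hA
    rw [side_rotSnd] at hB
    simp only [← sq] at hA hB
    refine mem_biUnion (x := ((‖jacobiPos m (rotFst φ a b) z‖ ^ 2) ^ 2 *
      accel m (rotFst φ a b) (rotFst φ a b) z, (‖jacobiPos m (rotSnd φ a b) z‖ ^ 2) ^ 2 *
      accel m (rotSnd φ a b) (rotSnd φ a b) z)) ⟨by positivity, by positivity, ?_, ?_⟩
      ⟨φ, _, _, b1, b2, hside, ?_, ?_, hC.symm⟩
    · rw [hS, i1]; simp only; ring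
    · rw [hD, i2]; simp only; ring
    · rw [← hA]
    · rw [← hB]
  · right
    ext k
    rw [hs k, hΩ.side_eq_of_ne_zero hm hp hz hpf hκ, hzL]

/-- The energies of the relative equilibria of a given angular momentum are finite in number. -/
theorem finite_relEq_energies (hm : ∀ i, 0 < m i) {L : Matrix (Fin 4) (Fin 4) ℝ} (hL : IsUnit L) :
    {E : ℝ | ∃ z ∈ momentumLevel m L, (∃ Ω, IsRelEq m Ω z) ∧ energy m z = E}.Finite := by
  refine ((finite_relEq_shapes hm hL).image
    fun s => -(1 / 2) * ∑ k, pairMass m k / √(s k)).subset ?_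
  rintro E ⟨z, hz, ⟨Ω, hΩ⟩, rfl⟩
  refine ⟨fun k => ‖side z.1 k‖ ^ 2, ⟨z, hz, ⟨Ω, hΩ⟩, fun k => rfl⟩, ?_⟩
  simp only [Real.sqrt_sq (norm_nonneg _), hΩ.energy_eq hm hz.1]

end

section

/-! ### The smallest angular velocity plane of a skew matrix -/

variable {L : Matrix (Fin 4) (Fin 4) ℝ}

theorem act_ne_zero (hL : IsUnit L) {x : Space} (hx : x ≠ 0) : act L x ≠ 0 := by
  intro h
  obtain ⟨u, rfl⟩ := hL
  apply hx
  rw [← act_one x, ← Units.inv_mul u, act_mul, h, map_zero]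

theorem eq_zero_of_forall_quadratic_nonneg {B q : ℝ} (hq : 0 ≤ q)
    (h : ∀ t : ℝ, 0 ≤ 2 * t * B + t ^ 2 * q) : B = 0 := by
  have h1 := h (-B / (q + 1))
  have h2 : 2 * (-B / (q + 1)) * B + (-B / (q + 1)) ^ 2 * q =
      -(B ^ 2 * (q + 2)) / (q + 1) ^ 2 := by
    field_simp
    ring
  rw [h2, div_nonneg_iff] at h1
  have h3 : 0 < (q + 1) ^ 2 := by positivity
  have h4 : B ^ 2 * (q + 2) ≤ 0 := by
    rcases h1 with h1 | h1
    · linarith [h1.1]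
    · linarith [h1.2]
  have h5 : B ^ 2 ≤ 0 := by nlinarith [sq_nonneg B]
  exact pow_eq_zero_iff two_ne_zero |>.1 (le_antisymm h5 (sq_nonneg B))

/-- At a minimiser `e` of `‖act L x‖` on the sphere, the first variation vanishes, which gives `L²e
= -σ²e`. Thus `e` and `Le` span an invariant plane. -/
theorem exists_minimal_plane (hskew : L.transpose = -L) (hL : IsUnit L) :
    ∃ σ > 0, ∃ e e' : Space, ‖e‖ = 1 ∧ ‖e'‖ = 1 ∧ ⟪e, e'⟫ = 0 ∧ act L e = -σ • e' ∧
      act L e' = σ • e ∧ ∀ x, σ * ‖x‖ ≤ ‖act L x‖ := by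
  obtain ⟨e, he, hmin⟩ := (isCompact_sphere (0 : Space) 1).exists_isMinOn
    (NormedSpace.sphere_nonempty.2 zero_le_one) (f := fun x => ‖act L x‖)
    (by fun_prop)
  have he1 : ‖e‖ = 1 := by simpa using he
  have he0 : e ≠ 0 := by rintro rfl; simp at he1
  set σ := ‖act L e‖ with hσ
  have hσ0 : 0 < σ := norm_pos_iff.2 (act_ne_zero hL he0)
  have hle : ∀ x, σ * ‖x‖ ≤ ‖act L x‖ := by
    intro x
    rcases eq_or_ne x 0 with rfl | hx
    · simp
    have hx' := norm_pos_iff.2 hx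
    have h1 := hmin (a := ‖x‖⁻¹ • x) (by simp [norm_smul, hx'.ne'])
    simp only [map_smul, norm_smul, norm_inv, norm_norm, mem_ofPred_eq] at h1
    rw [← hσ, inv_mul_eq_div, le_div_iff₀ hx'] at h1
    exact h1
  have hsq : ∀ x, 0 ≤ ⟪act L x, act L x⟫ - σ ^ 2 * ⟪x, x⟫ := by
    intro x
    have := mul_self_le_mul_self (by positivity) (hle x)
    rw [real_inner_self_eq_norm_sq, real_inner_self_eq_norm_sq]
    nlinarith
  have hcross : ∀ y, ⟪act L e, act L y⟫ - σ ^ 2 * ⟪e, y⟫ = 0 := by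
    intro y
    refine eq_zero_of_forall_quadratic_nonneg (hsq y) fun t => ?_
    have h1 := hsq (e + t • y)
    simp only [map_add, map_smul, inner_add_left, inner_add_right, real_inner_smul_left,
      real_inner_smul_right, real_inner_comm (act L e) (act L y), real_inner_comm e y] at h1
    have h2 : ⟪act L e, act L e⟫ = σ ^ 2 := by rw [real_inner_self_eq_norm_sq]
    have h3 : ⟪e, e⟫ = (1 : ℝ) := by rw [real_inner_self_eq_norm_sq, he1]; norm_num
    rw [h2, h3] at h1
    linarith
  have hLL : act L (act L e) = -(σ ^ 2 • e) := by
    refine ext_inner_right ℝ fun y => ?_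
    rw [inner_act_skew hskew, inner_neg_left, real_inner_smul_left]
    linarith [hcross y]
  refine ⟨σ, hσ0, e, -(σ⁻¹ • act L e), he1, ?_, ?_, ?_, ?_, hle⟩
  · rw [norm_neg, norm_smul, ← hσ, norm_inv, Real.norm_eq_abs, abs_of_pos hσ0,
      inv_mul_cancel₀ hσ0.ne']
  · rw [inner_neg_right, real_inner_smul_right, inner_act_self_skew hskew, mul_zero, neg_zero]
  · rw [neg_smul_neg, smul_smul, mul_inv_cancel₀ hσ0.ne', one_smul]
  · rw [map_neg, map_smul, hLL, smul_neg, neg_neg, smul_smul]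
    congr 1
    field_simp

/-- A skew form that vanishes on a plane of ℝ⁴ lives on the orthogonal plane, where there is only
one skew form up to a factor. -/
theorem eq_wedge_of_kernel {B : Matrix (Fin 4) (Fin 4) ℝ} (hB : B.transpose = -B)
    {e e' : Space} (he : ‖e‖ = 1) (he' : ‖e'‖ = 1) (hee : ⟪e, e'⟫ = 0) (h1 : act B e = 0)
    (h2 : act B e' = 0) : ∃ f R : Space, ‖f‖ = 1 ∧ ⟪e, f⟫ = 0 ∧ B = wedge f R := by
  have horth : Orthonormal ℝ (({0, 1} : Set (Fin 4)).domRestrict ![e, e', 0, 0]) := by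
    have hmem : ∀ i : ({0, 1} : Set (Fin 4)), i.1 = 0 ∨ i.1 = 1 := fun i => i.2
    constructor
    · intro i
      rcases hmem i with hi | hi <;> simp [Set.domRestrict, hi, he, he']
    · intro i j hij
      rw [ne_eq, Subtype.ext_iff] at hij
      rcases hmem i with hi | hi <;> rcases hmem j with hj | hj <;>
        simp [Set.domRestrict, hi, hj] at hij ⊢
      · exact hee
      · rw [real_inner_comm]; exact hee
  obtain ⟨b, hb⟩ := horth.exists_orthonormalBasis_extension_of_card_eq (by simp)
  have hb0 : b 0 = e := hb 0 (by simp)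
  have hb1 : b 1 = e' := hb 1 (by simp)
  have hbb := fun i j => orthonormal_iff_ite.1 b.orthonormal i j
  have hker : ∀ i, ∀ x, (i = 0 ∨ i = 1) → ⟪b i, act B x⟫ = 0 := by
    rintro i x (rfl | rfl)
    · rw [hb0, ← neg_eq_iff_eq_neg.2 (inner_act_skew hB e x), h1, inner_zero_left, neg_zero]
    · rw [hb1, ← neg_eq_iff_eq_neg.2 (inner_act_skew hB e' x), h2, inner_zero_left, neg_zero]
  refine ⟨b 2, -act B (b 2), b.norm_eq_one 2, ?_, ?_⟩
  · rw [← hb0, hbb]; simp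
  apply act_injective
  intro x
  have hx := b.sum_repr x
  rw [← hx]
  simp only [map_sum, map_smul]
  refine Finset.sum_congr rfl fun i _ => ?_
  congr 1
  rw [act_wedge, hbb, inner_neg_left, inner_act_skew hB, neg_neg]
  fin_cases i <;> simp [hb0, hb1, h1, h2, -mul_ite]
  · exact Or.inl (inner_act_self_skew hB _)
  refine b.repr.injective (PiLp.ext fun i => ?_)
  rw [b.repr_apply_apply, b.repr_apply_apply, real_inner_smul_right, hbb]
  fin_cases i
  · rw [hker _ _ (by simp)]; simp
  · rw [hker _ _ (by simp)]; simp
  · simp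
  · simp [inner_act_self_skew hB]

theorem exists_wedge_decomposition (hskew : L.transpose = -L) {σ : ℝ} {e e' : Space}
    (he : ‖e‖ = 1) (he' : ‖e'‖ = 1) (hee : ⟪e, e'⟫ = 0) (h1 : act L e = -σ • e')
    (h2 : act L e' = σ • e) :
    ∃ f R : Space, ‖f‖ = 1 ∧ ⟪e, f⟫ = 0 ∧ L = σ • wedge e e' + wedge f R := by
  have hB : (L - σ • wedge e e').transpose = -(L - σ • wedge e e') := by
    rw [Matrix.transpose_sub, Matrix.transpose_smul, transpose_wedge, hskew, smul_neg, neg_sub]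
    abel
  have e1 : ⟪e, e⟫ = (1 : ℝ) := by rw [real_inner_self_eq_norm_sq, he]; norm_num
  have e2 : ⟪e', e'⟫ = (1 : ℝ) := by rw [real_inner_self_eq_norm_sq, he']; norm_num
  have e3 : ⟪e', e⟫ = (0 : ℝ) := by rw [real_inner_comm, hee]
  obtain ⟨f, R, hf, hef, h⟩ := eq_wedge_of_kernel hB he he' hee
    (by rw [act_sub, act_smul, act_wedge, h1, e1, e3]; simp)
    (by rw [act_sub, act_smul, act_wedge, h2, e2, hee]; simp)
  exact ⟨f, R, hf, hef, by rw [← h]; abel⟩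

/-- The Gram determinant of `X`, `P`, `v` is non-negative. -/
theorem norm_act_wedge_sq_le (X P v : Space) :
    ‖act (wedge X P) v‖ ^ 2 ≤ (‖X‖ * ‖P‖ * ‖v‖) ^ 2 := by
  have h := (Matrix.posSemidef_gram ℝ ![X, P, v]).det_nonneg
  rw [Matrix.det_fin_three] at h
  simp [Matrix.gram] at h
  have e1 : ‖act (wedge X P) v‖ ^ 2 = ⟪P, v⟫ ^ 2 * ‖X‖ ^ 2 - 2 * (⟪P, v⟫ * ⟪X, v⟫ * ⟪X, P⟫) +
      ⟪X, v⟫ ^ 2 * ‖P‖ ^ 2 := by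
    rw [act_wedge, norm_sub_sq_real, norm_smul, norm_smul, real_inner_smul_left,
      real_inner_smul_right]
    simp only [mul_pow, Real.norm_eq_abs, sq_abs]
    ring
  rw [real_inner_comm X P, real_inner_comm X v, real_inner_comm P v] at h
  rw [e1]
  nlinarith [mul_nonneg (sq_nonneg ‖v‖) (sq_nonneg ⟪X, P⟫)]

/-- On a non-zero vector orthogonal to `Y` and `Q`, only the first wedge acts. -/
theorem le_norm_mul_norm_of_wedge_add_wedge {σ : ℝ} {X P Y Q : Space}
    (hle : ∀ x, σ * ‖x‖ ≤ ‖act (wedge X P + wedge Y Q) x‖) : σ ≤ ‖X‖ * ‖P‖ := by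
  have hlt : Module.finrank ℝ (Submodule.span ℝ (Set.range ![Y, Q])) <
      Module.finrank ℝ Space := by
    have := finrank_range_le_card (R := ℝ) ![Y, Q]
    simp only [Set.finrank, Fintype.card_fin] at this
    simp only [finrank_euclideanSpace, Fintype.card_fin]
    omega
  have hbot : (Submodule.span ℝ (Set.range ![Y, Q]))ᗮ ≠ ⊥ := by
    intro h
    rw [Submodule.orthogonal_eq_bot_iff] at h
    rw [h, finrank_top] at hlt
    exact lt_irrefl _ hlt
  obtain ⟨v, hv, hv0⟩ := Submodule.exists_mem_ne_zero_of_ne_bot hbot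
  rw [Submodule.mem_orthogonal] at hv
  have hY : ⟪Y, v⟫ = 0 := hv Y (Submodule.subset_span ⟨0, rfl⟩)
  have hQ : ⟪Q, v⟫ = 0 := hv Q (Submodule.subset_span ⟨1, rfl⟩)
  have h1 := hle v
  rw [act_add, act_wedge Y, hY, hQ, zero_smul, zero_smul, sub_zero, add_zero] at h1
  have h2 := (sq_le_sq₀ (norm_nonneg _) (by positivity)).1 (norm_act_wedge_sq_le X P v)
  have h3 := h1.trans h2
  exact le_of_mul_le_mul_right h3 (norm_pos_iff.2 hv0)

end

section

/-! ### Energy estimates at fixed angular momentum -/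

variable {m a b : Fin 3 → ℝ} {L : Matrix (Fin 4) (Fin 4) ℝ} {z : State} {σ E : ℝ}

/-- In a frame turned so that side `k` is a multiple of the first Jacobi vector `X`, the kinetic sum
is at least `‖P‖ ^ 2`, and `‖X‖ * ‖P‖ ≥ σ`. -/
theorem le_kinetic_mul_side_sq (hm : ∀ i, 0 < m i) (hf : MassFrame m a b) (hσ : 0 < σ)
    (hle : ∀ x, σ * ‖x‖ ≤ ‖act L x‖) (hz : z ∈ momentumLevel m L) (k : Fin 3) :
    σ ^ 2 * (side a k ^ 2 + side b k ^ 2) ≤ (∑ i, ‖z.2 i‖ ^ 2 / m i) * ‖side z.1 k‖ ^ 2 := by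
  obtain ⟨φ, hφ⟩ := exists_rotSnd_eq_zero (side a) (side b) k
  have hf' := hf.rotate φ
  have hrot := rot_sq_add_sq φ (side a) (side b) k
  rw [hφ] at hrot
  rw [← hz.2, hf'.angularMomentum_eq hz.1] at hle
  have h1 := le_norm_mul_norm_of_wedge_add_wedge hle
  rw [hf'.kinetic_eq hm hz.1, norm_side_sq hf' hz.1, side_rotSnd, side_rotFst, hφ, ← hrot]
  have h2 := mul_self_le_mul_self hσ.le h1
  have h3 : σ ^ 2 * rotFst φ (side a) (side b) k ^ 2 ≤
      (‖jacobiPos m (rotFst φ a b) z‖ * ‖jacobiMom (rotFst φ a b) z‖) ^ 2 *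
        rotFst φ (side a) (side b) k ^ 2 := by
    gcongr
  have h4 : 0 ≤ ‖jacobiMom (rotSnd φ a b) z‖ ^ 2 *
      (rotFst φ (side a) (side b) k ^ 2 * ‖jacobiPos m (rotFst φ a b) z‖ ^ 2) := by positivity
  linarith

/-- Take `k` to be the shortest side. By the triangle inequality, each of the other two is at least
half as long as the longest. -/
theorem exists_dominant_sides {r : Fin 3 → ℝ} (hr0 : ∀ k, 0 < r k)
    (hr : ∀ k, r k ≤ r (k + 1) + r (k + 2)) : ∃ k, ∀ j, j ≠ k → ∀ l, r l ≤ 2 * r j := by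
  obtain ⟨k, -, hk⟩ := Finset.exists_min_image Finset.univ r ⟨0, Finset.mem_univ _⟩
  refine ⟨k, fun j hj l => ?_⟩
  have e0 := hr 0
  have e1 := hr 1
  have e2 := hr 2
  have k0 := hk 0 (Finset.mem_univ _)
  have k1 := hk 1 (Finset.mem_univ _)
  have k2 := hk 2 (Finset.mem_univ _)
  have p := hr0 j
  simp at e0 e1 e2
  fin_cases k <;> fin_cases j <;> simp at hj k0 k1 k2 p ⊢ <;> fin_cases l <;> simp <;> linarith

theorem norm_side_le_add (q : Fin 3 → Space) (k : Fin 3) :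
    ‖side q k‖ ≤ ‖side q (k + 1)‖ + ‖side q (k + 2)‖ := by
  have h : side q k = -(side q (k + 1) + side q (k + 2)) := by
    fin_cases k <;> simp [side]
  rw [h, norm_neg]
  exact norm_add_le _ _

theorem norm_pos_le_of_norm_side_le (hm : ∀ i, 0 < m i) (hz : ∑ i, m i • z.1 i = 0) {R : ℝ}
    (hR : ∀ k, ‖side z.1 k‖ ≤ R) (i : Fin 3) : ‖z.1 i‖ ≤ R := by
  have hR0 : 0 ≤ R := (norm_nonneg _).trans (hR 0)
  have hM := totalMass_pos hm
  have hd : ∀ j, ‖z.1 i - z.1 j‖ ≤ R := by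
    intro j
    rcases eq_or_ne i j with rfl | hij
    · simpa using hR0
    · obtain ⟨k, hk | hk⟩ := exists_side_eq (q := z.1) hij
      · rw [hk]; exact hR k
      · rw [hk, norm_neg]; exact hR k
  have h1 : (∑ j, m j) • z.1 i = ∑ j, m j • (z.1 i - z.1 j) := by
    simp only [smul_sub, Finset.sum_sub_distrib, hz, sub_zero, Finset.sum_smul]
  have h2 : (∑ j, m j) * ‖z.1 i‖ ≤ (∑ j, m j) * R := by
    calc (∑ j, m j) * ‖z.1 i‖ = ‖(∑ j, m j) • z.1 i‖ := by
          rw [norm_smul, Real.norm_eq_abs, abs_of_pos hM]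
      _ ≤ ∑ j, ‖m j • (z.1 i - z.1 j)‖ := by rw [h1]; exact norm_sum_le _ _
      _ ≤ ∑ j, m j * R := by
          refine Finset.sum_le_sum fun j _ => ?_
          rw [norm_smul, Real.norm_eq_abs, abs_of_pos (hm j)]
          exact mul_le_mul_of_nonneg_left (hd j) (hm j).le
      _ = (∑ j, m j) * R := (Finset.sum_mul ..).symm
  exact le_of_mul_le_mul_left h2 hM

theorem continuousOn_energy (m : Fin 3 → ℝ) :
    ContinuousOn (energy m) {z | Function.Injective z.1} := fun _ hz =>
  (contDiffAt_energy hz).continuousAt.continuousWithinAt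

/-- Below the infimum of the energies of the escape of one body, the kinetic energy and the sides
are bounded. -/
theorem sublevel_bounds (hm : ∀ i, 0 < m i) (hf : MassFrame m a b) (hσ : 0 < σ)
    (hle : ∀ x, σ * ‖x‖ ≤ ‖act L x‖)
    (hE : ∀ k, E < -(pairMass m k ^ 2 / (2 * (σ ^ 2 * (side a k ^ 2 + side b k ^ 2))))) :
    ∃ δ > 0, ∃ R K : ℝ, ∀ z ∈ momentumLevel m L, energy m z ≤ E →
      ∑ i, ‖z.2 i‖ ^ 2 / m i ≤ K ∧ ∀ k, δ ≤ ‖side z.1 k‖ ∧ ‖side z.1 k‖ ≤ R := by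
  set c : Fin 3 → ℝ := fun k => σ ^ 2 * (side a k ^ 2 + side b k ^ 2) with hc
  have hc0 : ∀ k, 0 < c k := fun k =>
    mul_pos (by positivity) (hf.triangleFrame.sq_add_sq_pos (totalMass_pos hm) k)
  have hμ := pairMass_pos hm
  set A : ℝ := ∑ k, pairMass m k / √(c k) with hA
  have hA0 : 0 < A := Finset.sum_pos (fun k _ => div_pos (hμ k) (Real.sqrt_pos.2 (hc0 k)))
    Finset.univ_nonempty
  set S : ℝ := ∑ k, pairMass m k with hS
  have hS0 : 0 < S := Finset.sum_pos (fun k _ => hμ k) Finset.univ_nonempty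
  obtain ⟨k₀, -, hk₀⟩ := Finset.exists_min_image Finset.univ
    (fun k => -(pairMass m k ^ 2 / (2 * c k))) ⟨0, Finset.mem_univ _⟩
  obtain ⟨k₁, -, hk₁⟩ := Finset.exists_min_image Finset.univ c ⟨0, Finset.mem_univ _⟩
  -- The gap between `E` and the lowest escape energy.
  set η : ℝ := -(pairMass m k₀ ^ 2 / (2 * c k₀)) - E with hη
  have hη0 : 0 < η := sub_pos.2 (hE k₀)
  have hE0 : E < 0 := by
    have := hE k₀
    have h2 : 0 < pairMass m k₀ ^ 2 / (2 * c k₀) := by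
      have := hc0 k₀
      have := hμ k₀
      positivity
    linarith
  refine ⟨√(c k₁) / (2 * A), div_pos (Real.sqrt_pos.2 (hc0 k₁)) (by positivity), 4 * S / η,
    (2 * A) ^ 2, ?_⟩
  intro z hz hzE
  set K : ℝ := ∑ i, ‖z.2 i‖ ^ 2 / m i with hK
  have hK0 : 0 ≤ K := Finset.sum_nonneg fun i _ => div_nonneg (sq_nonneg _) (hm i).le
  have hr : ∀ k, 0 < ‖side z.1 k‖ := fun k => norm_pos_iff.2 (side_ne_zero hz.1.1 k)
  have hkin : ∀ k, c k ≤ K * ‖side z.1 k‖ ^ 2 := le_kinetic_mul_side_sq hm hf hσ hle hz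
  have hsqrt : ∀ k, √(c k) ≤ √K * ‖side z.1 k‖ := by
    intro k
    have := Real.sqrt_le_sqrt (hkin k)
    rwa [Real.sqrt_mul hK0, Real.sqrt_sq (hr k).le] at this
  rw [energy_eq, ← hK] at hzE
  have hpot : ∑ k, pairMass m k / ‖side z.1 k‖ ≤ √K * A := by
    rw [hA, Finset.mul_sum]
    refine Finset.sum_le_sum fun k _ => ?_
    have h1 := Real.sqrt_pos.2 (hc0 k)
    rw [mul_div_assoc', div_le_div_iff₀ (hr k) h1]
    nlinarith [hsqrt k, hμ k]
  have hs : √K ≤ 2 * A := by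
    by_contra! hcon
    have h1 := Real.sq_sqrt hK0
    have h2 : 0 < √K := by linarith
    nlinarith
  refine ⟨?_, fun k => ⟨?_, ?_⟩⟩
  · rw [← Real.sq_sqrt hK0]
    gcongr
  · rw [div_le_iff₀ (by positivity)]
    have h1 : √(c k₁) ≤ √(c k) := Real.sqrt_le_sqrt (hk₁ k (Finset.mem_univ _))
    have h2 := hsqrt k
    have h3 : √K * ‖side z.1 k‖ ≤ 2 * A * ‖side z.1 k‖ :=
      mul_le_mul_of_nonneg_right hs (hr k).le
    linarith
  · obtain ⟨j, hj⟩ := exists_dominant_sides hr (norm_side_le_add z.1)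
    -- All sides except `j` are at least half of any side, so if a side `k` is long, only the binary
    -- `j` contributes substantially to the potential.
    have h1 : ∑ l, pairMass m l / ‖side z.1 l‖ ≤
        pairMass m j / ‖side z.1 j‖ + 2 * S / ‖side z.1 k‖ := by
      rw [← Finset.add_sum_erase _ _ (Finset.mem_univ j), add_le_add_iff_left]
      calc ∑ l ∈ Finset.univ.erase j, pairMass m l / ‖side z.1 l‖
          ≤ ∑ l ∈ Finset.univ.erase j, 2 * pairMass m l / ‖side z.1 k‖ := by
            refine Finset.sum_le_sum fun l hl => ?_
            rw [div_le_div_iff₀ (hr l) (hr k)]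
            nlinarith [hj l (Finset.ne_of_mem_erase hl) k, hμ l]
        _ ≤ ∑ l, 2 * pairMass m l / ‖side z.1 k‖ :=
            Finset.sum_le_sum_of_subset_of_nonneg (Finset.subset_univ _) fun l _ _ =>
              div_nonneg (mul_nonneg zero_le_two (hμ l).le) (hr k).le
        _ = 2 * S / ‖side z.1 k‖ := by rw [← Finset.sum_div, ← Finset.mul_sum]
    -- Completing the square: the right-hand value is the minimum of `c / (2 r²) - μ / r`, attained
    -- by the circular binary.
    have h2 : -(pairMass m j ^ 2 / (2 * c j)) ≤ 1 / 2 * K - pairMass m j / ‖side z.1 j‖ := by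
      have h3 : c j / ‖side z.1 j‖ ^ 2 ≤ K := by
        rw [div_le_iff₀ (pow_pos (hr j) 2)]
        exact hkin j
      have h4 : 0 ≤ (c j / ‖side z.1 j‖ - pairMass m j) ^ 2 / (2 * c j) :=
        div_nonneg (sq_nonneg _) (by have := hc0 j; positivity)
      have h5 : (c j / ‖side z.1 j‖ - pairMass m j) ^ 2 / (2 * c j) =
          1 / 2 * (c j / ‖side z.1 j‖ ^ 2) - pairMass m j / ‖side z.1 j‖ +
            pairMass m j ^ 2 / (2 * c j) := by
        have := (hc0 j).ne'
        have := (hr j).ne'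
        field_simp
        ring
      linarith
    have h6 := hk₀ j (Finset.mem_univ _)
    have h7 : η ≤ 2 * S / ‖side z.1 k‖ := by
      linarith
    rw [le_div_iff₀ (hr k)] at h7
    rw [le_div_iff₀ hη0]
    nlinarith [hr k]

theorem isCompact_sublevel_of_bounds (hm : ∀ i, 0 < m i) {δ R K : ℝ} (hδ : 0 < δ)
    (h : ∀ z ∈ momentumLevel m L, energy m z ≤ E →
      ∑ i, ‖z.2 i‖ ^ 2 / m i ≤ K ∧ ∀ k, δ ≤ ‖side z.1 k‖ ∧ ‖side z.1 k‖ ≤ R) :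
    IsCompact {z | z ∈ momentumLevel m L ∧ energy m z ≤ E} := by
  have hinj : ∀ z : State, (∀ k, δ ≤ ‖side z.1 k‖) → Function.Injective z.1 := fun z hz =>
    injective_of_side_ne_zero fun k => norm_pos_iff.1 (hδ.trans_le (hz k))
  have heq : {z | z ∈ momentumLevel m L ∧ energy m z ≤ E} =
      {z | ∑ i, m i • z.1 i = 0} ∩ {z | ∑ i, z.2 i = 0} ∩ {z | angularMomentum z = L} ∩
        ({z | ∀ k, δ ≤ ‖side z.1 k‖} ∩ energy m ⁻¹' Iic E) := by
    ext z
    constructor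
    · rintro ⟨hz, hE⟩
      exact ⟨⟨⟨hz.1.2.1, hz.1.2.2⟩, hz.2⟩, fun k => ((h z hz hE).2 k).1, hE⟩
    · rintro ⟨⟨⟨h1, h2⟩, h3⟩, h4, h5⟩
      exact ⟨⟨⟨hinj z h4, h1, h2⟩, h3⟩, h5⟩
  have hclosed : IsClosed {z | z ∈ momentumLevel m L ∧ energy m z ≤ E} := by
    rw [heq]
    refine IsClosed.inter (IsClosed.inter (IsClosed.inter ?_ ?_) ?_) ?_
    · exact isClosed_eq (by fun_prop) continuous_const
    · exact isClosed_eq (by fun_prop) continuous_const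
    · refine isClosed_eq ?_ continuous_const
      unfold angularMomentum
      fun_prop
    · refine ContinuousOn.preimage_isClosed_of_isClosed
        ((continuousOn_energy m).mono fun z hz => hinj z hz) ?_ isClosed_Iic
      simp only [ofPred_forall]
      exact isClosed_iInter fun k => isClosed_le continuous_const (continuous_side k).norm
  refine Metric.isCompact_of_isClosed_isBounded hclosed ?_
  have hbdd : ∀ z ∈ {z | z ∈ momentumLevel m L ∧ energy m z ≤ E},
      ‖z‖ ≤ max R (√((∑ i, m i) * K)) := by
    rintro z ⟨hz, hzE⟩
    obtain ⟨h1, h2⟩ := h z hz hzE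
    have hR0 : 0 ≤ R := (norm_nonneg _).trans (h2 0).2
    have hT0 : ∀ j, 0 ≤ ‖z.2 j‖ ^ 2 / m j := fun j => div_nonneg (sq_nonneg _) (hm j).le
    rw [Prod.norm_def]
    refine max_le_max ((pi_norm_le_iff_of_nonneg hR0).2 ?_)
      ((pi_norm_le_iff_of_nonneg (Real.sqrt_nonneg _)).2 fun i => ?_)
    · exact norm_pos_le_of_norm_side_le hm hz.1.2.1 fun k => (h2 k).2
    · refine Real.le_sqrt_of_sq_le ?_
      have h3 : ‖z.2 i‖ ^ 2 / m i ≤ K :=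
        (Finset.single_le_sum (fun j _ => hT0 j) (Finset.mem_univ i)).trans h1
      have h4 : m i ≤ ∑ j, m j :=
        Finset.single_le_sum (fun j _ => (hm j).le) (Finset.mem_univ i)
      rw [div_le_iff₀ (hm i)] at h3
      have h5 : 0 ≤ K := (Finset.sum_nonneg fun j _ => hT0 j).trans h1
      nlinarith
  exact isBounded_iff_forall_norm_le.2 ⟨_, hbdd⟩

end

/-! ### Trial states below the escape energy, and the minimum of the energy -/

section

variable {m a b : Fin 3 → ℝ} {L : Matrix (Fin 4) (Fin 4) ℝ} {z : State} {E : ℝ}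

theorem wedge_smul_smul (s t : ℝ) (x p : Space) : wedge (s • x) (t • p) = (s * t) • wedge x p := by
  ext i j
  simp [wedge_apply]
  ring

theorem sum_eq_shift (f : Fin 3 → ℝ) (k : Fin 3) : ∑ i, f i = f k + f (k + 1) + f (k + 2) := by
  fin_cases k <;> simp [Fin.sum_univ_three] <;> ring

/-- The pair opposite to `k` has the position and momentum of a circular binary in the plane of
smallest angular velocity, and body `k` is placed far away with the remaining angular momentum. At
distance of order `R` its kinetic cost is of order `R⁻²`, its gain in potential of order `R⁻¹`. -/
theorem exists_energy_lt_escape (hm : ∀ i, 0 < m i) (hf : MassFrame m a b)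
    (hskew : L.transpose = -L) {σ : ℝ} (hσ : 0 < σ) {e e' : Space} (he : ‖e‖ = 1) (he' : ‖e'‖ = 1)
    (hee : ⟪e, e'⟫ = 0) (h1 : act L e = -σ • e') (h2 : act L e' = σ • e) (k : Fin 3) :
    ∃ z ∈ momentumLevel m L,
      energy m z < -(pairMass m k ^ 2 / (2 * (σ ^ 2 * (side a k ^ 2 + side b k ^ 2)))) := by
  obtain ⟨a', b', hf', hφ, hd⟩ : ∃ a' b', MassFrame m a' b' ∧ side b' k = 0 ∧
      side a' k ^ 2 = side a k ^ 2 + side b k ^ 2 := by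
    obtain ⟨φ, hφ⟩ := exists_rotSnd_eq_zero (side a) (side b) k
    refine ⟨_, _, hf.rotate φ, by rw [side_rotSnd, hφ], ?_⟩
    rw [← rot_sq_add_sq φ, hφ, side_rotFst]
    ring
  rw [← hd]
  clear hd hf
  rename' a' => a, b' => b, hf' => hf
  obtain ⟨f, N, hfn, hef, hdec⟩ := exists_wedge_decomposition hskew he he' hee h1 h2
  have hμ := pairMass_pos hm
  have hM := totalMass_pos hm
  have hα2 := hf.triangleFrame.sq_add_sq_pos hM k
  rw [hφ] at hα2
  have hα : 0 < |side a k| := abs_pos.2 (by rintro h; simp [h] at hα2)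
  -- The minimiser of `σ² / (2 ρ²) - μ / (|α| ρ)`, the energy of the binary.
  set ρ : ℝ := σ ^ 2 * |side a k| / pairMass m k with hρ
  have hρ0 : 0 < ρ := div_pos (by positivity) (hμ k)
  -- Since `R ≥ 1`, the side `k + 1` is at most `C * R`; and `R` is so large that `‖N‖² / (2 R²)` is
  -- less than `μ / (C R)`.
  set C : ℝ := |side a (k + 1)| * ρ + |side b (k + 1)| + 1 with hC
  have hC0 : 0 < C := by positivity
  set R : ℝ := 1 + ‖N‖ ^ 2 * C / pairMass m (k + 1) with hR
  have hR1 : 1 ≤ R := by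
    have := hμ (k + 1)
    have : 0 ≤ ‖N‖ ^ 2 * C / pairMass m (k + 1) := by positivity
    linarith
  have hR0 : 0 < R := by linarith
  have hnorm : ∀ j, ‖side a j • (ρ • e) + side b j • (R • f)‖ ^ 2 =
      side a j ^ 2 * ρ ^ 2 + side b j ^ 2 * R ^ 2 := by
    intro j
    rw [norm_add_sq_real]
    simp only [real_inner_smul_left, real_inner_smul_right, hef, norm_smul, he, hfn, mul_pow,
      Real.norm_eq_abs, sq_abs]
    ring
  have hne : ∀ j, side a j • (ρ • e) + side b j • (R • f) ≠ 0 := by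
    intro j h0
    have h3 := hnorm j
    rw [h0, norm_zero] at h3
    have h4 := hf.triangleFrame.side_pos hM j (pow_pos hρ0 2) (pow_pos hR0 2)
    linarith
  set z := ofJacobi m a b (ρ • e) (R • f) ((σ / ρ) • e') (R⁻¹ • N) with hz
  have hzP : z ∈ phaseSpace m := hf.ofJacobi_mem hne
  obtain ⟨p1, p2⟩ := hf.jacobiPos_ofJacobi (ρ • e) (R • f) ((σ / ρ) • e') (R⁻¹ • N)
  obtain ⟨p3, p4⟩ := hf.jacobiMom_ofJacobi (ρ • e) (R • f) ((σ / ρ) • e') (R⁻¹ • N)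
  rw [← hz] at p1 p2 p3 p4
  have hside : ∀ j, ‖side z.1 j‖ ^ 2 = side a j ^ 2 * ρ ^ 2 + side b j ^ 2 * R ^ 2 := by
    intro j
    rw [hf.side_eq hzP, p1, p2, hnorm]
  have hrpos : ∀ j, 0 < ‖side z.1 j‖ := fun j => norm_pos_iff.2 (side_ne_zero hzP.1 j)
  refine ⟨z, ⟨hzP, ?_⟩, ?_⟩
  · rw [hf.angularMomentum_eq hzP, p1, p2, p3, p4, wedge_smul_smul, wedge_smul_smul,
      mul_inv_cancel₀ hR0.ne', one_smul, mul_div_cancel₀ _ hρ0.ne', ← hdec]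
  have hrk : ‖side z.1 k‖ = |side a k| * ρ := by
    rw [← sq_eq_sq₀ (norm_nonneg _) (by positivity), hside, hφ, mul_pow, sq_abs]
    ring
  have hrj : ‖side z.1 (k + 1)‖ ≤ C * R := by
    refine le_of_sq_le_sq ?_ (by positivity)
    rw [hside]
    have h5 : |side a (k + 1)| * ρ + |side b (k + 1)| * R ≤ C * R := by
      rw [hC]
      have : 0 ≤ |side a (k + 1)| * ρ := by positivity
      nlinarith
    have h6 : (|side a (k + 1)| * ρ + |side b (k + 1)| * R) ^ 2 ≤ (C * R) ^ 2 := by gcongr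
    have h7 : 0 ≤ |side a (k + 1)| * ρ * (|side b (k + 1)| * R) := by positivity
    rw [← sq_abs (side a (k + 1)), ← sq_abs (side b (k + 1))]
    nlinarith
  rw [energy_eq, hf.kinetic_eq hm hzP, p3, p4, sum_eq_shift _ k, hrk]
  simp only [norm_smul, he', norm_inv, Real.norm_eq_abs, abs_of_pos hR0,
    abs_of_pos (div_pos hσ hρ0)]
  have h8 : pairMass m (k + 1) / (C * R) ≤ pairMass m (k + 1) / ‖side z.1 (k + 1)‖ :=
    div_le_div_of_nonneg_left (hμ _).le (hrpos _) hrj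
  have h9 : 0 < pairMass m (k + 2) / ‖side z.1 (k + 2)‖ := div_pos (hμ _) (hrpos _)
  have h10 : 1 / 2 * (R⁻¹ * ‖N‖) ^ 2 < pairMass m (k + 1) / (C * R) := by
    have h11 : pairMass m (k + 1) * R = pairMass m (k + 1) + ‖N‖ ^ 2 * C := by
      rw [hR, mul_add, mul_div_cancel₀ _ (hμ _).ne', mul_one]
    have h12 := hμ (k + 1)
    have h13 : 1 / 2 * (R⁻¹ * ‖N‖) ^ 2 = ‖N‖ ^ 2 / (2 * R ^ 2) := by field_simp
    rw [h13, div_lt_div_iff₀ (by positivity) (by positivity)]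
    have h14 : 0 ≤ ‖N‖ ^ 2 * C := by positivity
    nlinarith
  have h15 : 1 / 2 * (σ / ρ * 1) ^ 2 - pairMass m k / (|side a k| * ρ) =
      -(pairMass m k ^ 2 / (2 * (σ ^ 2 * side a k ^ 2))) := by
    have := (hμ k).ne'
    rw [hρ, ← sq_abs (side a k)]
    field_simp
    ring
  linarith

/-- There is a level of the energy above the minimum whose sublevel set is compact. -/
theorem exists_isCompact_sublevel (hm : ∀ i, 0 < m i) (hskew : L.transpose = -L)
    (hL : IsUnit L) : ∃ E₁ < 0, (∃ z ∈ momentumLevel m L, energy m z < E₁) ∧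
      IsCompact {z | z ∈ momentumLevel m L ∧ energy m z ≤ E₁} := by
  obtain ⟨a, b, hf⟩ := exists_massFrame hm
  obtain ⟨σ, hσ, e, e', he, he', hee, h1, h2, hle⟩ := exists_minimal_plane hskew hL
  obtain ⟨k, -, hk⟩ := Finset.exists_min_image Finset.univ
    (fun k => -(pairMass m k ^ 2 / (2 * (σ ^ 2 * (side a k ^ 2 + side b k ^ 2)))))
    ⟨0, Finset.mem_univ _⟩
  obtain ⟨z, hz, hzE⟩ := exists_energy_lt_escape hm hf hskew hσ he he' hee h1 h2 k
  obtain ⟨E₁, hE1, hE2⟩ := exists_between hzE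
  have hpos := hf.triangleFrame.sq_add_sq_pos (totalMass_pos hm) k
  have hμ := pairMass_pos hm k
  refine ⟨E₁, hE2.trans (neg_neg_of_pos (by positivity)), ⟨z, hz, hE1⟩, ?_⟩
  obtain ⟨δ, hδ, R, K, hb⟩ := sublevel_bounds hm hf hσ hle fun j =>
    hE2.trans_le (hk j (Finset.mem_univ _))
  exact isCompact_sublevel_of_bounds hm hδ hb

theorem continuousOn_energy_momentumLevel (m : Fin 3 → ℝ) (L : Matrix (Fin 4) (Fin 4) ℝ) :
    ContinuousOn (energy m) (momentumLevel m L) :=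
  (continuousOn_energy m).mono fun _ hz => hz.1.1

/-- The state with positions multiplied by `s` and momenta divided by `s`. -/
def dilate (s : ℝ) (z : State) : State := (fun i => s • z.1 i, fun i => s⁻¹ • z.2 i)

theorem dilate_mem {s : ℝ} (hs : s ≠ 0) (hz : z ∈ momentumLevel m L) :
    dilate s z ∈ momentumLevel m L := by
  obtain ⟨⟨h1, h2, h3⟩, h4⟩ := hz
  refine ⟨⟨fun i j h => h1 (smul_right_injective _ hs h), ?_, ?_⟩, ?_⟩
  · simp only [dilate, smul_comm _ s, ← Finset.smul_sum, h2, smul_zero]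
  · simp only [dilate, ← Finset.smul_sum, h3, smul_zero]
  · rw [← h4, angularMomentum_eq, angularMomentum_eq]
    simp only [dilate, wedge_smul_smul, mul_inv_cancel₀ hs, one_smul]

theorem energy_dilate {s : ℝ} (hs : 0 < s) (z : State) : energy m (dilate s z) =
    1 / 2 * (∑ i, ‖z.2 i‖ ^ 2 / m i) * s⁻¹ ^ 2 - (∑ k, pairMass m k / ‖side z.1 k‖) * s⁻¹ := by
  have h1 : ∀ k, side (dilate s z).1 k = s • side z.1 k := fun k => by
    simp only [side, dilate, smul_sub]
  rw [energy_eq]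
  simp only [h1]
  simp only [dilate, norm_smul, norm_inv, Real.norm_eq_abs, abs_of_pos hs, Finset.mul_sum,
    Finset.sum_mul]
  congr 1
  · exact Finset.sum_congr rfl fun i _ => by ring
  · exact Finset.sum_congr rfl fun k _ => by rw [div_mul_eq_div_div_swap, div_eq_mul_inv _ s]

/-- Dilation by `t⁻¹` preserves the angular momentum and changes the energy into `K t² / 2 - U t`,
which tends to zero with `t`; the intermediate value theorem applies. -/
theorem integralManifold_nonempty (hm : ∀ i, 0 < m i) (hz : z ∈ momentumLevel m L)
    (hzE : energy m z ≤ E) (hE : E < 0) : (integralManifold m L E).Nonempty := by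
  set K := ∑ i, ‖z.2 i‖ ^ 2 / m i with hK
  set U := ∑ k, pairMass m k / ‖side z.1 k‖ with hU
  have hK0 : 0 ≤ K := Finset.sum_nonneg fun i _ => div_nonneg (sq_nonneg _) (hm i).le
  have hU0 : 0 < U := Finset.sum_pos (fun k _ => div_pos (pairMass_pos hm k)
    (norm_pos_iff.2 (side_ne_zero hz.1.1 k))) Finset.univ_nonempty
  set u := min 1 (-E / U) with hu
  have hu0 : 0 < u := lt_min one_pos (div_pos (neg_pos.2 hE) hU0)
  let f : ℝ → ℝ := fun t => 1 / 2 * K * t ^ 2 - U * t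
  have hf1 : f 1 ≤ E := by
    rw [energy_eq, ← hK, ← hU] at hzE
    simp only [f]
    linarith
  have hfu : E ≤ f u := by
    have h1 : u * U ≤ -E := (le_div_iff₀ hU0).1 (min_le_right _ _)
    have h2 : 0 ≤ 1 / 2 * K * u ^ 2 := by positivity
    simp only [f]
    linarith
  obtain ⟨t, ht, hft⟩ := intermediate_value_Icc' (min_le_left 1 (-E / U))
    (f := f) (by fun_prop) ⟨hf1, hfu⟩
  have ht0 : 0 < t := hu0.trans_le ht.1
  refine ⟨dilate t⁻¹ z, dilate_mem (inv_pos.2 ht0).ne' hz, ?_⟩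
  rw [energy_dilate (inv_pos.2 ht0), inv_inv, ← hft]

/-- The gap `ε` stops at the compact sublevel and before the next of the finitely many energies of
relative equilibria. -/
theorem exists_isLeast_energy (hm : ∀ i, 0 < m i) (hskew : L.transpose = -L) (hL : IsUnit L) :
    ∃ E₀, IsLeast (energy m '' momentumLevel m L) E₀ ∧
      ∃ ε > 0, ∀ E, E₀ < E → E < E₀ + ε → (integralManifold m L E).Nonempty ∧
        IsCompact (integralManifold m L E) ∧
        ∀ z ∈ integralManifold m L E, IsRegularPoint m z := by
  obtain ⟨E₁, hE₁, ⟨z₁, hz₁, hzE₁⟩, hK⟩ := exists_isCompact_sublevel hm hskew hL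
  have hcont := (continuousOn_energy_momentumLevel m L).mono
    (fun z (hz : z ∈ {z | z ∈ momentumLevel m L ∧ energy m z ≤ E₁}) => hz.1)
  obtain ⟨z₀, hz₀, hmin⟩ := hK.exists_isMinOn ⟨z₁, hz₁, hzE₁.le⟩ hcont
  have h01 : energy m z₀ < E₁ := (hmin ⟨hz₁, hzE₁.le⟩).trans_lt hzE₁
  have hfin := finite_relEq_energies hm hL
  set F := {E : ℝ | ∃ z ∈ momentumLevel m L, (∃ Ω, IsRelEq m Ω z) ∧ energy m z = E}
  have hgap : ∀ᶠ E in 𝓝[>] (energy m z₀), E ∉ F := by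
    have h1 := (hfin.subset (Set.sep_subset F (· ≠ energy m z₀))).isClosed.isOpen_compl.mem_nhds
      (show energy m z₀ ∈ {E ∈ F | E ≠ energy m z₀}ᶜ from fun h => h.2 rfl)
    filter_upwards [nhdsWithin_le_nhds h1, self_mem_nhdsWithin] with E h2 h3 h4
    exact h2 ⟨h4, (ne_of_gt h3 : E ≠ energy m z₀)⟩
  obtain ⟨E₂, hE₂, hE₂'⟩ := (mem_nhdsGT_iff_exists_Ioo_subset).1 hgap
  refine ⟨energy m z₀, ⟨⟨z₀, hz₀.1, rfl⟩, ?_⟩, min E₁ E₂ - energy m z₀,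
    sub_pos.2 (lt_min h01 hE₂), ?_⟩
  · rintro _ ⟨z, hz, rfl⟩
    rcases le_total (energy m z) E₁ with h | h
    · exact hmin ⟨hz, h⟩
    · exact h01.le.trans h
  · intro E hE hE'
    rw [add_sub_cancel] at hE'
    obtain ⟨hEE₁, hEE₂⟩ := lt_min_iff.1 hE'
    refine ⟨integralManifold_nonempty hm hz₀.1 hE.le (hEE₁.trans hE₁), ?_, ?_⟩
    · have hcl := hcont.preimage_isClosed_of_isClosed hK.isClosed (isClosed_singleton (x := E))
      convert! hK.of_isClosed_subset hcl inter_subset_left using 1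
      ext z
      exact ⟨fun h => ⟨⟨h.1, h.2.le.trans hEE₁.le⟩, h.2⟩, fun h => ⟨h.1.1, h.2⟩⟩
    · rintro z ⟨hz, hzE⟩
      by_contra hreg
      exact hE₂' ⟨hE, hEE₂⟩ ⟨z, hz,
        exists_isRelEq_of_not_isRegularPoint hm hz.1 (by rwa [hz.2]) hreg, hzE⟩

end

section

/-! ### Relative equilibria of the same shape -/

variable {m a b : Fin 3 → ℝ} {L Ω Ω' : Matrix (Fin 4) (Fin 4) ℝ} {z w : State}

theorem act_colMatrix_mul {R : Matrix (Fin 4) (Fin 4) ℝ} {X P Y Q X' P' Y' Q' : Space}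
    (h : R * colMatrix X P Y Q = colMatrix X' P' Y' Q') :
    act R X = X' ∧ act R P = P' ∧ act R Y = Y' ∧ act R Q = Q' := by
  have key : ∀ j, act R (![X, P, Y, Q] j) = ![X', P', Y', Q'] j := by
    intro j
    ext i
    have := congrFun (congrFun h i) j
    simpa [Matrix.mul_apply, colMatrix, act_ofLp, Matrix.mulVec, dotProduct] using this
  exact ⟨key 0, key 1, key 2, key 3⟩

theorem mem_specialOrthogonalGroup {R : Matrix (Fin 4) (Fin 4) ℝ} (h : R.transpose * R = 1)
    (hdet : R.det = 1) : R ∈ Matrix.specialOrthogonalGroup (Fin 4) ℝ :=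
  Matrix.mem_specialOrthogonalGroup_iff.2 ⟨(Matrix.mem_orthogonalGroup_iff' _ _).2 h, hdet⟩

theorem transpose_mul_self_of_mem {R : Matrix (Fin 4) (Fin 4) ℝ}
    (h : R ∈ Matrix.specialOrthogonalGroup (Fin 4) ℝ) : R.transpose * R = 1 :=
  (Matrix.mem_orthogonalGroup_iff' _ _).1 (Matrix.mem_specialOrthogonalGroup_iff.1 h).1

/-- The linear map between the two bases is orthogonal because the Gram matrices agree. It preserves
orientation because both bases have the same determinant, the common Pfaffian. -/
theorem exists_rotation_of_gram_eq {X P Y Q X' P' Y' Q' : Space}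
    (hpf : pfaffian (wedge X P + wedge Y Q) ≠ 0)
    (hL : wedge X P + wedge Y Q = wedge X' P' + wedge Y' Q')
    (hgram : ∀ i j, ⟪![X, P, Y, Q] i, ![X, P, Y, Q] j⟫ =
      ⟪![X', P', Y', Q'] i, ![X', P', Y', Q'] j⟫) :
    ∃ R ∈ Matrix.specialOrthogonalGroup (Fin 4) ℝ,
      act R X = X' ∧ act R P = P' ∧ act R Y = Y' ∧ act R Q = Q' := by
  have hdet : (colMatrix X' P' Y' Q').det = (colMatrix X P Y Q).det := by
    rw [← pfaffian_wedge_add_wedge, ← pfaffian_wedge_add_wedge, hL]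
  rw [pfaffian_wedge_add_wedge] at hpf
  have hgram' : (colMatrix X P Y Q).transpose * colMatrix X P Y Q =
      (colMatrix X' P' Y' Q').transpose * colMatrix X' P' Y' Q' := by
    ext i j
    rw [gram_colMatrix, gram_colMatrix, hgram]
  generalize hZ : colMatrix X P Y Q = Z at *
  generalize hW : colMatrix X' P' Y' Q' = W at *
  have hu : IsUnit Z.det := isUnit_iff_ne_zero.2 hpf
  have hmul : W * Z⁻¹ * Z = W := by
    rw [Matrix.mul_assoc, Matrix.nonsing_inv_mul _ hu, Matrix.mul_one]
  refine ⟨W * Z⁻¹, mem_specialOrthogonalGroup ?_ ?_, ?_⟩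
  · rw [Matrix.transpose_mul, Matrix.mul_assoc, ← Matrix.mul_assoc W.transpose, ← hgram',
      Matrix.mul_assoc, Matrix.mul_nonsing_inv _ hu, Matrix.mul_one, ← Matrix.transpose_mul,
      Matrix.mul_nonsing_inv _ hu, Matrix.transpose_one]
  · rw [Matrix.det_mul, Matrix.det_nonsing_inv, hdet, Ring.mul_inverse_cancel _ hu]
  · rw [← hZ, ← hW] at hmul
    rw [← hZ, ← hW]
    exact act_colMatrix_mul hmul

theorem gram_eq {X P Y Q X' P' Y' Q' : Space} (h1 : ‖X‖ ^ 2 = ‖X'‖ ^ 2) (h2 : ‖P‖ ^ 2 = ‖P'‖ ^ 2)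
    (h3 : ‖Y‖ ^ 2 = ‖Y'‖ ^ 2) (h4 : ‖Q‖ ^ 2 = ‖Q'‖ ^ 2) (h5 : ⟪X, P⟫ = ⟪X', P'⟫)
    (h6 : ⟪X, Y⟫ = ⟪X', Y'⟫) (h7 : ⟪X, Q⟫ = ⟪X', Q'⟫) (h8 : ⟪Y, P⟫ = ⟪Y', P'⟫)
    (h9 : ⟪P, Q⟫ = ⟪P', Q'⟫) (h10 : ⟪Y, Q⟫ = ⟪Y', Q'⟫) (i j : Fin 4) :
    ⟪![X, P, Y, Q] i, ![X, P, Y, Q] j⟫ = ⟪![X', P', Y', Q'] i, ![X', P', Y', Q'] j⟫ := by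
  rw [← real_inner_self_eq_norm_sq, ← real_inner_self_eq_norm_sq] at h1 h2 h3 h4
  have comm : ∀ {x y x' y' : Space}, ⟪x, y⟫ = ⟪x', y'⟫ → ⟪y, x⟫ = ⟪y', x'⟫ := fun h => by
    rw [real_inner_comm, h, real_inner_comm]
  have s5 := comm h5
  have s6 := comm h6
  have s7 := comm h7
  have s8 := comm h8
  have s9 := comm h9
  have s10 := comm h10
  fin_cases i <;> fin_cases j <;> assumption

theorem MassFrame.rotate_eq_of_act (hf : MassFrame m a b) (hz : z ∈ phaseSpace m)
    (hw : w ∈ phaseSpace m) {R : Matrix (Fin 4) (Fin 4) ℝ}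
    (h1 : act R (jacobiPos m a z) = jacobiPos m a w)
    (h2 : act R (jacobiPos m b z) = jacobiPos m b w)
    (h3 : act R (jacobiMom a z) = jacobiMom a w)
    (h4 : act R (jacobiMom b z) = jacobiMom b w) : ThreeBody.rotate R z = w := by
  rw [rotate_eq]
  refine Prod.ext (funext fun i => ?_) (funext fun i => ?_)
  · simp only [hf.pos_eq hz i, hf.pos_eq hw i, map_add, map_smul, h1, h2]
  · simp only [hf.mom_eq hz i, hf.mom_eq hw i, map_add, map_smul, h3, h4]

theorem MassFrame.inner_jacobiPos_eq (hm : ∀ i, 0 < m i) (hf : MassFrame m a b)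
    (hz : z ∈ phaseSpace m) (hw : w ∈ phaseSpace m)
    (h : ∀ k, ‖side z.1 k‖ ^ 2 = ‖side w.1 k‖ ^ 2) :
    ‖jacobiPos m a z‖ ^ 2 = ‖jacobiPos m a w‖ ^ 2 ∧
    ‖jacobiPos m b z‖ ^ 2 = ‖jacobiPos m b w‖ ^ 2 ∧
    ⟪jacobiPos m a z, jacobiPos m b z⟫ = ⟪jacobiPos m a w, jacobiPos m b w⟫ := by
  simp only [norm_side_sq hf hz, norm_side_sq hf hw] at h
  have hd := hf.triangleFrame.det_ne_zero (totalMass_pos hm) (i := 0) (j := 1) (by decide)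
  have s1 := hf.triangleFrame.sum_left
  have s2 := hf.triangleFrame.sum_right
  simp only [Fin.sum_univ_three] at s1 s2
  have e0 : side a 2 = -side a 0 - side a 1 := by linarith
  have e1 : side b 2 = -side b 0 - side b 1 := by linarith
  have h0 := h 0
  have h1 := h 1
  have h2 := h 2
  rw [e0, e1] at h2
  have hd2 := pow_ne_zero 2 hd
  generalize side a 0 = α₀ at *
  generalize side a 1 = α₁ at *
  generalize side b 0 = β₀ at *
  generalize side b 1 = β₁ at *
  refine ⟨mul_left_cancel₀ hd2 ?_, mul_left_cancel₀ hd2 ?_, mul_left_cancel₀ hd2 ?_⟩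
  · linear_combination β₁ ^ 2 * h0 + β₀ ^ 2 * h1 - β₀ * β₁ * (h2 - h0 - h1)
  · linear_combination α₁ ^ 2 * h0 + α₀ ^ 2 * h1 - α₀ * α₁ * (h2 - h0 - h1)
  · linear_combination -(α₁ * β₁) * h0 - α₀ * β₀ * h1 +
      (α₀ * β₁ + α₁ * β₀) / 2 * (h2 - h0 - h1)

theorem accel_eq_of_side_eq (hz : z ∈ phaseSpace m) (hw : w ∈ phaseSpace m)
    (h : ∀ k, ‖side z.1 k‖ ^ 2 = ‖side w.1 k‖ ^ 2) (c d : Fin 3 → ℝ) :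
    accel m c d z = accel m c d w := by
  simp only [accel, attraction_eq_invCube hz, attraction_eq_invCube hw, h]

/-- Two relative equilibria with the same angular momentum and congruent triangles are equal up to
rotation, if a sign agrees. -/
theorem IsRelEq.exists_rotation (hz : IsRelEq m Ω z) (hw : IsRelEq m Ω' w) (hm : ∀ i, 0 < m i)
    (hL : IsUnit L) (hzL : z ∈ momentumLevel m L) (hwL : w ∈ momentumLevel m L)
    (hp : IsPrincipalFrame m a b z) (h : ∀ k, ‖side z.1 k‖ ^ 2 = ‖side w.1 k‖ ^ 2)
    (hκ : ⟪jacobiPos m a z, jacobiMom b z⟫ = 0 ∨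
      0 < ⟪jacobiPos m a z, jacobiMom b z⟫ * ⟪jacobiPos m a w, jacobiMom b w⟫) :
    ∃ R ∈ Matrix.specialOrthogonalGroup (Fin 4) ℝ, rotate R z = w := by
  have hpfz : pfaffian (angularMomentum z) ≠ 0 := pfaffian_ne_zero hm hzL.1 (by rwa [hzL.2])
  have hLL : angularMomentum z = angularMomentum w := hzL.2.trans hwL.2.symm
  have hpfw : pfaffian (angularMomentum w) ≠ 0 := by rwa [← hLL]
  obtain ⟨g1, g2, g3⟩ := hp.frame.inner_jacobiPos_eq hm hzL.1 hwL.1 h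
  have hA := accel_eq_of_side_eq hzL.1 hwL.1 h
  have hp' : IsPrincipalFrame m a b w :=
    ⟨hp.frame, by rw [← g3, hp.orth], by rw [← hA, hp.accel_eq]⟩
  obtain ⟨z1, z2, z3, z4, z5, z6, z7⟩ := hz.inner_eq hp hzL.1
  obtain ⟨w1, w2, w3, w4, w5, w6, w7⟩ := hw.inner_eq hp' hwL.1
  obtain ⟨-, -, -, -, bz⟩ := hz.principal_bounds hp hzL.1 hpfz
  obtain ⟨-, -, -, -, bw⟩ := hw.principal_bounds hp' hwL.1 hpfw
  have iz := (hz.invariants hp hzL.1).2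
  have iw := (hw.invariants hp' hwL.1).2
  -- If the diagonal accelerations differ, both numbers vanish. If they agree, the squared Pfaffian
  -- is the square of a non-negative quantity that determines `⟪X, Q⟫ ^ 2`.
  have hsq : ⟪jacobiPos m a z, jacobiMom b z⟫ ^ 2 = ⟪jacobiPos m a w, jacobiMom b w⟫ ^ 2 := by
    rw [← hA, ← hA, ← g1, ← g2, ← hLL, iz] at iw
    rw [← hA, ← hA] at w7
    rw [← hA, ← g1, ← g2] at bw
    rcases eq_or_ne (accel m a a z) (accel m b b z) with hab | hab
    · rw [hab, ← sq, ← sq, sq_eq_sq₀ (sub_nonneg.2 bz) (sub_nonneg.2 bw)] at iw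
      linarith
    · rw [(mul_eq_zero.1 z7).resolve_left (sub_ne_zero.2 hab),
        (mul_eq_zero.1 w7).resolve_left (sub_ne_zero.2 hab)]
  have hκ' : ⟪jacobiPos m a z, jacobiMom b z⟫ = ⟪jacobiPos m a w, jacobiMom b w⟫ := by
    rcases sq_eq_sq_iff_eq_or_eq_neg.1 hsq with h0 | h0
    · exact h0
    · rcases hκ with h1 | h1
      · rw [h1] at hsq ⊢
        exact (pow_eq_zero_iff two_ne_zero |>.1 (by rw [← hsq]; norm_num)).symm
      · rw [h0] at h1
        nlinarith [sq_nonneg ⟪jacobiPos m a w, jacobiMom b w⟫]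
  rw [hp.frame.angularMomentum_eq hzL.1] at hLL hpfz
  rw [hp.frame.angularMomentum_eq hwL.1] at hLL
  rw [← hA, ← g1] at w5
  rw [← hA, ← g2] at w6
  have c1 := hp.orth
  have c2 := hp'.orth
  obtain ⟨R, hR, r1, r2, r3, r4⟩ := exists_rotation_of_gram_eq hpfz hLL
    (gram_eq g1 (z5.trans w5.symm) g2 (z6.trans w6.symm) (z1.trans w1.symm) (c1.trans c2.symm) hκ'
      (by rw [z3, w3, hκ']) (z4.trans w4.symm) (z2.trans w2.symm))
  exact ⟨R, hR, hp.frame.rotate_eq_of_act hzL.1 hwL.1 r1 r3 r2 r4⟩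

/-- Relative equilibria with a given angular momentum are isolated, up to rotations. -/
theorem IsRelEq.isolated (hz : IsRelEq m Ω z) (hm : ∀ i, 0 < m i) (hL : IsUnit L)
    (hzL : z ∈ momentumLevel m L) : ∀ᶠ w in 𝓝 z, w ∈ momentumLevel m L →
      (∃ Ω', IsRelEq m Ω' w) → ∃ R ∈ Matrix.specialOrthogonalGroup (Fin 4) ℝ, rotate R z = w := by
  obtain ⟨a₀, b₀, hf₀⟩ := exists_massFrame hm
  obtain ⟨φ, hp⟩ := hz.exists_isPrincipalFrame hf₀ hzL.1
  generalize rotFst φ a₀ b₀ = a at hp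
  generalize rotSnd φ a₀ b₀ = b at hp
  set F := {s : Fin 3 → ℝ | ∃ z ∈ momentumLevel m L, (∃ Ω, IsRelEq m Ω z) ∧
      ∀ k, s k = ‖side z.1 k‖ ^ 2}
  have hF : F.Finite := finite_relEq_shapes hm hL
  let sh : State → Fin 3 → ℝ := fun w k => ‖side w.1 k‖ ^ 2
  have hsh : Continuous sh := continuous_pi fun k => (continuous_side k).norm.pow 2
  -- There are finitely many shapes, so a relative equilibrium close to `z` has the shape of `z`; by
  -- continuity it also has the same sign of `⟪X, Q⟫` if this is not zero.
  have h1 : ∀ᶠ w in 𝓝 z, sh w ∉ {s ∈ F | s ≠ sh z} :=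
    hsh.continuousAt.eventually ((hF.subset (Set.sep_subset F _)).isClosed.isOpen_compl.mem_nhds
      (show sh z ∈ {s ∈ F | s ≠ sh z}ᶜ from fun h => h.2 rfl))
  have h2 : ∀ᶠ w in 𝓝 z, ⟪jacobiPos m a z, jacobiMom b z⟫ = 0 ∨
      0 < ⟪jacobiPos m a z, jacobiMom b z⟫ * ⟪jacobiPos m a w, jacobiMom b w⟫ := by
    rcases eq_or_ne ⟪jacobiPos m a z, jacobiMom b z⟫ 0 with h0 | h0
    · exact Eventually.of_forall fun w => Or.inl h0
    · have hc : Continuous fun w : State =>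
          ⟪jacobiPos m a z, jacobiMom b z⟫ * ⟪jacobiPos m a w, jacobiMom b w⟫ := by
        unfold jacobiPos jacobiMom
        fun_prop
      filter_upwards [hc.continuousAt.eventually (lt_mem_nhds (mul_self_pos.2 h0))] with w hw
      exact Or.inr hw
  filter_upwards [h1, h2] with w hw1 hw2 hwL hw
  obtain ⟨Ω', hΩ'⟩ := hw
  refine hz.exists_rotation hΩ' hm hL hzL hwL hp (fun k => ?_) hw2
  by_contra hne
  exact hw1 ⟨⟨w, hwL, ⟨Ω', hΩ'⟩, fun k => rfl⟩, fun h => hne (congrFun h k).symm⟩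

end

section

/-! ### Global solutions and conservation laws -/

/-- A vector field that is Lipschitz and bounded has global integral curves. -/
theorem exists_global_integralCurve {V : Type*} [NormedAddCommGroup V] [NormedSpace ℝ V]
    [CompleteSpace V] {X : V → V} {K : NNReal} (hX : LipschitzWith K X) {B : ℝ}
    (hB : ∀ x, ‖X x‖ ≤ B) (x₀ : V) :
    ∃ γ : ℝ → V, γ 0 = x₀ ∧ ∀ t, HasDerivAt γ (X (γ t)) t := by
  have hloc : ∀ a : ℝ, 0 < a → ∃ γ : ℝ → V, γ 0 = x₀ ∧
      ∀ t ∈ Ioo (-a) a, HasDerivAt γ (X (γ t)) t := by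
    intro a ha
    have hB0 : 0 ≤ B := (norm_nonneg _).trans (hB x₀)
    -- The bound `B` is global, so a ball of radius `B * a` contains the solution for time `a`,
    -- however long.
    have hPL : IsPicardLindelof (fun _ => X) (⟨0, by simp [ha.le]⟩ : Icc (-a) a) x₀
        (⟨B * a, by positivity⟩ : NNReal) 0 ⟨B, hB0⟩ K := by
      refine IsPicardLindelof.of_time_independent (fun x _ => hB x) hX.lipschitzOnWith ?_
      simp
      exact le_rfl
    obtain ⟨γ, h0, hγ⟩ := hPL.exists_eq_forall_mem_Icc_hasDerivWithinAt₀
    exact ⟨γ, h0, fun t ht =>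
      (hγ t (Ioo_subset_Icc_self ht)).hasDerivAt (Icc_mem_nhds ht.1 ht.2)⟩
  choose! γ h0 hγ using hloc
  have huniq : ∀ a b, 0 < a → a ≤ b → EqOn (γ a) (γ b) (Ioo (-a) a) := by
    intro a b ha hab
    refine ODE_solution_unique_of_mem_Ioo (v := fun _ => X) (s := fun _ => univ) (K := K)
      (fun _ _ => hX.lipschitzOnWith) (t₀ := 0) (by simp [ha]) (fun t ht => ⟨hγ a ha t ht, trivial⟩)
      (fun t ht => ⟨hγ b (ha.trans_le hab) t ⟨by linarith [ht.1], by linarith [ht.2]⟩, trivial⟩) ?_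
    rw [h0 a ha, h0 b (ha.trans_le hab)]
  have hmem : ∀ t : ℝ, t ∈ Ioo (-(|t| + 1)) (|t| + 1) := fun t =>
    abs_lt.1 (lt_add_one |t|)
  refine ⟨fun t => γ (|t| + 1) t, h0 _ (by positivity), fun t => ?_⟩
  have hpos : 0 < |t| + 1 := by positivity
  refine (hγ _ hpos t (hmem t)).congr_of_eventuallyEq ?_
  filter_upwards [Ioo_mem_nhds (hmem t).1 (hmem t).2] with s hs
  rcases le_total (|s| + 1) (|t| + 1) with h | h
  · exact huniq _ _ (by positivity) h (hmem s)
  · exact (huniq _ _ hpos h hs).symm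

variable {m : Fin 3 → ℝ} {L : Matrix (Fin 4) (Fin 4) ℝ} {z w : State}

theorem contDiffAt_vectorField (hz : Function.Injective z.1) :
    ContDiffAt ℝ 1 (vectorField m) z := by
  have hq : ∀ i, ContDiff ℝ 1 fun z : State => z.1 i := fun i =>
    (ContinuousLinearMap.proj (R := ℝ) (φ := fun _ : Fin 3 => Space) i).contDiff.comp contDiff_fst
  have hp : ∀ i, ContDiff ℝ 1 fun z : State => z.2 i := fun i =>
    (ContinuousLinearMap.proj (R := ℝ) (φ := fun _ : Fin 3 => Space) i).contDiff.comp contDiff_snd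
  have hs : ∀ k, ContDiffAt ℝ 1 (fun z : State => attraction m z k • side z.1 k) z := by
    intro k
    have h1 : ContDiffAt ℝ 1 (fun z : State => side z.1 k) z := ((hq _).sub (hq _)).contDiffAt
    have h2 := norm_ne_zero_iff.2 (side_ne_zero hz k)
    exact (contDiffAt_const.div ((h1.norm ℝ (side_ne_zero hz k)).pow 3) (pow_ne_zero 3 h2)).smul h1
  have hF : ∀ i, ContDiffAt ℝ 1 (fun z : State => force m z i) z := by
    intro i
    simp only [force_eq]
    exact (hs _).sub (hs _)
  have hv : ∀ i, ContDiffAt ℝ 1 (fun z : State => (m i)⁻¹ • z.2 i) z := fun i =>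
    ((contDiff_const (c := (m i)⁻¹)).fun_smul (hp i)).contDiffAt
  exact ContDiffAt.prodMk (contDiffAt_pi.2 hv) (contDiffAt_pi.2 hF)

/-- The factor `s` makes conservation available for the vector field multiplied by a cut-off
function. -/
theorem energyDeriv_smul_vectorField (m : Fin 3 → ℝ) (z : State) (s : ℝ) :
    energyDeriv m z (s • vectorField m z) = 0 := by
  rw [vectorField_eq, energyDeriv, ← Finset.sum_sub_distrib]
  refine Finset.sum_eq_zero fun i _ => ?_
  simp only [Prod.smul_fst, Prod.smul_snd, Pi.smul_apply, real_inner_smul_right]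
  rw [real_inner_comm]
  field_simp
  ring

theorem wedge_self (x : Space) : wedge x x = 0 := by
  ext i j
  simp [wedge_apply]

theorem momentumDeriv_smul_vectorField (m : Fin 3 → ℝ) (z : State) (s : ℝ) :
    momentumDeriv z (s • vectorField m z) = 0 := by
  have h1 : ∀ x p : Space, ∀ t : ℝ, wedge (t • x) p = t • wedge x p := fun x p t => by
    simpa using wedge_smul_smul t 1 x p
  have h2 : ∀ x p : Space, ∀ t : ℝ, wedge x (t • p) = t • wedge x p := fun x p t => by
    simpa using wedge_smul_smul 1 t x p
  have h3 : ∀ x p p' : Space, wedge x (p - p') = wedge x p - wedge x p' := fun x p p' => by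
    ext i j; simp [wedge_apply]; ring
  have h4 : ∀ x x' p : Space, wedge (x - x') p = wedge x p - wedge x' p := fun x p p' => by
    ext i j; simp [wedge_apply]; ring
  have h5 : ∀ x p : Space, wedge p x = -wedge x p := fun x p => by
    ext i j; simp [wedge_apply]
  simp only [momentumDeriv, vectorField_eq, Prod.smul_fst, Prod.smul_snd, Pi.smul_apply, h1, h2,
    wedge_self, smul_zero, zero_add, ← Finset.smul_sum]
  have h6 : ∑ i, wedge (z.1 i) (force m z i) = 0 := by
    simp only [force_eq, h2, h3, Fin.sum_univ_three, side]
    simp [h5 (z.1 0) (z.1 1), h5 (z.1 0) (z.1 2), h5 (z.1 1) (z.1 2), wedge_self]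
    module
  rw [h6, smul_zero]

/-- The first integrals are constant along a time change of a motion, at least to first order. -/
theorem hasDerivAt_firstIntegrals (hm : ∀ i, 0 < m i) {γ : ℝ → State} {t s : ℝ}
    (hγ : HasDerivAt γ (s • vectorField m (γ t)) t) (hinj : Function.Injective (γ t).1)
    (hmom : ∑ i, (γ t).2 i = 0) : HasDerivAt (fun t => firstIntegrals m (γ t)) 0 t := by
  have h1 := ((contDiffAt_firstIntegrals (m := m) hinj).differentiableAt
    (by norm_num)).hasFDerivAt.comp_hasDerivAt t hγ
  rw [fderiv_firstIntegrals hinj, momentumDeriv_smul_vectorField,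
    energyDeriv_smul_vectorField] at h1
  convert! h1 using 1
  have h2 : ∑ i, m i • (s • vectorField m (γ t)).1 i = 0 := by
    rw [← smul_zero s, ← hmom, Finset.smul_sum]
    refine Finset.sum_congr rfl fun i _ => ?_
    simp only [vectorField_eq, Prod.smul_fst, Pi.smul_apply]
    rw [smul_comm, smul_inv_smul₀ (hm i).ne']
  have h3 : ∑ i, (s • vectorField m (γ t)).2 i = 0 := by
    simp only [vectorField_eq, Prod.smul_snd, Pi.smul_apply]
    rw [← Finset.smul_sum, sum_force, smul_zero]
  rw [h2, h3]
  rfl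

theorem IsMotion.firstIntegrals_eq (hm : ∀ i, 0 < m i) {γ : ℝ → State} (hγ : IsMotion m γ)
    (t : ℝ) : firstIntegrals m (γ t) = firstIntegrals m (γ 0) := by
  have h : ∀ t, HasDerivAt (fun t => firstIntegrals m (γ t)) 0 t := fun t =>
    hasDerivAt_firstIntegrals hm (s := 1) (by rw [one_smul]; exact (hγ t).2) (hγ t).1.1 (hγ t).1.2.2
  exact is_const_of_deriv_eq_zero (fun t => (h t).differentiableAt) (fun t => (h t).deriv) t 0

theorem IsMotion.mem_momentumLevel (hm : ∀ i, 0 < m i) {γ : ℝ → State} (hγ : IsMotion m γ)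
    {t₀ : ℝ} (h0 : γ t₀ ∈ momentumLevel m L) (t : ℝ) : γ t ∈ momentumLevel m L := by
  have h := (hγ.firstIntegrals_eq hm t).trans (hγ.firstIntegrals_eq hm t₀).symm
  rw [firstIntegrals_of_mem h0] at h
  exact (mem_momentumLevel_of_firstIntegrals (hγ t).1.1 h).1

/-- A curve whose first integrals differ from those of the boundary of a closed set without
collisions cannot leave this set. -/
theorem mem_of_firstIntegrals_notMem_frontier (hm : ∀ i, 0 < m i) {N : Set State}
    (hN : IsClosed N) (hinj : ∀ z ∈ N, Function.Injective z.1) {γ : ℝ → State} {s : ℝ → ℝ}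
    (hγ : ∀ t, HasDerivAt γ (s t • vectorField m (γ t)) t) (h0 : γ 0 ∈ N)
    (hmom : ∑ i, (γ 0).2 i = 0)
    (hfr : firstIntegrals m (γ 0) ∉ firstIntegrals m '' frontier N) (t : ℝ) :
    γ t ∈ N ∧ firstIntegrals m (γ t) = firstIntegrals m (γ 0) := by
  have hcont : Continuous γ := continuous_iff_continuousAt.2 fun t => (hγ t).continuousAt
  have hmomt : ∀ t, ∑ i, (γ t).2 i = 0 := by
    have h : ∀ t, HasDerivAt (fun t => ∑ i, (γ t).2 i) 0 t := by
      intro t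
      have h1 := HasDerivAt.fun_sum (u := Finset.univ) fun i _ => hasDerivAt_snd_apply (hγ t) i
      convert! h1 using 1
      simp only [vectorField_eq, Prod.smul_snd, Pi.smul_apply]
      rw [← Finset.smul_sum, sum_force, smul_zero]
    intro t
    rw [← hmom]
    exact is_const_of_deriv_eq_zero (fun t => (h t).differentiableAt) (fun t => (h t).deriv) t 0
  have hclN : IsClosed (N ∩ firstIntegrals m ⁻¹' {firstIntegrals m (γ 0)}) :=
    ContinuousOn.preimage_isClosed_of_isClosed (fun z hz =>
      (contDiffAt_firstIntegrals (hinj z hz)).continuousAt.continuousWithinAt) hN isClosed_singleton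
  -- The times at which the curve is in `N` with its initial integrals form a clopen set: such
  -- points are interior to `N`, and near them the integrals are locally constant.
  have hopen : IsOpen (γ ⁻¹' (N ∩ firstIntegrals m ⁻¹' {firstIntegrals m (γ 0)})) := by
    rw [isOpen_iff_mem_nhds]
    rintro t ⟨h1, h2⟩
    have h3 : γ t ∈ interior N := by
      by_contra h4
      exact hfr ⟨γ t, ⟨subset_closure h1, h4⟩, h2⟩
    obtain ⟨ε, hε, hball⟩ := Metric.isOpen_iff.1 (isOpen_interior.preimage hcont) t h3
    filter_upwards [Metric.ball_mem_nhds t hε] with u hu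
    refine ⟨interior_subset (hball hu), ?_⟩
    have hd : ∀ v ∈ Metric.ball t ε, HasDerivAt (fun t => firstIntegrals m (γ t)) 0 v := fun v hv =>
      hasDerivAt_firstIntegrals hm (hγ v) (hinj _ (interior_subset (hball hv))) (hmomt v)
    have heq := (convex_ball t ε).is_const_of_fderivWithin_eq_zero
      (fun v hv => (hd v hv).differentiableAt.differentiableWithinAt)
      (fun v hv => by
        rw [fderivWithin_of_isOpen Metric.isOpen_ball hv]
        refine ContinuousLinearMap.ext_ring ?_
        simpa using (hd v hv).deriv) hu (Metric.mem_ball_self hε)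
    exact heq.trans h2
  have huniv := IsClopen.eq_univ ⟨hclN.preimage hcont, hopen⟩ ⟨0, h0, rfl⟩
  have ht : t ∈ γ ⁻¹' (N ∩ firstIntegrals m ⁻¹' {firstIntegrals m (γ 0)}) := by
    rw [huniv]; trivial
  exact ht

/-- Existence for all time of a motion that starts in a compact set without collisions which it
cannot leave. -/
theorem exists_isMotion_of_firstIntegrals_notMem_frontier (hm : ∀ i, 0 < m i) {N : Set State}
    (hN : IsCompact N) (hinj : ∀ z ∈ N, Function.Injective z.1) (hw : w ∈ N)
    (hwP : w ∈ phaseSpace m) (hfr : firstIntegrals m w ∉ firstIntegrals m '' frontier N) :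
    ∃ γ, IsMotion m γ ∧ γ 0 = w := by
  obtain ⟨δ, hδ, hsub⟩ := hN.exists_cthickening_subset_open isOpen_injective hinj
  -- The cut-off is 1 on `N` and 0 outside a collision-free thickening, which makes the field
  -- bounded and Lipschitz. Its solution never leaves `N`, so it solves the original equation.
  obtain ⟨f, hf, -, hf0, hf1⟩ := exists_contMDiff_zero_iff_one_iff_of_isClosed (n := 1)
    (modelWithCornersSelf ℝ State)
    (Metric.isOpen_thickening (δ := δ) (E := N)).isClosed_compl hN.isClosed
    (disjoint_compl_left_iff_subset.2 (Metric.self_subset_thickening hδ N))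
  rw [contMDiff_iff_contDiff] at hf
  have hsupp : tsupport f ⊆ Metric.cthickening δ N := by
    refine closure_minimal ?_ Metric.isClosed_cthickening
    intro x hx
    by_contra hx'
    exact hx ((hf0 x).1 fun h => hx' (Metric.thickening_subset_cthickening _ _ h))
  have hcs : HasCompactSupport f := hN.cthickening.of_isClosed_subset (isClosed_tsupport f) hsupp
  have hXs : HasCompactSupport (fun z => f z • vectorField m z) := hcs.smul_right
  have hX : ContDiff ℝ 1 (fun z => f z • vectorField m z) := by
    rw [contDiff_iff_contDiffAt]
    intro z
    by_cases hz : z ∈ tsupport f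
    · exact hf.contDiffAt.smul (contDiffAt_vectorField (hsub (hsupp hz)))
    · refine contDiffAt_const (c := (0 : State)) |>.congr_of_eventuallyEq ?_
      filter_upwards [notMem_tsupport_iff_eventuallyEq.1 hz] with x hx
      rw [hx, Pi.zero_apply, zero_smul]
  obtain ⟨K, hK⟩ := hX.lipschitzWith_of_hasCompactSupport hXs (by norm_num)
  obtain ⟨B, hB⟩ := hXs.exists_bound_of_continuous hX.continuous
  obtain ⟨γ, h0, hγ⟩ := exists_global_integralCurve hK hB w
  have hmem := mem_of_firstIntegrals_notMem_frontier hm hN.isClosed hinj (γ := γ)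
    (s := fun t => f (γ t)) hγ (by rwa [h0]) (by rw [h0]; exact hwP.2.2) (by rwa [h0])
  refine ⟨γ, fun t => ⟨?_, ?_⟩, h0⟩
  · obtain ⟨h1, h2⟩ := hmem t
    simp only [h0, firstIntegrals, Prod.mk.injEq] at h2
    exact ⟨hinj _ h1, h2.1.trans hwP.2.1, h2.2.1.trans hwP.2.2⟩
  · have := hγ t
    rwa [(hf1 _).1 (hmem t).1, one_smul] at this

end

section

/-! ### Rotations and motions -/

variable {m : Fin 3 → ℝ} {L R : Matrix (Fin 4) (Fin 4) ℝ} {z w : State}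

theorem isCompact_specialOrthogonalGroup :
    IsCompact (Matrix.specialOrthogonalGroup (Fin 4) ℝ : Set (Matrix (Fin 4) (Fin 4) ℝ)) := by
  have hbox : IsCompact (Set.pi univ fun _ : Fin 4 => Set.pi univ fun _ : Fin 4 =>
      Icc (-1 : ℝ) 1) := isCompact_univ_pi fun _ => isCompact_univ_pi fun _ => isCompact_Icc
  have heq : (Matrix.specialOrthogonalGroup (Fin 4) ℝ : Set (Matrix (Fin 4) (Fin 4) ℝ)) =
      {R | R.transpose * R = 1} ∩ {R | R.det = 1} := by
    ext R
    exact ⟨fun h => ⟨transpose_mul_self_of_mem h, (Matrix.mem_specialOrthogonalGroup_iff.1 h).2⟩,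
      fun h => mem_specialOrthogonalGroup h.1 h.2⟩
  refine hbox.of_isClosed_subset ?_ ?_
  · rw [heq]
    exact (isClosed_eq (by fun_prop) continuous_const).inter
      (isClosed_eq (by fun_prop) continuous_const)
  · intro R hR i _ j _
    have h := entry_norm_bound_of_unitary (𝕜 := ℝ) (Matrix.mem_specialOrthogonalGroup_iff.1 hR).1 i j
    exact abs_le.1 h

theorem transpose_mem (hR : R ∈ Matrix.specialOrthogonalGroup (Fin 4) ℝ) :
    R.transpose ∈ Matrix.specialOrthogonalGroup (Fin 4) ℝ := by
  refine mem_specialOrthogonalGroup ?_ ?_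
  · rw [Matrix.transpose_transpose]
    exact mul_eq_one_comm.1 (transpose_mul_self_of_mem hR)
  · rw [Matrix.det_transpose, (Matrix.mem_specialOrthogonalGroup_iff.1 hR).2]

theorem rotate_transpose_rotate (hR : R ∈ Matrix.specialOrthogonalGroup (Fin 4) ℝ) (z : State) :
    rotate R.transpose (rotate R z) = z := by
  rw [← rotate_mul, transpose_mul_self_of_mem hR, rotate_one]

theorem rotate_rotate_transpose (hR : R ∈ Matrix.specialOrthogonalGroup (Fin 4) ℝ) (z : State) :
    rotate R (rotate R.transpose z) = z := by
  rw [← rotate_mul, mul_eq_one_comm.1 (transpose_mul_self_of_mem hR), rotate_one]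

theorem continuous_rotate (R : Matrix (Fin 4) (Fin 4) ℝ) : Continuous (rotate R) := by
  have h : rotate R = fun z => (fun i => act R (z.1 i), fun i => act R (z.2 i)) :=
    funext (rotate_eq R)
  rw [h]
  fun_prop

theorem continuous_rotate_left (z : State) :
    Continuous fun R : Matrix (Fin 4) (Fin 4) ℝ => rotate R z := by
  unfold rotate
  fun_prop

theorem vectorField_rotate (hR : R.transpose * R = 1) (z : State) :
    vectorField m (rotate R z) = rotate R (vectorField m z) := by
  simp only [vectorField, rotate_eq, map_sum, map_smul, ← map_sub, norm_act hR]

theorem hasDerivAt_rotate {γ : ℝ → State} {δ : State} {t : ℝ} (h : HasDerivAt γ δ t)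
    (R : Matrix (Fin 4) (Fin 4) ℝ) : HasDerivAt (fun t => rotate R (γ t)) (rotate R δ) t := by
  simp only [rotate_eq]
  exact (hasDerivAt_pi.2 fun i =>
    (act R).hasFDerivAt.comp_hasDerivAt t (hasDerivAt_fst_apply h i)).prodMk
    (hasDerivAt_pi.2 fun i => (act R).hasFDerivAt.comp_hasDerivAt t (hasDerivAt_snd_apply h i))

theorem IsMotion.rotate {γ : ℝ → State} (hγ : IsMotion m γ) (hR : R.transpose * R = 1) :
    IsMotion m fun t => ThreeBody.rotate R (γ t) := fun t =>
  ⟨rotate_mem_phaseSpace hR (hγ t).1, by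
    rw [vectorField_rotate hR]
    exact hasDerivAt_rotate (hγ t).2 R⟩

/-- A rotation that takes one state of the set into the set preserves the set. -/
def IsRotationStable (S : Set State) : Prop :=
  ∀ R ∈ Matrix.specialOrthogonalGroup (Fin 4) ℝ, ∀ w ∈ S, rotate R w ∈ S → ∀ u ∈ S, rotate R u ∈ S

theorem isRotationStable_phaseSpace (m : Fin 3 → ℝ) : IsRotationStable (phaseSpace m) :=
  fun _ hR _ _ _ _ hu => rotate_mem_phaseSpace (transpose_mul_self_of_mem hR) hu

theorem isRotationStable_momentumLevel (m : Fin 3 → ℝ) (L : Matrix (Fin 4) (Fin 4) ℝ) :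
    IsRotationStable (momentumLevel m L) := by
  rintro R hR w ⟨-, hw⟩ ⟨-, hw'⟩ u ⟨hu, hu'⟩
  refine ⟨rotate_mem_phaseSpace (transpose_mul_self_of_mem hR) hu, ?_⟩
  rw [angularMomentum_rotate, hu', ← hw, ← angularMomentum_rotate, hw', hw]

theorem IsRotationStable.transpose {S : Set State} (hS : IsRotationStable S)
    (hR : R ∈ Matrix.specialOrthogonalGroup (Fin 4) ℝ) (hw : w ∈ S) (hRw : rotate R w ∈ S)
    {u : State} (hu : u ∈ S) : rotate R.transpose u ∈ S :=
  hS _ (transpose_mem hR) _ hRw (by rwa [rotate_transpose_rotate hR]) _ hu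

theorem toReduced_eq_iff {S : Set State} {z w : S} : toReduced S z = toReduced S w ↔
    ∃ R ∈ Matrix.specialOrthogonalGroup (Fin 4) ℝ, rotate R z.1 = w.1 :=
  Quotient.eq

/-- The class map is open. -/
theorem image_toReduced_mem_nhds {S : Set State} (hS : IsRotationStable S) (z : S) {V : Set State}
    (hV : V ∈ 𝓝 z.1) : toReduced S '' (Subtype.val ⁻¹' V) ∈ 𝓝 (toReduced S z) := by
  obtain ⟨V', hV', hopen, hz⟩ := mem_nhds_iff.1 hV
  refine mem_nhds_iff.2 ⟨toReduced S '' (Subtype.val ⁻¹' V'),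
    image_mono (preimage_mono hV'), ?_, z, hz, rfl⟩
  change IsOpen ((Quotient.mk (orbitSetoid S)) ⁻¹' (toReduced S '' (Subtype.val ⁻¹' V')))
  rw [isOpen_iff_mem_nhds]
  rintro w ⟨v, hv, hvw⟩
  obtain ⟨R, hR, hRv⟩ := toReduced_eq_iff.1 (hvw : toReduced S v = toReduced S w)
  have hw : rotate R.transpose w.1 = v.1 := by rw [← hRv, rotate_transpose_rotate hR]
  have hnear : ∀ᶠ u : S in 𝓝 w, rotate R.transpose u.1 ∈ V' :=
    ((continuous_rotate _).comp continuous_subtype_val).continuousAt.eventually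
      (hopen.mem_nhds (by rw [Function.comp_apply, hw]; exact hv))
  filter_upwards [hnear] with u hu
  exact ⟨⟨_, hS.transpose hR v.2 (by rw [hRv]; exact w.2) u.2⟩, hu,
    toReduced_eq_iff.2 ⟨R, hR, rotate_rotate_transpose hR _⟩⟩

/-- Lyapunov stability in the quotient follows from trapping near the orbit. -/
theorem isReducedStable_of_trap {S : Set State} (hS : IsRotationStable S)
    (hSP : S ⊆ phaseSpace m)
    (hflow : ∀ γ, IsMotion m γ → γ 0 ∈ S → ∀ t, γ t ∈ S) (z : S)
    (htrap : ∀ G, IsOpen G →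
      (∀ R ∈ Matrix.specialOrthogonalGroup (Fin 4) ℝ, rotate R z.1 ∈ S → rotate R z.1 ∈ G) →
      ∃ V ∈ 𝓝 z.1, ∀ w ∈ V ∩ phaseSpace m, (∃ γ, IsMotion m γ ∧ γ 0 = w) ∧
        ∀ γ, IsMotion m γ → γ 0 = w → ∀ t, γ t ∈ G) : IsReducedStable m S z := by
  intro U hU
  obtain ⟨U', hUU', hopen, hz⟩ := mem_nhds_iff.1 hU
  obtain ⟨G, hG, hGU⟩ := isOpen_induced_iff.1
    (hopen.preimage (continuous_quotient_mk' (s := orbitSetoid S)))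
  have hmemG : ∀ u : S, u.1 ∈ G ↔ toReduced S u ∈ U' := fun u => by
    have := Set.ext_iff.1 hGU u
    exact this
  obtain ⟨V, hV, hVtrap⟩ := htrap G hG fun R hR hRz => by
    rw [hmemG ⟨_, hRz⟩, ← toReduced_eq_iff.2 ⟨R, hR, rfl⟩]
    exact hz
  refine ⟨_, image_toReduced_mem_nhds hS z hV, ?_⟩
  rintro w ⟨v, hv, hvw⟩
  obtain ⟨R, hR, hRv⟩ := toReduced_eq_iff.1 hvw
  obtain ⟨⟨γ, hγ, hγ0⟩, hstay⟩ := hVtrap v.1 ⟨hv, hSP v.2⟩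
  -- Classes near that of `z` have representatives near `z` itself; motions are carried over by the
  -- rotation `R`.
  refine ⟨⟨_, hγ.rotate (transpose_mul_self_of_mem hR), by simp only [hγ0, hRv]⟩, ?_⟩
  intro β hβ hβ0 t
  have hβS := hflow β hβ (by rw [hβ0]; exact w.2)
  have hβ' := hβ.rotate (transpose_mul_self_of_mem (transpose_mem hR))
  have h0 : rotate R.transpose (β 0) = v.1 := by rw [hβ0, ← hRv, rotate_transpose_rotate hR]
  have h1 := hstay _ hβ' h0 t
  have h2 := hflow _ hβ' (by rw [h0]; exact v.2) t
  refine ⟨hβS t, hUU' ?_⟩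
  rw [hmemG ⟨_, h2⟩] at h1
  convert! h1 using 1
  exact (toReduced_eq_iff.2 ⟨R, hR, rotate_rotate_transpose hR _⟩).symm

/-! ### Minima of the energy -/

theorem IsLocalMinOn.rotate (hmin : IsLocalMinOn (energy m) (momentumLevel m L) z)
    (hz : z ∈ momentumLevel m L) (hR : R ∈ Matrix.specialOrthogonalGroup (Fin 4) ℝ)
    (hRz : ThreeBody.rotate R z ∈ momentumLevel m L) :
    IsLocalMinOn (energy m) (momentumLevel m L) (ThreeBody.rotate R z) := by
  have h1 : ∀ᶠ u in 𝓝 z, u ∈ momentumLevel m L → energy m z ≤ energy m u :=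
    eventually_nhdsWithin_iff.1 hmin
  refine eventually_nhdsWithin_iff.2 ?_
  have h2 : Tendsto (ThreeBody.rotate R.transpose) (𝓝 (ThreeBody.rotate R z)) (𝓝 z) := by
    have := (continuous_rotate R.transpose).tendsto (ThreeBody.rotate R z)
    rwa [rotate_transpose_rotate hR] at this
  filter_upwards [h2.eventually h1] with u hu huL
  have h3 := hu ((isRotationStable_momentumLevel m L).transpose hR hz hRz huL)
  rwa [energy_rotate (transpose_mul_self_of_mem (transpose_mem hR)),
    ← energy_rotate (transpose_mul_self_of_mem hR) z] at h3

theorem exists_isRelEq_of_isLocalMinOn (hm : ∀ i, 0 < m i) (hL : IsUnit L)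
    (hz : z ∈ momentumLevel m L) (hmin : IsLocalMinOn (energy m) (momentumLevel m L) z) :
    ∃ Ω, IsRelEq m Ω z :=
  exists_isRelEq_of_not_isRegularPoint hm hz.1 (by rwa [hz.2])
    (not_isRegularPoint_of_isLocalMinOn hz hmin)

/-- A nearby state on the same level with the minimal energy is itself a local minimum, hence a
relative equilibrium, and these are isolated up to rotation. -/
theorem eventually_mem_orbit_of_energy_eq (hm : ∀ i, 0 < m i) (hL : IsUnit L)
    (hz : z ∈ momentumLevel m L) (hmin : IsLocalMinOn (energy m) (momentumLevel m L) z) :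
    ∀ᶠ v in 𝓝 z, v ∈ momentumLevel m L → energy m v = energy m z →
      ∃ R ∈ Matrix.specialOrthogonalGroup (Fin 4) ℝ, rotate R z = v := by
  obtain ⟨Ω, hΩ⟩ := exists_isRelEq_of_isLocalMinOn hm hL hz hmin
  have h1 : ∀ᶠ u in 𝓝 z, u ∈ momentumLevel m L → energy m z ≤ energy m u :=
    eventually_nhdsWithin_iff.1 hmin
  filter_upwards [hΩ.isolated hm hL hz, h1.eventually_nhds] with v hv hv1 hvL hvE
  refine hv hvL (exists_isRelEq_of_isLocalMinOn hm hL hvL (eventually_nhdsWithin_iff.2 ?_))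
  filter_upwards [hv1] with u hu huL
  rw [hvE]
  exact hu huL

/-- Motions that start near a minimum of the energy at fixed angular momentum stay near its
orbit. -/
theorem exists_trap (hm : ∀ i, 0 < m i) (hL : IsUnit L)
    (hz : z ∈ momentumLevel m L) (hmin : IsLocalMinOn (energy m) (momentumLevel m L) z)
    {G : Set State} (hG : IsOpen G) (hzG : ∀ R ∈ Matrix.specialOrthogonalGroup (Fin 4) ℝ,
      rotate R z ∈ momentumLevel m L → rotate R z ∈ G) :
    ∃ N ⊆ G, IsCompact N ∧ (∀ u ∈ N, Function.Injective u.1) ∧ ∃ V ∈ 𝓝 z, V ⊆ N ∧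
      ∀ w ∈ V ∩ phaseSpace m, (∃ γ, IsMotion m γ ∧ γ 0 = w) ∧
        ∀ γ, IsMotion m γ → γ 0 = w → ∀ t, γ t ∈ N := by
  set O : Set State := (fun R => rotate R z) ''
    (Matrix.specialOrthogonalGroup (Fin 4) ℝ ∩ {R | R * L * R.transpose = L}) with hO
  have hOmem : ∀ R ∈ Matrix.specialOrthogonalGroup (Fin 4) ℝ,
      rotate R z ∈ momentumLevel m L → rotate R z ∈ O := by
    intro R hR h
    refine ⟨R, ⟨hR, ?_⟩, rfl⟩
    rw [mem_ofPred_eq, ← hz.2, ← angularMomentum_rotate, h.2, hz.2]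
  have hOL : ∀ u ∈ O, ∃ R ∈ Matrix.specialOrthogonalGroup (Fin 4) ℝ, rotate R z = u ∧
      u ∈ momentumLevel m L := by
    rintro _ ⟨R, ⟨hR, hR'⟩, rfl⟩
    refine ⟨R, hR, rfl, rotate_mem_phaseSpace (transpose_mul_self_of_mem hR) hz.1, ?_⟩
    rw [angularMomentum_rotate, hz.2, hR']
  have hOc : IsCompact O := by
    refine (isCompact_specialOrthogonalGroup.inter_right ?_).image (continuous_rotate_left z)
    exact isClosed_eq (by fun_prop) continuous_const
  set A : Set State := {v | v ∈ momentumLevel m L → energy m v = energy m z → v ∈ O} with hA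
  have hOA : O ⊆ interior A := by
    intro u hu
    obtain ⟨R, hR, rfl, huL⟩ := hOL u hu
    rw [mem_interior_iff_mem_nhds]
    filter_upwards [eventually_mem_orbit_of_energy_eq hm hL huL
      (IsLocalMinOn.rotate hmin hz hR huL)] with v hv hvL hvE
    rw [energy_rotate (transpose_mul_self_of_mem hR)] at hv
    obtain ⟨R', hR', rfl⟩ := hv hvL hvE
    rw [← rotate_mul] at hvL ⊢
    exact hOmem _ (mul_mem hR' hR) hvL
  obtain ⟨δ, hδ, hsub⟩ := hOc.exists_cthickening_subset_open
    ((hG.inter isOpen_injective).inter isOpen_interior) (t := (G ∩ _) ∩ interior A) (by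
      intro u hu
      obtain ⟨R, hR, rfl, huL⟩ := hOL u hu
      exact ⟨⟨hzG R hR huL, huL.1.1⟩, hOA hu⟩)
  -- Within `N` there are no collisions, and only the points of the orbit `O` have the first
  -- integrals of `z`. As `O` is interior to `N`, no boundary point does.
  set N := Metric.cthickening δ O with hN
  have hNc : IsCompact N := hOc.cthickening
  have hinj : ∀ u ∈ N, Function.Injective u.1 := fun u hu => (hsub hu).1.2
  have hzO : z ∈ O := by
    have := hOmem 1 (one_mem _) (by rwa [rotate_one])
    rwa [rotate_one] at this
  have hOint : O ⊆ interior N := fun u hu =>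
    mem_interior.2 ⟨_, Metric.thickening_subset_cthickening δ O, Metric.isOpen_thickening,
      Metric.self_subset_thickening hδ O hu⟩
  have hfrc : IsClosed (firstIntegrals m '' frontier N) :=
    ((hNc.of_isClosed_subset isClosed_frontier hNc.isClosed.frontier_subset).image_of_continuousOn
      fun u hu => (contDiffAt_firstIntegrals
        (hinj u (hNc.isClosed.frontier_subset hu))).continuousAt.continuousWithinAt).isClosed
  have hzfr : firstIntegrals m z ∉ firstIntegrals m '' frontier N := by
    rintro ⟨u, hu, huz⟩
    have huN := hNc.isClosed.frontier_subset hu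
    rw [firstIntegrals_of_mem hz] at huz
    obtain ⟨h1, h2⟩ := mem_momentumLevel_of_firstIntegrals (hinj u huN) huz
    exact hu.2 (hOint (interior_subset (hsub huN).2 h1 h2))
  -- No condition fixes the angular momentum of `w`: the boundary values form a closed set, so all
  -- integrals may vary a little.
  have hV : {w | w ∈ N ∧ firstIntegrals m w ∉ firstIntegrals m '' frontier N} ∈ 𝓝 z :=
    (mem_interior_iff_mem_nhds.1 (hOint hzO)) |> fun h => Filter.inter_mem h
      ((contDiffAt_firstIntegrals hz.1.1).continuousAt.eventually (hfrc.isOpen_compl.mem_nhds hzfr))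
  refine ⟨N, fun u hu => (hsub hu).1.1, hNc, hinj, _, hV, fun w hw => hw.1, ?_⟩
  rintro w ⟨⟨hwN, hwfr⟩, hwP⟩
  refine ⟨exists_isMotion_of_firstIntegrals_notMem_frontier hm hNc hinj hwN hwP hwfr, ?_⟩
  rintro γ hγ rfl t
  exact (mem_of_firstIntegrals_notMem_frontier hm hNc.isClosed hinj (s := fun _ => 1)
    (fun t => by rw [one_smul]; exact (hγ t).2) hwN hwP.2.2 hwfr t).1

/-- A uniform lower bound of the mutual distances on a compact set without collisions. -/
theorem exists_le_norm_sub {N : Set State} (hN : IsCompact N)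
    (hinj : ∀ u ∈ N, Function.Injective u.1) :
    ∃ r > 0, ∀ u ∈ N, ∀ i j, i ≠ j → r ≤ ‖u.1 i - u.1 j‖ := by
  rcases N.eq_empty_or_nonempty with rfl | hne
  · exact ⟨1, one_pos, by simp⟩
  have h : ∀ k, ∃ u ∈ N, IsMinOn (fun u : State => ‖side u.1 k‖) N u := fun k =>
    hN.exists_isMinOn hne (continuous_side k).norm.continuousOn
  choose u hu hmin using h
  obtain ⟨k₀, -, hk₀⟩ := Finset.exists_min_image Finset.univ
    (fun k => ‖side (u k).1 k‖) ⟨0, Finset.mem_univ _⟩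
  refine ⟨‖side (u k₀).1 k₀‖, norm_pos_iff.2 (side_ne_zero (hinj _ (hu k₀)) k₀), ?_⟩
  intro v hv i j hij
  obtain ⟨k, hk⟩ := exists_side_eq (q := v.1) hij
  have h1 : ‖v.1 i - v.1 j‖ = ‖side v.1 k‖ := by
    rcases hk with hk | hk <;> rw [hk]
    exact norm_neg _
  rw [h1]
  exact (hk₀ k (Finset.mem_univ _)).trans (hmin k hv)

end

section

/-! ### Relative equilibria are uniform rotations -/

variable {m : Fin 3 → ℝ} {L Ω : Matrix (Fin 4) (Fin 4) ℝ} {z : State}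

section

attribute [local instance] Matrix.linftyOpNormedRing Matrix.linftyOpNormedAlgebra

theorem hasDerivAt_exp_apply (Ω : Matrix (Fin 4) (Fin 4) ℝ) (i j : Fin 4) (t : ℝ) :
    HasDerivAt (fun t : ℝ => NormedSpace.exp (t • Ω) i j) ((NormedSpace.exp (t • Ω) * Ω) i j) t :=
  (LinearMap.toContinuousLinearMap (Matrix.entryLinearMap ℝ ℝ i j)).hasFDerivAt.comp_hasDerivAt t
    (hasDerivAt_exp_smul_const (𝕂 := ℝ) Ω t)

end

theorem hasDerivAt_act_exp (Ω : Matrix (Fin 4) (Fin 4) ℝ) (x : Space) (t : ℝ) :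
    HasDerivAt (fun t : ℝ => act (NormedSpace.exp (t • Ω)) x)
      (act (NormedSpace.exp (t • Ω)) (act Ω x)) t := by
  rw [← act_mul]
  simp only [act_ofLp]
  exact (PiLp.continuousLinearEquiv 2 ℝ fun _ : Fin 4 => ℝ).symm.hasFDerivAt.comp_hasDerivAt t
    (hasDerivAt_pi.2 fun i => by
      simp only [Matrix.mulVec, dotProduct]
      exact HasDerivAt.fun_sum fun j _ => (hasDerivAt_exp_apply Ω i j t).mul_const (x j))

theorem transpose_exp_mul_exp (hΩ : Ω.transpose = -Ω) (t : ℝ) :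
    (NormedSpace.exp (t • Ω)).transpose * NormedSpace.exp (t • Ω) = 1 := by
  rw [← Matrix.exp_transpose, Matrix.transpose_smul, hΩ, smul_neg, Matrix.exp_neg]
  exact Matrix.nonsing_inv_mul _ ((Matrix.isUnit_iff_isUnit_det _).1 (Matrix.isUnit_exp _))

theorem IsRelEq.isMotion (h : IsRelEq m Ω z) (hm : ∀ i, 0 < m i) (hz : z ∈ phaseSpace m) :
    IsMotion m (uniformRotation Ω z) := by
  intro t
  have hR := transpose_exp_mul_exp h.skew t
  refine ⟨rotate_mem_phaseSpace hR hz, ?_⟩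
  have hv : vectorField m z = (fun i => act Ω (z.1 i), fun i => act Ω (z.2 i)) := by
    rw [vectorField_eq]
    refine Prod.ext (funext fun i => ?_) (funext fun i => h.balance i)
    simp only [h.mom, inv_smul_smul₀ (hm i).ne']
  unfold uniformRotation
  rw [vectorField_rotate hR, hv]
  exact (hasDerivAt_pi.2 fun i => hasDerivAt_act_exp Ω (z.1 i) t).prodMk
    (hasDerivAt_pi.2 fun i => hasDerivAt_act_exp Ω (z.2 i) t)

theorem Submodule.mem_of_hasDerivAt (S : Submodule ℝ Space) {f : ℝ → Space} {f' : Space} {t : ℝ}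
    (hf : ∀ t, f t ∈ S) (h : HasDerivAt f f' t) : f' ∈ S := by
  refine S.closed_of_finiteDimensional.mem_of_tendsto (hasDerivAt_iff_tendsto_slope.1 h)
    (Eventually.of_forall fun s => ?_)
  rw [slope_def_module]
  exact S.smul_mem _ (S.sub_mem (hf s) (hf t))

theorem act_colMatrix (X P Y Q v : Space) :
    act (colMatrix X P Y Q) v = v 0 • X + v 1 • P + v 2 • Y + v 3 • Q := by
  ext i
  simp [act_ofLp, Matrix.mulVec, dotProduct, colMatrix, Fin.sum_univ_four]
  ring

/-- The span of the trajectories also contains the velocities, hence all four Jacobi vectors, which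
form a basis because the Pfaffian is not zero. -/
theorem IsRelEq.motionDim_eq (h : IsRelEq m Ω z) (hm : ∀ i, 0 < m i)
    (hz : z ∈ phaseSpace m) (hL : IsUnit (angularMomentum z)) :
    motionDim (uniformRotation Ω z) = 4 := by
  set S := Submodule.span ℝ {x : Space | ∃ t i, (uniformRotation Ω z t).1 i = x} with hS
  have hmem : ∀ t i, act (NormedSpace.exp (t • Ω)) (z.1 i) ∈ S := fun t i =>
    Submodule.subset_span ⟨t, i, rfl⟩
  have hq : ∀ i, z.1 i ∈ S := fun i => by
    have := hmem 0 i
    rwa [zero_smul, NormedSpace.exp_zero, act_one] at this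
  have hp : ∀ i, act Ω (z.1 i) ∈ S := fun i => by
    have := Submodule.mem_of_hasDerivAt S (fun t => hmem t i) (hasDerivAt_act_exp Ω (z.1 i) 0)
    rwa [zero_smul, NormedSpace.exp_zero, act_one] at this
  have hX : ∀ c, jacobiPos m c z ∈ S := fun c =>
    S.sum_mem fun i _ => S.smul_mem _ (hq i)
  have hP : ∀ c, jacobiMom c z ∈ S := fun c => by
    rw [h.jacobiMom_eq, jacobiPos, map_sum]
    exact S.sum_mem fun i _ => by rw [map_smul]; exact S.smul_mem _ (hp i)
  have htop : S = ⊤ := by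
    obtain ⟨a, b, hf⟩ := exists_massFrame hm
    have hpf := pfaffian_ne_zero hm hz hL
    rw [hf.angularMomentum_eq hz, pfaffian_wedge_add_wedge] at hpf
    rw [eq_top_iff]
    rintro y -
    rw [← act_one y, ← Matrix.mul_nonsing_inv _ (isUnit_iff_ne_zero.2 hpf), act_mul,
      act_colMatrix]
    exact S.add_mem (S.add_mem (S.add_mem (S.smul_mem _ (hX a)) (S.smul_mem _ (hP a)))
      (S.smul_mem _ (hX b))) (S.smul_mem _ (hP b))
  rw [motionDim, ← hS, htop, finrank_top, finrank_euclideanSpace, Fintype.card_fin]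

end

end ThreeBody

end

theorem mainTheorem2 (m : Fin 3 → ℝ) (hm : ∀ i, 0 < m i)
    (L : Matrix (Fin 4) (Fin 4) ℝ) (hL : L.transpose = -L) (hrank : L.rank = 4) :
    -- the energy has a minimum at fixed `L`, and just above it the integral manifolds are compact
    (∃ E₀ : ℝ, IsLeast (ThreeBody.energy m '' ThreeBody.momentumLevel m L) E₀ ∧
      ∃ ε > 0, ∀ E, E₀ < E → E < E₀ + ε →
        (ThreeBody.integralManifold m L E).Nonempty ∧
        IsCompact (ThreeBody.integralManifold m L E) ∧
        ∀ z ∈ ThreeBody.integralManifold m L E, ThreeBody.IsRegularPoint m z) ∧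
    -- each (local or global) minimum of the energy at fixed `L`
    (∀ z : ThreeBody.momentumLevel m L,
      IsLocalMinOn (ThreeBody.energy m) (ThreeBody.momentumLevel m L) z.1 →
      -- is a relative equilibrium with 4-dimensional motion
      (∃ Ω : Matrix (Fin 4) (Fin 4) ℝ, Ω.transpose = -Ω ∧
        ThreeBody.IsMotion m (ThreeBody.uniformRotation Ω z.1) ∧
        ThreeBody.motionDim (ThreeBody.uniformRotation Ω z.1) = 4) ∧
      -- is isolated among these minima in the fully reduced space
      (∃ U ∈ 𝓝 (ThreeBody.toReduced (ThreeBody.momentumLevel m L) z),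
        ∀ w : ThreeBody.momentumLevel m L,
          IsLocalMinOn (ThreeBody.energy m) (ThreeBody.momentumLevel m L) w.1 →
          ThreeBody.toReduced (ThreeBody.momentumLevel m L) w ∈ U →
          ThreeBody.toReduced (ThreeBody.momentumLevel m L) w =
            ThreeBody.toReduced (ThreeBody.momentumLevel m L) z) ∧
      -- is Lyapunov stable in the fully reduced system (`L` fixed),
      ThreeBody.IsReducedStable m (ThreeBody.momentumLevel m L) z ∧
      -- and also, with `L` free to vary, in the quotient of the phase space by `SO(4)`,
      ThreeBody.IsReducedStable m (ThreeBody.phaseSpace m) ⟨z.1, z.2.1⟩ ∧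
      -- and all nearby motions exist for all time, are bounded, and stay away from collisions
      (∃ W ∈ 𝓝 z.1, ∃ r > 0, ∃ C : ℝ, ∀ w ∈ W ∩ ThreeBody.phaseSpace m,
        (∃ γ, ThreeBody.IsMotion m γ ∧ γ 0 = w) ∧
        ∀ γ, ThreeBody.IsMotion m γ → γ 0 = w →
          ∀ t, ‖γ t‖ ≤ C ∧ ∀ i j, i ≠ j → r ≤ ‖(γ t).1 i - (γ t).1 j‖)) := by
  have hunit : IsUnit L := by
    rw [← Matrix.mulVec_surjective_iff_isUnit, ← Matrix.coe_mulVecLin, ← LinearMap.range_eq_top]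
    exact Submodule.eq_top_of_finrank_eq (by simpa [Matrix.rank] using hrank)
  refine ⟨ThreeBody.exists_isLeast_energy hm hL hunit, fun z hmin => ?_⟩
  obtain ⟨Ω, hΩ⟩ := ThreeBody.exists_isRelEq_of_isLocalMinOn hm hunit z.2 hmin
  refine ⟨⟨Ω, hΩ.skew, hΩ.isMotion hm z.2.1, hΩ.motionDim_eq hm z.2.1 (by rwa [z.2.2])⟩,
    ?_, ?_, ?_, ?_⟩
  · have hS := ThreeBody.isRotationStable_momentumLevel m L
    refine ⟨_, ThreeBody.image_toReduced_mem_nhds hS z (hΩ.isolated hm hunit z.2), ?_⟩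
    rintro w hw ⟨v, hv, hvw⟩
    obtain ⟨R, hR, hRv⟩ := ThreeBody.toReduced_eq_iff.1 hvw.symm
    have hvmin := ThreeBody.IsLocalMinOn.rotate hw w.2 hR (by rw [hRv]; exact v.2)
    rw [hRv] at hvmin
    rw [← hvw]
    exact (ThreeBody.toReduced_eq_iff.2
      (hv v.2 (ThreeBody.exists_isRelEq_of_isLocalMinOn hm hunit v.2 hvmin))).symm
  · refine ThreeBody.isReducedStable_of_trap (ThreeBody.isRotationStable_momentumLevel m L)
      (fun w hw => hw.1) (fun γ hγ h0 => hγ.mem_momentumLevel hm h0) z fun G hG hzG => ?_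
    obtain ⟨N, hNG, -, -, V, hV, -, htrap⟩ := ThreeBody.exists_trap hm hunit z.2 hmin hG hzG
    exact ⟨V, hV, fun w hw => ⟨(htrap w hw).1, fun γ hγ h0 t => hNG ((htrap w hw).2 γ hγ h0 t)⟩⟩
  · refine ThreeBody.isReducedStable_of_trap (ThreeBody.isRotationStable_phaseSpace m)
      subset_rfl (fun γ hγ _ t => (hγ t).1) _ fun G hG hzG => ?_
    -- The trap needs `G` to contain only the part of the `SO(4)`-orbit with angular momentum `L`,
    -- yet it holds starting states of every nearby angular momentum.
    obtain ⟨N, hNG, -, -, V, hV, -, htrap⟩ := ThreeBody.exists_trap hm hunit z.2 hmin hG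
      fun R hR hRz => hzG R hR hRz.1
    exact ⟨V, hV, fun w hw => ⟨(htrap w hw).1, fun γ hγ h0 t => hNG ((htrap w hw).2 γ hγ h0 t)⟩⟩
  · obtain ⟨N, -, hNc, hinj, V, hV, -, htrap⟩ := ThreeBody.exists_trap hm hunit z.2 hmin isOpen_univ
      fun _ _ _ => trivial
    obtain ⟨r, hr, hrN⟩ := ThreeBody.exists_le_norm_sub hNc hinj
    obtain ⟨C, hC⟩ := hNc.isBounded.exists_norm_le
    exact ⟨V, hV, r, hr, C, fun w hw => ⟨(htrap w hw).1, fun γ hγ h0 t =>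
      ⟨hC _ ((htrap w hw).2 γ hγ h0 t), hrN _ ((htrap w hw).2 γ hγ h0 t)⟩⟩⟩
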